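/- **Setting.** Let $J=\begin{pmatrix}0&0&0&-1\\0&1&0&0\\0&0&1&0\\-1&0&0&0\end{pmatrix}$, $\langle v,w\rangle=v^TJw$ on $\mathbb R^4$ (coordinates $u_0,\dots,u_3$, standard basis $e_1,\dots,e_4$), $G=SO(3,1)=\{g: g^TJg=J,\ \det g=1\}$ with Lie algebra $\mathfrak o(3,1)$, and $C_L=\{u\ne0:\langle u,u\rangle=0\}$ the light cone. Let $M$ be the projectivized cone (the conformal 2-sphere), $\Pi:C_L\to M$ the projection, with affine coordinates $(u_1/u_3,u_2/u_3)$ around $[e_4]$; let $H_L, H_M\subset G$ be the isotropy subgroups of $e_4\in C_L$ and $[e_4]\in M$. Fix a period $T>0$; "loop" means smooth $T$-periodic map on $\mathbb R$, integrals are over one period, and $D=d/dx$. All curves are smooth and have monodromy: $u(x+T)=g\cdot u(x)$ for some $g\in G$. *Invariants.* A non-radial curve $u$ in $C_L$ ($\|u'\|_J^2=\langle u',u'\rangle>0$) has the right moving frame $\rho_L:\mathbb R\to G$ given by $\rho_Lu=e_4$, $\rho_Lu'=\|u'\|_Je_2$ and the vanishing of the third coordinate of $\rho_Lu''$. Its invariants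 $\mathbf k=(k_0,k_1,k_2)$ are defined by $(\rho_L)_x\rho_L^{-1}=-K(\mathbf k)$, where $$K(k_0,k_1,k_2)=\begin{pmatrix}0&k_0&0&0\\k_1&0&0&k_0\\k_2&0&0&0\\0&k_1&k_2&0\end{pmatrix}.$$ A regular curve $m$ in $M$ has a right moving frame $\rho_M$ (unique up to sign) given by $\rho_M\cdot m=0$, $\rho_M\cdot m'=e_1$, $\rho_M\cdot m''=0$ for the prolonged action in affine coordinates (here $e_1=(1,0)$), and its invariants $\kappa=(\kappa_1,\kappa_2)$ are defined by $(\rho_M)_x\rho_M^{-1}=-K(1,\kappa_1,\kappa_2)$. Let $\mathcal K_L$, $\mathcal K_M$ be the sets of invariants of all such curves, and $\mathcal K_L^1=\{\mathbf k\in\mathcal K_L:k_0=1\}$ (invariants of curves parametrized by arc-length). *Brackets.* A functional on a space of maps has a variational derivative at a point if, along every smooth path through the point, it has derivative $\int\langle\text{variational derivative},\text{velocity}\rangle dx$; variational derivatives are loops, and the pairing is $\mathrm{trace}(XY)$ on $\mathfrak o(3,1)$ and the dot product on invariants. The loop group of $H=H_L$ (resp. $H_M$) acts by gauge transformations $L\mapsto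 gLg^{-1}-g_xg^{-1}$. The geometric bracket $\{h,f\}(\mathbf k)$ of functionals on $\mathcal K_L$ (resp. $\mathcal K_M$) is the value at $L=K(\mathbf k)$ (resp. $L=K(1,\kappa)$) of the first Lie–Poisson bracket $$\{\mathcal H,\mathcal F\}_1(L)=\int\mathrm{trace}\Big(\Big(\big(\tfrac{\delta\mathcal H}{\delta L}\big)_x+\big[L,\tfrac{\delta\mathcal H}{\delta L}\big]\Big)\tfrac{\delta\mathcal F}{\delta L}\Big)dx,$$ where $\mathcal H,\mathcal F$ are the extensions of $h,f$, constant on gauge leaves, to the union of the gauge leaves through the matrices $K(\mathbf k)$, $\mathbf k\in\mathcal K_L$ (resp. $K(1,\kappa)$, $\kappa\in\mathcal K_M$). **Theorem.** 1. $\mathcal K_L$ is the set of all loops $(k_0,k_1,k_2)$ with $k_0>0$, and $\mathcal K_M$ is the set of all loops $(\kappa_1,\kappa_2)$. 2. The geometric bracket on $\mathcal K_L$ is well defined: for functionals $h,f$ with variational derivatives $\delta h,\delta f$ at $\mathbf k$, the extensions have variational derivatives in $\mathfrak o(3,1)$-valued loops, and $$\{h,f\}(\mathbf k)=\frac12\int(\delta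 f)^T\begin{pmatrix}0&0&0\\0&-D\frac1{k_0}D\frac1{k_0}D+D\frac{k_1}{k_0}+\frac{k_1}{k_0}D&\frac{k_2}{k_0}D+D\frac{k_2}{k_0}\\0&\frac{k_2}{k_0}D+D\frac{k_2}{k_0}&D\frac1{k_0}D\frac1{k_0}D-D\frac{k_1}{k_0}-\frac{k_1}{k_0}D\end{pmatrix}\delta h\,dx.$$ 3. The geometric bracket on $\mathcal K_M$ is well defined in the same sense, and $\{h,f\}(\kappa)=\frac12\int(\delta f)^TP\,\delta h\,dx$ with $$P=\begin{pmatrix}-D^3+\kappa_1D+D\kappa_1&D\kappa_2+\kappa_2D\\D\kappa_2+\kappa_2D&D^3-D\kappa_1-\kappa_1D\end{pmatrix}.$$ 4. $\mathcal K_L$ foliates into Poisson submanifolds on which $k_0$ is fixed: for every function $c$ (in particular every positive constant), on $N_c=\{\mathbf k\in\mathcal K_L:k_0=c\}$ the bracket of two functionals depends only on their restrictions to $N_c$. The induced bracket of functionals on $N_c$ with variational derivatives (along paths in $N_c$) is given by the formula in 2. 5. $\Pi$ induces a Poisson equivalence $\Phi:\mathcal K_L^1\to\mathcal K_M$. That is,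 there is a bijection $\Phi$, given by $(1,k_1,k_2)\mapsto(k_1,k_2)$, such that if $u$ is a curve in $C_L$ parametrized by arc-length, then $\Pi u$ is a regular curve in $M$, $u$ has unique invariants $\mathbf k$, these lie in $\mathcal K_L^1$, and $\Phi(\mathbf k)$ is the unique system of invariants of $\Pi u$; and $\{h\circ\Phi,f\circ\Phi\}=\{h,f\}\circ\Phi$ for all functionals $h,f$ on $\mathcal K_M$ (with one side defined at a point if and only if the other is), where the left bracket is the one induced on $\mathcal K_L^1=N_1$ by $\mathcal K_L$. -/

import Mathlib

open scoped ContDiff Matrix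

attribute [local instance] Matrix.normedAddCommGroup Matrix.normedSpace

namespace ConeSphere

/-! ### The Lorentzian group, its Lie algebra, isotropy subgroups -/

/-- Vectors of `ℝ⁴`, with coordinates `(u₀, u₁, u₂, u₃)`. -/
abbrev Vec4 := Fin 4 → ℝ

abbrev Mat4 := Matrix (Fin 4) (Fin 4) ℝ

/-- The matrix of the Minkowski metric in a null basis. -/
def J : Mat4 := !![0, 0, 0, -1; 0, 1, 0, 0; 0, 0, 1, 0; -1, 0, 0, 0]

/-- The Minkowski inner product `⟨v, w⟩ = vᵀ J w`. -/
def mink (v w : Vec4) : ℝ := v ⬝ᵥ (J *ᵥ w)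

/-- The orientation preserving Lorentzian group `SO(3,1)`. -/
def SO31 : Set Mat4 := {g | gᵀ * J * g = J ∧ g.det = 1}

/-- The Lie algebra `𝔬(3,1)`. -/
def so31 : Set Mat4 := {X | Xᵀ * J + J * X = 0}

/-- The base point `e₄` of the cone. -/
def e4 : Vec4 := ![0, 0, 0, 1]

/-- The isotropy subgroup of the point `e₄` of the cone. -/
def HL : Set Mat4 := {g | g ∈ SO31 ∧ g *ᵥ e4 = e4}

/-- The isotropy subgroup of the point `[e₄]` of the projectivized cone. -/
def HM : Set Mat4 := {g | g ∈ SO31 ∧ ∃ c : ℝ, g *ᵥ e4 = c • e4}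

/-! ### Loops (smooth `T`-periodic maps), gauge action -/

/-- Smooth loops in `V`, that is, smooth maps `ℝ → V` of period `T`. -/
def loops (T : ℝ) (V : Type*) [NormedAddCommGroup V] [NormedSpace ℝ V] : Set (ℝ → V) :=
  {f | ContDiff ℝ ∞ f ∧ Function.Periodic f T}

/-- The loop algebra of `𝔬(3,1)`, identified with its dual by the trace form. -/
def algLoops (T : ℝ) : Set (ℝ → Mat4) := {L | L ∈ loops T Mat4 ∧ ∀ x, L x ∈ so31}

/-- The loop group of a group `H` of matrices. -/
def groupLoops (T : ℝ) (H : Set Mat4) : Set (ℝ → Mat4) :=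
  {g | g ∈ loops T Mat4 ∧ ∀ x, g x ∈ H}

/-- The gauge action `g · L = g L g⁻¹ - gₓ g⁻¹`: if `L = r⁻¹ rₓ` is the left Maurer-Cartan
matrix of `r`, then `g · L` is the left Maurer-Cartan matrix of `r g⁻¹`. -/
noncomputable def gauge (g L : ℝ → Mat4) : ℝ → Mat4 := fun x =>
  g x * L x * (g x)⁻¹ - deriv g x * (g x)⁻¹

/-! ### Curves in the light cone and their invariants -/

/-- The matrix with entries `k₀, k₁, k₂` which is the left Maurer-Cartan matrix of curves in the
cone (the right one is its negative). -/
def mcCone (k : Fin 3 → ℝ) : Mat4 :=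
  !![0, k 0, 0, 0; k 1, 0, 0, k 0; k 2, 0, 0, 0; 0, k 1, k 2, 0]

/-- Smooth non-radial curves in the light cone, with group monodromy over the period `T`. -/
structure IsConeCurve (T : ℝ) (u : ℝ → Vec4) : Prop where
  smooth : ContDiff ℝ ∞ u
  ne_zero : ∀ x, u x ≠ 0
  null : ∀ x, mink (u x) (u x) = 0
  nonradial : ∀ x, 0 < mink (deriv u x) (deriv u x)
  monodromy : ∃ g ∈ SO31, ∀ x, u (x + T) = g *ᵥ u x

/-- Parametrization by arc-length: `‖u'‖_J = 1`. -/
def IsArcLength (u : ℝ → Vec4) : Prop := ∀ x, mink (deriv u x) (deriv u x) = 1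

/-- `ρ` is the right moving frame along `u` determined by the normalization equations
`ρ u = e₄`, `ρ u' = ‖u'‖_J e₂`, and vanishing of the third coordinate of `ρ u''`. -/
structure IsConeFrame (u : ℝ → Vec4) (ρ : ℝ → Mat4) : Prop where
  smooth : ContDiff ℝ ∞ ρ
  mem : ∀ x, ρ x ∈ SO31
  zeroth : ∀ x, ρ x *ᵥ u x = e4
  first : ∀ x, ρ x *ᵥ deriv u x = ![0, Real.sqrt (mink (deriv u x) (deriv u x)), 0, 0]
  second : ∀ x, (ρ x *ᵥ deriv (deriv u) x) 2 = 0

/-- `k = (k₀, k₁, k₂)` are the differential invariants of the cone curve `u`: the right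
Maurer-Cartan matrix `ρₓ ρ⁻¹` of its right moving frame is `-mcCone k`. -/
def HasConeInvariants (u : ℝ → Vec4) (k : ℝ → Fin 3 → ℝ) : Prop :=
  ∃ ρ, IsConeFrame u ρ ∧ ∀ x, deriv ρ x * (ρ x)⁻¹ = -mcCone (k x)

/-- The space `𝒦_L` of invariants of curves in the cone. -/
def coneInvariants (T : ℝ) : Set (ℝ → Fin 3 → ℝ) :=
  {k | ∃ u, IsConeCurve T u ∧ HasConeInvariants u k}

/-- The part of `𝒦_L` on which `k₀` is the given function `c`. -/
def coneLeaf (T : ℝ) (c : ℝ → ℝ) : Set (ℝ → Fin 3 → ℝ) :=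
  {k | k ∈ coneInvariants T ∧ ∀ x, k x 0 = c x}

/-- The space `𝒦_L¹` of invariants of curves in the cone parametrized by arc-length. -/
abbrev coneInvariantsOne (T : ℝ) : Set (ℝ → Fin 3 → ℝ) := coneLeaf T (fun _ => 1)

/-! ### Curves in the conformal sphere (the projectivized cone) and their invariants -/

/-- The left Maurer-Cartan matrix of curves in the sphere with invariants `κ₁, κ₂`. -/
def mcSphere (κ : Fin 2 → ℝ) : Mat4 := mcCone ![1, κ 0, κ 1]

/-- Real projective 3-space, which contains the projectivized cone. -/
abbrev P3 := Projectivization ℝ Vec4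

/-- The projectivization `Π u` of a curve in the cone. -/
noncomputable def projectivize (u : ℝ → Vec4) (hu : ∀ x, u x ≠ 0) : ℝ → P3 :=
  fun x => Projectivization.mk ℝ (u x) (hu x)

/-- The affine coordinates `(u₁ / u₃, u₂ / u₃)`, a chart of the sphere around `[e₄]`. -/
noncomputable def affine (v : Vec4) : Fin 2 → ℝ := ![v 1 / v 3, v 2 / v 3]

/-- Smooth regular curves in the projectivized cone, with group monodromy over the period `T`. -/
structure IsSphereCurve (T : ℝ) (m : ℝ → P3) : Prop where
  /-- `m` has a smooth null lift `v`; regularity (`m' ≠ 0`) is `⟨v', v'⟩ > 0`. -/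
  lift : ∃ v : ℝ → Vec4, ContDiff ℝ ∞ v ∧ (∀ x, ∃ h : v x ≠ 0, m x = Projectivization.mk ℝ (v x) h) ∧
    (∀ x, mink (v x) (v x) = 0) ∧ ∀ x, 0 < mink (deriv v x) (deriv v x)
  monodromy : ∃ g ∈ SO31, ∀ x, ∃ c : ℝ, (m (x + T)).rep = c • (g *ᵥ (m x).rep)

/-- `ρ` is a right moving frame along `m` satisfying the normalization equations
`ρ · m = 0`, `ρ · m' = e₁`, `ρ · m'' = 0` for the prolonged action in affine coordinates: for
every `x₀`, the curve `x ↦ ρ(x₀) · m(x)` has 2-jet `(0, e₁, 0)` at `x₀`. The curve in coordinates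
does not depend on the representatives, as `affine` is invariant under scaling. -/
structure IsSphereFrame (m : ℝ → P3) (ρ : ℝ → Mat4) : Prop where
  smooth : ContDiff ℝ ∞ ρ
  mem : ∀ x, ρ x ∈ SO31
  chart : ∀ x₀, (ρ x₀ *ᵥ (m x₀).rep) 3 ≠ 0
  zeroth : ∀ x₀, affine (ρ x₀ *ᵥ (m x₀).rep) = 0
  first : ∀ x₀, deriv (fun x => affine (ρ x₀ *ᵥ (m x).rep)) x₀ = ![1, 0]
  second : ∀ x₀, deriv (deriv (fun x => affine (ρ x₀ *ᵥ (m x).rep))) x₀ = 0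

/-- `κ = (κ₁, κ₂)` are the differential invariants of the curve `m` in the sphere. -/
def HasSphereInvariants (m : ℝ → P3) (κ : ℝ → Fin 2 → ℝ) : Prop :=
  ∃ ρ, IsSphereFrame m ρ ∧ ∀ x, deriv ρ x * (ρ x)⁻¹ = -mcSphere (κ x)

/-- The space `𝒦_M` of invariants of curves in the sphere. -/
def sphereInvariants (T : ℝ) : Set (ℝ → Fin 2 → ℝ) :=
  {κ | ∃ m, IsSphereCurve T m ∧ HasSphereInvariants m κ}

/-! ### Functionals and variational derivatives -/

section Functionals

variable {V : Type*} [NormedAddCommGroup V] [NormedSpace ℝ V]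

/-- A smooth one-parameter family of elements of a space `S` of maps `ℝ → V`. -/
def IsSmoothPath {S : Set (ℝ → V)} (γ : ℝ → S) : Prop :=
  ContDiff ℝ ∞ (fun p : ℝ × ℝ => (γ p.1 : ℝ → V) p.2)

/-- `X` is a variational derivative at `s` of the functional `Φ` on `S`, relative to the pairing
`B`: along every smooth path through `s`, `dΦ/dε = ∫ B(X, ∂_ε γ) dx` at `ε = 0`. -/
def HasVarDeriv (T : ℝ) (B : V → V → ℝ) {S : Set (ℝ → V)} (Φ : S → ℝ) (s : S) (X : ℝ → V) : Prop :=
  ∀ γ : ℝ → S, IsSmoothPath γ → γ 0 = s →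
    HasDerivAt (fun ε => Φ (γ ε))
      (∫ x in (0 : ℝ)..T, B (X x) (deriv (fun ε => (γ ε : ℝ → V) x) 0)) 0

/-- The brackets below are given by their graphs: `br h f s v` says that `{h, f}(s)` is defined
and has the value `v`. The bracket induced on a subspace `N ⊆ S`: `{h, f}` is computed by extending
`h` and `f` to `S`. -/
def InducedBracket {S : Set (ℝ → V)} (br : (S → ℝ) → (S → ℝ) → S → ℝ → Prop) (N : Set (ℝ → V))
    (h f : N → ℝ) (n : N) (v : ℝ) : Prop :=
  ∃ h' f' : S → ℝ, (∀ (s : S) (p : N), s.1 = p.1 → h' s = h p) ∧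
    (∀ (s : S) (p : N), s.1 = p.1 → f' s = f p) ∧ ∃ s : S, s.1 = n.1 ∧ br h' f' s v

/-- `N ⊆ S` is a Poisson submanifold: on `N`, the bracket of two functionals on `S` depends only
on the restrictions of the two functionals to `N`. -/
def IsPoissonSubmanifold {S : Set (ℝ → V)} (br : (S → ℝ) → (S → ℝ) → S → ℝ → Prop)
    (N : Set (ℝ → V)) : Prop :=
  N ⊆ S ∧ ∀ h h' f f' : S → ℝ, (∀ s : S, s.1 ∈ N → h s = h' s) → (∀ s : S, s.1 ∈ N → f s = f' s) →
    ∀ s : S, s.1 ∈ N → ∀ v v' : ℝ, br h f s v → br h' f' s v' → v = v'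

end Functionals

/-! ### The Lie-Poisson bracket and its reductions -/

/-- The trace form. -/
def tracePairing (X Y : Mat4) : ℝ := (X * Y).trace

/-- The standard pairing of coordinate vectors. -/
def dotPairing {n : ℕ} (a b : Fin n → ℝ) : ℝ := a ⬝ᵥ b

/-- The first Lie-Poisson bracket at `L`, in terms of the variational derivatives `X` and `Y` of
the two functionals: `∫ trace ((Xₓ + [L, X]) Y) dx`. -/
noncomputable def lieBracket (T : ℝ) (L X Y : ℝ → Mat4) : ℝ :=
  ∫ x in (0 : ℝ)..T, tracePairing (deriv X x + (L x * X x - X x * L x)) (Y x)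

section Reduction

variable (T : ℝ) (H : Set Mat4) {n : ℕ} (S : Set (ℝ → Fin n → ℝ)) (mc : (Fin n → ℝ) → Mat4)

/-- The set `U` of the loops in the gauge leaves, under the loop group of `H`, of the
Maurer-Cartan matrices `mc(k)` with `k ∈ S`. -/
def gaugeDomain : Set (ℝ → Mat4) :=
  {L | ∃ k ∈ S, ∃ g ∈ groupLoops T H, L = gauge g (fun x => mc (k x))}

/-- `F` is an extension to `U` of the functional `h` on `S`, constant on the gauge leaves. -/
def IsInvariantExtension (h : S → ℝ) (F : gaugeDomain T H S mc → ℝ) : Prop :=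
  (∀ (L : gaugeDomain T H S mc) (k : S), L.1 = (fun x => mc (k.1 x)) → F L = h k) ∧
  ∀ L L' : gaugeDomain T H S mc, (∃ g ∈ groupLoops T H, L'.1 = gauge g L.1) → F L' = F L

/-- The geometric (reduced) bracket: `{h, f}(k) = v` if `v` is the value at `mc(k)` of the first
Lie-Poisson bracket of extensions of `h` and `f` constant on the gauge leaves. -/
def ReducedBracket (h f : S → ℝ) (k : S) (v : ℝ) : Prop :=
  ∃ F G : gaugeDomain T H S mc → ℝ,
    IsInvariantExtension T H S mc h F ∧ IsInvariantExtension T H S mc f G ∧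
    ∃ L : gaugeDomain T H S mc, L.1 = (fun x => mc (k.1 x)) ∧
    ∃ X ∈ algLoops T, ∃ Y ∈ algLoops T,
      HasVarDeriv T tracePairing F L X ∧ HasVarDeriv T tracePairing G L Y ∧
      v = lieBracket T L.1 X Y

end Reduction

/-- The geometric bracket on `𝒦_L`. -/
def ConeBracket (T : ℝ) : (coneInvariants T → ℝ) → (coneInvariants T → ℝ) →
    coneInvariants T → ℝ → Prop :=
  ReducedBracket T HL (coneInvariants T) mcCone

/-- The geometric bracket on `𝒦_M`. -/
def SphereBracket (T : ℝ) : (sphereInvariants T → ℝ) → (sphereInvariants T → ℝ) →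
    sphereInvariants T → ℝ → Prop :=
  ReducedBracket T HM (sphereInvariants T) mcSphere

/-! ### The explicit operators -/

/-- The diagonal entry `-D k₀⁻¹ D k₀⁻¹ D + D (k₁/k₀) + (k₁/k₀) D` of the cone operator. -/
noncomputable def coneDiag (k : ℝ → Fin 3 → ℝ) (a : ℝ → ℝ) : ℝ → ℝ := fun x =>
  -deriv (fun y => 1 / k y 0 * deriv (fun z => 1 / k z 0 * deriv a z) y) x
    + deriv (fun y => k y 1 / k y 0 * a y) x + k x 1 / k x 0 * deriv a x

/-- The off-diagonal entry `(k₂/k₀) D + D (k₂/k₀)` of the cone operator. -/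
noncomputable def coneOff (k : ℝ → Fin 3 → ℝ) (a : ℝ → ℝ) : ℝ → ℝ := fun x =>
  k x 2 / k x 0 * deriv a x + deriv (fun y => k y 2 / k y 0 * a y) x

/-- The operator of the geometric bracket on `𝒦_L`. -/
noncomputable def coneOp (k a : ℝ → Fin 3 → ℝ) : ℝ → Fin 3 → ℝ := fun x =>
  ![0,
    coneDiag k (fun y => a y 1) x + coneOff k (fun y => a y 2) x,
    coneOff k (fun y => a y 1) x - coneDiag k (fun y => a y 2) x]

/-- The diagonal entry `-D³ + κ₁ D + D κ₁` of `P`. -/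
noncomputable def diagP (κ : ℝ → Fin 2 → ℝ) (a : ℝ → ℝ) : ℝ → ℝ := fun x =>
  -iteratedDeriv 3 a x + κ x 0 * deriv a x + deriv (fun y => κ y 0 * a y) x

/-- The off-diagonal entry `D κ₂ + κ₂ D` of `P`. -/
noncomputable def offP (κ : ℝ → Fin 2 → ℝ) (a : ℝ → ℝ) : ℝ → ℝ := fun x =>
  deriv (fun y => κ y 1 * a y) x + κ x 1 * deriv a x

/-- The operator `P` of the complexly coupled KdV system. -/
noncomputable def opP (κ a : ℝ → Fin 2 → ℝ) : ℝ → Fin 2 → ℝ := fun x =>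
  ![diagP κ (fun y => a y 0) x + offP κ (fun y => a y 1) x,
    offP κ (fun y => a y 0) x - diagP κ (fun y => a y 1) x]

end ConeSphere

open ConeSphere

/-! Invariants and curves determine each other through a linear equation. If `ρ` is the right moving
frame of a cone curve, then `r = ρ⁻¹` solves `r' = r K(k)`. Differentiating the normalization
equations forces `K` to have the shape `mcCone`, and uniqueness of the frame (`frame_unique`) makes
`k` periodic although `u` only has monodromy. Conversely, for a loop `k` with `k₀ > 0` the equation
has a global solution in `SO(3,1)` with monodromy, and `u = r e₄` has invariants `k`
(`mem_coneInvariants_of_loop`). The sphere reduces to the cone: a regular curve in `M` has a null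
lift of arc-length one (`IsSphereCurve.exists_arcLength_lift`), and the sphere frames of the
projection are exactly plus or minus the cone frames of that lift (`isSphereFrame_iff`). The sign
cancels in `ρ' ρ⁻¹`, so sphere invariants are cone invariants with `k₀ = 1`.

For the brackets, the matrices `K` form a cross section of the gauge action. The union of the leaves
consists of the loops in the algebra whose entries `(0,1)` and `(0,2)` never vanish simultaneously.
A smooth family of such loops is brought to normal form smoothly by rotations and translations, for
the sphere also by dilations, and an `HL`-loop relating two cone normal forms is trivial
(`exists_cone_normal_form`, `exists_sphere_normal_form`, `eq_one_of_gauge_mcCone`). Hence invariant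
extensions exist. `IsCrossSection` collects what both cases share.

The variational derivative of an extension is the horizontal element `X`: its pairing with tangents
of the cross section gives `δh`, and `X' + [K, X]` annihilates the isotropy algebra, which is
infinitesimal gauge invariance (`IsCrossSection.hasVarDeriv_extension`). Testing against transposes
shows that it is the only one (`IsCrossSection.varDeriv_unique`), so the bracket is the Lie–Poisson
expression in two horizontal elements. On the cone these are found by solving algebraic equations
one after the other (`coneHorizontal`), and one integration by parts gives the operator
(`lieBracket_coneHorizontal`).

The row and column of the operator belonging to `k₀` vanish. The bracket therefore sees only the
components of `δh` and `δf` along `k₁` and `k₂`, which the restrictions to `N_c` determine; this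
makes the sets `N_c` Poisson submanifolds. It also gives the equivalence: at `k₀ = 1` the free
component `a₀` can be chosen so that the cone horizontal element is horizontal for the larger group
`HM` (`sphereLift`), without changing the value of the bracket. Both brackets are thus computed by
the same operator. -/

namespace ConeSphere

/-! ### Calculus of matrix valued maps -/

section MatrixCalculus

variable {E : Type*} [NormedAddCommGroup E] [NormedSpace ℝ E]

theorem contDiff_mat_iff {n : WithTop ℕ∞} {f : E → Mat4} :
    ContDiff ℝ n f ↔ ∀ i j, ContDiff ℝ n fun x => f x i j := by
  have h1 : ContDiff ℝ n f ↔ ∀ i, ContDiff ℝ n fun x => f x i :=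
    contDiff_pi (Φ := fun x => f x)
  rw [h1]
  exact forall_congr' fun i => contDiff_pi (Φ := fun x => f x i)

theorem contDiff_entry {n : WithTop ℕ∞} {f : E → Mat4} (hf : ContDiff ℝ n f) (i j : Fin 4) :
    ContDiff ℝ n fun x => f x i j := contDiff_mat_iff.1 hf i j

theorem contDiff_matMul {n : WithTop ℕ∞} {f g : E → Mat4} (hf : ContDiff ℝ n f)
    (hg : ContDiff ℝ n g) : ContDiff ℝ n fun x => f x * g x := by
  refine contDiff_mat_iff.2 fun i j => ?_
  simp only [Matrix.mul_apply]
  exact ContDiff.sum fun l _ => (contDiff_entry hf i l).mul (contDiff_entry hg l j)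

theorem contDiff_matTranspose {f : E → Mat4} (hf : ContDiff ℝ ∞ f) :
    ContDiff ℝ ∞ fun x => (f x)ᵀ :=
  contDiff_mat_iff.2 fun i j => contDiff_entry hf j i

theorem contDiff_mulVec {f : E → Mat4} {v : E → Vec4} (hf : ContDiff ℝ ∞ f)
    (hv : ContDiff ℝ ∞ v) : ContDiff ℝ ∞ fun x => f x *ᵥ v x := by
  refine contDiff_pi.2 fun i => ?_
  simp only [Matrix.mulVec, dotProduct]
  exact ContDiff.sum fun l _ => (contDiff_entry hf i l).mul (contDiff_pi.1 hv l)

theorem contDiff_mink {v w : E → Vec4} (hv : ContDiff ℝ ∞ v) (hw : ContDiff ℝ ∞ w) :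
    ContDiff ℝ ∞ fun x => mink (v x) (w x) := by
  simp only [mink, dotProduct]
  exact ContDiff.sum fun l _ => (contDiff_pi.1 hv l).mul
    (contDiff_pi.1 (contDiff_mulVec (contDiff_const (c := J)) hw) l)

end MatrixCalculus

theorem hasDerivAt_mat_iff {f : ℝ → Mat4} {f' : Mat4} {x : ℝ} :
    HasDerivAt f f' x ↔ ∀ i j, HasDerivAt (fun y => f y i j) (f' i j) x := by
  have h1 : HasDerivAt f f' x ↔ ∀ i, HasDerivAt (fun y => f y i) (f' i) x :=
    hasDerivAt_pi (φ := fun x => f x)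
  rw [h1]
  exact forall_congr' fun i => hasDerivAt_pi (φ := fun x => f x i)

theorem hasDerivAt_matMul {f g : ℝ → Mat4} {f' g' : Mat4} {x : ℝ} (hf : HasDerivAt f f' x)
    (hg : HasDerivAt g g' x) :
    HasDerivAt (fun y => f y * g y) (f' * g x + f x * g') x := by
  refine hasDerivAt_mat_iff.2 fun i j => ?_
  simp only [Matrix.mul_apply, Matrix.add_apply, ← Finset.sum_add_distrib]
  exact HasDerivAt.fun_sum fun l _ =>
    (hasDerivAt_mat_iff.1 hf i l).mul (hasDerivAt_mat_iff.1 hg l j)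

theorem hasDerivAt_matTranspose {f : ℝ → Mat4} {f' : Mat4} {x : ℝ} (hf : HasDerivAt f f' x) :
    HasDerivAt (fun y => (f y)ᵀ) f'ᵀ x :=
  hasDerivAt_mat_iff.2 fun i j => hasDerivAt_mat_iff.1 hf j i

theorem hasDerivAt_mulVec {f : ℝ → Mat4} {v : ℝ → Vec4} {f' : Mat4} {v' : Vec4} {x : ℝ}
    (hf : HasDerivAt f f' x) (hv : HasDerivAt v v' x) :
    HasDerivAt (fun y => f y *ᵥ v y) (f' *ᵥ v x + f x *ᵥ v') x := by
  refine hasDerivAt_pi.2 fun i => ?_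
  simp only [Matrix.mulVec, dotProduct, Pi.add_apply, ← Finset.sum_add_distrib]
  exact HasDerivAt.fun_sum fun l _ => (hasDerivAt_mat_iff.1 hf i l).mul (hasDerivAt_pi.1 hv l)

theorem hasDerivAt_mink {v w : ℝ → Vec4} {v' w' : Vec4} {x : ℝ}
    (hv : HasDerivAt v v' x) (hw : HasDerivAt w w' x) :
    HasDerivAt (fun y => mink (v y) (w y)) (mink v' (w x) + mink (v x) w') x := by
  have h := hasDerivAt_mulVec (hasDerivAt_const x J) hw
  simp only [mink, dotProduct, ← Finset.sum_add_distrib]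
  refine HasDerivAt.fun_sum fun l _ => ?_
  have h2 := (hasDerivAt_pi.1 hv l).fun_mul (hasDerivAt_pi.1 h l)
  simp only [Matrix.zero_mulVec, zero_add] at h2
  exact h2

/-! ### Smooth loops and jointly smooth one-parameter families. -/

section Smooth

variable {V : Type*} [NormedAddCommGroup V] [NormedSpace ℝ V]

theorem hasDerivAt_of_smooth {f : ℝ → V} (hf : ContDiff ℝ ∞ f) (x : ℝ) :
    HasDerivAt f (deriv f x) x :=
  (hf.differentiable (by simp) x).hasDerivAt

theorem contDiff_deriv {f : ℝ → V} (hf : ContDiff ℝ ∞ f) : ContDiff ℝ ∞ (deriv f) :=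
  (contDiff_infty_iff_deriv.1 hf).2

theorem periodic_deriv {f : ℝ → V} {T : ℝ} (hf : Function.Periodic f T) :
    Function.Periodic (deriv f) T := fun x => by
  rw [← deriv_comp_add_const]; congr 1; exact funext hf

theorem deriv_mem_loops {f : ℝ → V} {T : ℝ} (hf : f ∈ loops T V) : deriv f ∈ loops T V :=
  ⟨contDiff_deriv hf.1, periodic_deriv hf.2⟩

theorem hasDerivAt_mat {f : ℝ → Mat4} (hf : ContDiff ℝ ∞ f) (x : ℝ) :
    HasDerivAt f (deriv f x) x := hasDerivAt_of_smooth hf x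

theorem deriv_mat_eq {f : ℝ → Mat4} {f' : Mat4} {x : ℝ} (h : HasDerivAt f f' x) :
    deriv f x = f' := h.deriv

theorem deriv_matMul {f g : ℝ → Mat4} (hf : ContDiff ℝ ∞ f) (hg : ContDiff ℝ ∞ g) (x : ℝ) :
    deriv (fun y => f y * g y) x = deriv f x * g x + f x * deriv g x :=
  deriv_mat_eq (hasDerivAt_matMul (hasDerivAt_mat hf x) (hasDerivAt_mat hg x))

theorem deriv_mat_const (c : Mat4) (x : ℝ) : deriv (fun _ : ℝ => c) x = 0 :=
  deriv_mat_eq (hasDerivAt_const x c)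

theorem deriv_mat_entry {f : ℝ → Mat4} (hf : ContDiff ℝ ∞ f) (x : ℝ) (i j : Fin 4) :
    deriv f x i j = deriv (fun y => f y i j) x :=
  (hasDerivAt_mat_iff.1 (hasDerivAt_mat hf x) i j).deriv.symm

theorem contDiff_deriv_mat {f : ℝ → Mat4} (hf : ContDiff ℝ ∞ f) : ContDiff ℝ ∞ (deriv f) :=
  contDiff_deriv hf

theorem periodic_deriv_mat {f : ℝ → Mat4} {T : ℝ} (hf : Function.Periodic f T) :
    Function.Periodic (deriv f) T := periodic_deriv hf

theorem integral_deriv_loop [CompleteSpace V] {f : ℝ → V} {T : ℝ} (hf : f ∈ loops T V) :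
    ∫ x in (0 : ℝ)..T, deriv f x = 0 := by
  rw [intervalIntegral.integral_deriv_eq_sub (fun x _ => (hasDerivAt_of_smooth hf.1 x).differentiableAt)
    ((contDiff_deriv hf.1).continuous.intervalIntegrable _ _)]
  have := hf.2 0
  rw [zero_add] at this
  rw [this, sub_self]

/-- Jointly smooth one-parameter families of maps `ℝ → V`. -/
def SmoothFamily (G : ℝ → ℝ → V) : Prop := ContDiff ℝ ∞ (fun p : ℝ × ℝ => G p.1 p.2)

theorem SmoothFamily.right {G : ℝ → ℝ → V} (hG : SmoothFamily G) (ε : ℝ) : ContDiff ℝ ∞ (G ε) :=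
  hG.comp (contDiff_const.prodMk contDiff_id : ContDiff ℝ ∞ fun x : ℝ => (ε, x))

theorem SmoothFamily.left {G : ℝ → ℝ → V} (hG : SmoothFamily G) (x : ℝ) :
    ContDiff ℝ ∞ (fun ε => G ε x) :=
  hG.comp (contDiff_id.prodMk contDiff_const : ContDiff ℝ ∞ fun ε : ℝ => (ε, x))

theorem SmoothFamily.deriv_right_eq {G : ℝ → ℝ → V} (hG : SmoothFamily G) (ε x : ℝ) :
    deriv (G ε) x = fderiv ℝ (fun p : ℝ × ℝ => G p.1 p.2) (ε, x) (0, 1) := by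
  have h : HasDerivAt (fun y : ℝ => (ε, y)) ((0 : ℝ), (1 : ℝ)) x :=
    (hasDerivAt_const x ε).prodMk (hasDerivAt_id x)
  exact (((ContDiff.differentiable hG (by simp)) (ε, x)).hasFDerivAt.comp_hasDerivAt x h).deriv

theorem SmoothFamily.deriv_left_eq {G : ℝ → ℝ → V} (hG : SmoothFamily G) (ε x : ℝ) :
    deriv (fun η => G η x) ε = fderiv ℝ (fun p : ℝ × ℝ => G p.1 p.2) (ε, x) (1, 0) := by
  have h : HasDerivAt (fun η : ℝ => (η, x)) ((1 : ℝ), (0 : ℝ)) ε :=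
    (hasDerivAt_id ε).prodMk (hasDerivAt_const ε x)
  exact (((ContDiff.differentiable hG (by simp)) (ε, x)).hasFDerivAt.comp_hasDerivAt ε h).deriv

theorem SmoothFamily.contDiff_fderiv_apply {G : ℝ → ℝ → V} (hG : SmoothFamily G) (w : ℝ × ℝ) :
    ContDiff ℝ ∞ (fun p : ℝ × ℝ => fderiv ℝ (fun p : ℝ × ℝ => G p.1 p.2) p w) :=
  (ContDiff.fderiv_right hG (by simp)).clm_apply contDiff_const

theorem SmoothFamily.deriv_right {G : ℝ → ℝ → V} (hG : SmoothFamily G) :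
    SmoothFamily (fun ε => deriv (G ε)) := by
  unfold SmoothFamily
  simp only [hG.deriv_right_eq]
  exact hG.contDiff_fderiv_apply (0, 1)

theorem SmoothFamily.deriv_left {G : ℝ → ℝ → V} (hG : SmoothFamily G) :
    SmoothFamily (fun ε x => deriv (fun η => G η x) ε) := by
  unfold SmoothFamily
  simp only [hG.deriv_left_eq]
  exact hG.contDiff_fderiv_apply (1, 0)

/-- Both sides are values of the second Fréchet derivative on the coordinate directions, which is
symmetric. In the variation of a gauge transformation this exchanges the parameter with the loop
variable. -/
theorem SmoothFamily.deriv_comm {G : ℝ → ℝ → V} (hG : SmoothFamily G) (ε x : ℝ) :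
    deriv (fun η => deriv (G η) x) ε = deriv (fun y => deriv (fun η => G η y) ε) x := by
  rw [hG.deriv_right.deriv_left_eq, hG.deriv_left.deriv_right_eq]
  simp only [hG.deriv_right_eq, hG.deriv_left_eq]
  have hd : DifferentiableAt ℝ (fderiv ℝ fun p : ℝ × ℝ => G p.1 p.2) (ε, x) :=
    (ContDiff.fderiv_right (m := ∞) hG (by simp)).differentiable (by simp) _
  have key (v w : ℝ × ℝ) : fderiv ℝ (fun p : ℝ × ℝ =>
      fderiv ℝ (fun p : ℝ × ℝ => G p.1 p.2) p v) (ε, x) w =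
      fderiv ℝ (fderiv ℝ fun p : ℝ × ℝ => G p.1 p.2) (ε, x) w v := by
    rw [fderiv_clm_apply hd (differentiableAt_const v)]; simp
  have hs : IsSymmSndFDerivAt ℝ (fun p : ℝ × ℝ => G p.1 p.2) (ε, x) :=
    (ContDiff.contDiffAt hG).isSymmSndFDerivAt
      (by simpa using WithTop.coe_le_coe.2 (le_top : (2 : ℕ∞) ≤ ⊤))
  simp only [Prod.mk.eta]
  rw [key, key, hs.eq]

end Smooth

/-- The line is connected, so a continuous sign is constant. All sign ambiguities below (lifts,
frames, determinants, scalings of `e₄`) are settled by this. -/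
theorem eq_one_or_eq_neg_one_of_sq {c : ℝ → ℝ} (hc : Continuous c) (h : ∀ x, c x ^ 2 = 1) :
    (∀ x, c x = 1) ∨ ∀ x, c x = -1 := by
  have := isPreconnected_univ.eq_or_eq_neg_of_sq_eq hc.continuousOn
    (continuous_const (y := (1 : ℝ))).continuousOn (fun x _ => by simpa using h x) (by simp)
  simpa [Set.EqOn] using this

/-! ### The Lorentzian group and its Lie algebra -/

theorem J_mul_J : J * J = 1 := by
  ext i j; fin_cases i <;> fin_cases j <;> simp [J, Matrix.mul_apply, Fin.sum_univ_four]

theorem one_mem_SO31 : (1 : Mat4) ∈ SO31 := by simp [SO31]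

theorem mul_mem_SO31 {g h : Mat4} (hg : g ∈ SO31) (hh : h ∈ SO31) : g * h ∈ SO31 := by
  refine ⟨?_, by rw [Matrix.det_mul, hg.2, hh.2, one_mul]⟩
  calc (g * h)ᵀ * J * (g * h) = hᵀ * (gᵀ * J * g) * h := by
        rw [Matrix.transpose_mul]; simp only [Matrix.mul_assoc]
    _ = J := by rw [hg.1, hh.1]

theorem isUnit_det_of_mem_SO31 {g : Mat4} (hg : g ∈ SO31) : IsUnit g.det := by simp [hg.2]

/-- On the group, inversion is the restriction of a linear map, so smoothness and derivatives of
inverses follow from those of products. -/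
theorem inv_eq_of_mem_SO31 {g : Mat4} (hg : g ∈ SO31) : g⁻¹ = J * gᵀ * J := by
  refine Matrix.inv_eq_left_inv ?_
  rw [Matrix.mul_assoc, Matrix.mul_assoc, ← Matrix.mul_assoc gᵀ, hg.1, J_mul_J]

theorem inv_mul_of_mem_SO31 {g : Mat4} (hg : g ∈ SO31) : g⁻¹ * g = 1 :=
  Matrix.nonsing_inv_mul g (isUnit_det_of_mem_SO31 hg)

theorem mul_inv_of_mem_SO31 {g : Mat4} (hg : g ∈ SO31) : g * g⁻¹ = 1 :=
  Matrix.mul_nonsing_inv g (isUnit_det_of_mem_SO31 hg)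

theorem inv_mem_SO31 {g : Mat4} (hg : g ∈ SO31) : g⁻¹ ∈ SO31 := by
  refine ⟨?_, by rw [Matrix.det_nonsing_inv, hg.2, Ring.inverse_one]⟩
  have h1 := mul_inv_of_mem_SO31 hg
  calc g⁻¹ᵀ * J * g⁻¹ = g⁻¹ᵀ * (gᵀ * J * g) * g⁻¹ := by rw [hg.1]
    _ = (g * g⁻¹)ᵀ * J * (g * g⁻¹) := by
        rw [Matrix.transpose_mul]; simp only [Matrix.mul_assoc]
    _ = J := by rw [h1]; simp

/-- The dimension is even, so the determinant is unchanged. This lets the sign of a null lift, or of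
a sphere frame, be absorbed in the group. -/
theorem neg_mem_SO31 {g : Mat4} (hg : g ∈ SO31) : -g ∈ SO31 := by
  refine ⟨by simpa using hg.1, ?_⟩
  rw [Matrix.det_neg, hg.2]; norm_num [Fintype.card_fin]

theorem inv_mulVec_mulVec {g : Mat4} (hg : g ∈ SO31) (v : Vec4) : g⁻¹ *ᵥ (g *ᵥ v) = v := by
  rw [Matrix.mulVec_mulVec, inv_mul_of_mem_SO31 hg, Matrix.one_mulVec]

theorem mink_eq (v w : Vec4) :
    mink v w = -(v 0 * w 3) - v 3 * w 0 + v 1 * w 1 + v 2 * w 2 := by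
  simp [mink, J, dotProduct, Matrix.mulVec, Fin.sum_univ_four]; ring

theorem mink_comm (v w : Vec4) : mink v w = mink w v := by rw [mink_eq, mink_eq]; ring

theorem mink_smul_left (c : ℝ) (v w : Vec4) : mink (c • v) w = c * mink v w := by
  simp only [mink_eq, Pi.smul_apply, smul_eq_mul]; ring

theorem mink_smul_right (c : ℝ) (v w : Vec4) : mink v (c • w) = c * mink v w := by
  simp only [mink_eq, Pi.smul_apply, smul_eq_mul]; ring

theorem mink_add_left (v v' w : Vec4) : mink (v + v') w = mink v w + mink v' w := by
  simp only [mink_eq, Pi.add_apply]; ring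

theorem mink_add_right (v w w' : Vec4) : mink v (w + w') = mink v w + mink v w' := by
  simp only [mink_eq, Pi.add_apply]; ring

theorem mink_mulVec {g : Mat4} (hg : g ∈ SO31) (v w : Vec4) :
    mink (g *ᵥ v) (g *ᵥ w) = mink v w := by
  have h : (g *ᵥ v) ⬝ᵥ (J *ᵥ (g *ᵥ w)) = v ⬝ᵥ ((gᵀ * J * g) *ᵥ w) := by
    rw [Matrix.dotProduct_mulVec v, ← Matrix.vecMul_vecMul, ← Matrix.vecMul_vecMul,
      Matrix.vecMul_transpose, Matrix.dotProduct_mulVec, Matrix.dotProduct_mulVec,]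
  rw [mink, h, hg.1, mink]

/-- An element of `SO(3,1)` that fixes `e₄` and `e₂`, and whose entry `(2, 0)` vanishes,
is the identity. -/
theorem eq_one_of_fixes {g : Mat4} (hg : g ∈ SO31) (h4 : g *ᵥ e4 = e4)
    (h2 : g *ᵥ ![0, 1, 0, 0] = ![0, 1, 0, 0]) (h20 : g 2 0 = 0) : g = 1 := by
  have c3 (i : Fin 4) : g i 3 = e4 i := by
    rw [← congr_fun h4 i]; simp [e4, Matrix.mulVec, dotProduct, Fin.sum_univ_four]
  have c1 (i : Fin 4) : g i 1 = ![0, 1, 0, 0] i := by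
    rw [← congr_fun h2 i]; simp [Matrix.mulVec, dotProduct, Fin.sum_univ_four]
  have hJ (i j : Fin 4) : (gᵀ * J * g) i j = J i j := by rw [hg.1]
  have b0 := c3 0; have b1 := c3 1; have b2 := c3 2; have b3 := c3 3
  have a0 := c1 0; have a1 := c1 1; have a2 := c1 2; have a3 := c1 3
  simp [e4] at b0 b1 b2 b3 a0 a1 a2 a3
  -- The columns 1 and 3 are known; pairing the other two with them under `J` gives the rows 0 and
  -- 1.
  have g00 : g 0 0 = 1 := by
    have := hJ 0 3
    simp [J, Matrix.mul_apply, Fin.sum_univ_four, b0, b1, b2, b3] at this; linarith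
  have g02 : g 0 2 = 0 := by
    have := hJ 2 3
    simp [J, Matrix.mul_apply, Fin.sum_univ_four, b0, b1, b2, b3] at this; linarith
  have g10 : g 1 0 = 0 := by
    have := hJ 0 1
    simp [J, Matrix.mul_apply, Fin.sum_univ_four, a0, a1, a2, a3] at this; linarith
  have g12 : g 1 2 = 0 := by
    have := hJ 2 1
    simp [J, Matrix.mul_apply, Fin.sum_univ_four, a0, a1, a2, a3] at this; linarith
  -- Preservation of the metric would only give `g 2 2 = ±1`; the determinant selects the sign.
  have g22 : g 2 2 = 1 := by
    have := hg.2
    simp [Matrix.det_succ_row_zero, Fin.sum_univ_succ, Fin.succAbove, a0, a1, a2, a3, b0, b1, b2,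
      b3, g00, g02, g10, g12] at this
    exact this
  have g30 : g 3 0 = 0 := by
    have := hJ 0 0
    simp [J, Matrix.mul_apply, Fin.sum_univ_four, g00, g10, h20] at this; linarith
  have g32 : g 3 2 = 0 := by
    have := hJ 0 2
    simp [J, Matrix.mul_apply, Fin.sum_univ_four, g00, g10, h20, g02, g12] at this; linarith
  ext i j
  fin_cases i <;> fin_cases j <;> simp [*, e4]

/-- The general element of `𝔬(3,1)`. -/
def alg (p q₁ q₂ r₁ r₂ s : ℝ) : Mat4 :=
  !![p, q₁, q₂, 0; r₁, 0, s, q₁; r₂, -s, 0, q₂; 0, r₁, r₂, -p]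

theorem alg_mem_so31 (p q₁ q₂ r₁ r₂ s : ℝ) : alg p q₁ q₂ r₁ r₂ s ∈ so31 := by
  change _ = _
  ext i j
  fin_cases i <;> fin_cases j <;> simp [alg, J, Matrix.mul_apply, Fin.sum_univ_four]

theorem eq_alg_of_mem_so31 {X : Mat4} (hX : X ∈ so31) :
    X = alg (X 0 0) (X 0 1) (X 0 2) (X 1 0) (X 2 0) (X 1 2) := by
  have h (i j : Fin 4) : (Xᵀ * J + J * X) i j = 0 := by rw [show _ = _ from hX]; rfl
  have e (i j : Fin 4) := h i j
  simp only [J, Matrix.add_apply, Matrix.mul_apply, Fin.sum_univ_four, Matrix.transpose_apply] at e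
  have e00 := e 0 0; have e01 := e 0 1; have e02 := e 0 2; have e03 := e 0 3
  have e11 := e 1 1; have e12 := e 1 2; have e13 := e 1 3; have e22 := e 2 2
  have e23 := e 2 3; have e33 := e 3 3
  simp at e00 e01 e02 e03 e11 e12 e13 e22 e23 e33
  ext i j
  fin_cases i <;> fin_cases j <;> simp [alg] <;> linarith

theorem mcCone_eq_alg (k : Fin 3 → ℝ) : mcCone k = alg 0 (k 0) 0 (k 1) (k 2) 0 := by
  ext i j; fin_cases i <;> fin_cases j <;> simp [alg, mcCone]

/-- The trace form pairs the `q` entries with the `r` entries, and `p` and `s` with themselves. So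
the annihilator of the Lie algebra of `HL` is `q₁ = q₂ = s = 0`, and for `HM` also `p = 0`. -/
theorem tracePairing_alg (p q₁ q₂ r₁ r₂ s p' q₁' q₂' r₁' r₂' s' : ℝ) :
    tracePairing (alg p q₁ q₂ r₁ r₂ s) (alg p' q₁' q₂' r₁' r₂' s') =
      2 * (p * p' + q₁ * r₁' + q₂ * r₂' + r₁ * q₁' + r₂ * q₂' - s * s') := by
  simp [tracePairing, alg, Matrix.trace, Fin.sum_univ_four]; ring

theorem conj_mem_so31 {g X : Mat4} (hg : g ∈ SO31) (hX : X ∈ so31) : g * X * g⁻¹ ∈ so31 := by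
  have h1 := mul_inv_of_mem_SO31 hg
  have h2 : (g⁻¹)ᵀ * Xᵀ * (gᵀ * J * g) * g⁻¹ + (g⁻¹)ᵀ * (gᵀ * J * g) * X * g⁻¹ = 0 := by
    rw [hg.1, ← add_mul, mul_assoc, mul_assoc, ← mul_add, show Xᵀ * J + J * X = 0 from hX]; simp
  change (g * X * g⁻¹)ᵀ * J + J * (g * X * g⁻¹) = 0
  rw [← h2]
  simp only [Matrix.transpose_mul, Matrix.mul_assoc]
  rw [h1, Matrix.mul_one, ← Matrix.mul_assoc (g⁻¹ᵀ) gᵀ, ← Matrix.transpose_mul, h1]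
  simp

theorem deriv_mul_inv_mem_so31 {g : ℝ → Mat4} {g' : Mat4} {x : ℝ} (hd : HasDerivAt g g' x)
    (hg : ∀ y, g y ∈ SO31) : g' * (g x)⁻¹ ∈ so31 := by
  have h1 := mul_inv_of_mem_SO31 (hg x)
  have h := hasDerivAt_matMul (hasDerivAt_matMul (hasDerivAt_matTranspose hd)
    (hasDerivAt_const x J)) hd
  have hc : (fun y => (g y)ᵀ * J * g y) = fun _ => J := funext fun y => (hg y).1
  rw [hc] at h
  have h0 := h.unique (hasDerivAt_const x J)
  simp only [mul_zero, add_zero] at h0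
  change (g' * (g x)⁻¹)ᵀ * J + J * (g' * (g x)⁻¹) = 0
  have h2 : ((g x)⁻¹)ᵀ * (g'ᵀ * J * g x + (g x)ᵀ * J * g') * (g x)⁻¹ = 0 := by rw [h0]; simp
  rw [← h2]
  simp only [Matrix.transpose_mul, Matrix.mul_assoc, Matrix.mul_add, Matrix.add_mul]
  rw [h1, Matrix.mul_one, ← Matrix.mul_assoc ((g x)⁻¹ᵀ) (g x)ᵀ, ← Matrix.transpose_mul, h1]
  simp

/-- `J` is a symmetric involution, and conjugating the defining relation by it gives the relation
for the transpose. Transposes then serve as test directions, for which the trace form is positive.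
-/
theorem transpose_mem_so31 {X : Mat4} (hX : X ∈ so31) : Xᵀ ∈ so31 := by
  have h : J * (Xᵀ * J + J * X) * J = 0 := by rw [show Xᵀ * J + J * X = 0 from hX]; simp
  change Xᵀᵀ * J + J * Xᵀ = 0
  rw [← h, Matrix.transpose_transpose, Matrix.mul_add, Matrix.add_mul, ← Matrix.mul_assoc J J,
    J_mul_J, Matrix.one_mul, Matrix.mul_assoc J, Matrix.mul_assoc, J_mul_J, Matrix.mul_one, add_comm]

theorem sub_mem_so31 {X Y : Mat4} (hX : X ∈ so31) (hY : Y ∈ so31) : X - Y ∈ so31 := by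
  change _ = _
  have hX' : Xᵀ * J + J * X = 0 := hX
  have hY' : Yᵀ * J + J * Y = 0 := hY
  rw [Matrix.transpose_sub, Matrix.sub_mul, Matrix.mul_sub, sub_add_sub_comm, hX', hY', sub_zero]

theorem add_mem_so31 {X Y : Mat4} (hX : X ∈ so31) (hY : Y ∈ so31) : X + Y ∈ so31 := by
  change _ = _
  have hX' : Xᵀ * J + J * X = 0 := hX
  have hY' : Yᵀ * J + J * Y = 0 := hY
  rw [Matrix.transpose_add, Matrix.add_mul, Matrix.mul_add, add_add_add_comm, hX', hY', add_zero]

theorem smul_mem_so31 (c : ℝ) {X : Mat4} (hX : X ∈ so31) : c • X ∈ so31 := by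
  change _ = _
  have hX' : Xᵀ * J + J * X = 0 := hX
  rw [Matrix.transpose_smul, Matrix.smul_mul, Matrix.mul_smul, ← smul_add, hX', smul_zero]

theorem neg_mem_so31 {X : Mat4} (hX : X ∈ so31) : -X ∈ so31 := by
  simpa using smul_mem_so31 (-1) hX

/-! ### Isotropy subgroups and gauge transformations -/

/-- The closure properties of a subgroup of `SO(3,1)`. -/
structure IsLorentzSubgroup (H : Set Mat4) : Prop where
  subset : H ⊆ SO31
  one_mem : 1 ∈ H
  mul_mem : ∀ {g h}, g ∈ H → h ∈ H → g * h ∈ H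
  inv_mem : ∀ {g}, g ∈ H → g⁻¹ ∈ H

theorem isLorentzSubgroup_HL : IsLorentzSubgroup HL where
  subset := fun _ h => h.1
  one_mem := ⟨one_mem_SO31, by simp⟩
  mul_mem := fun {g h} hg hh =>
    ⟨mul_mem_SO31 hg.1 hh.1, by rw [← Matrix.mulVec_mulVec, hh.2, hg.2]⟩
  inv_mem := fun {g} hg => ⟨inv_mem_SO31 hg.1, by
    nth_rw 1 [← hg.2]; exact inv_mulVec_mulVec hg.1 _⟩

theorem e4_ne_zero : e4 ≠ 0 := fun h => by simpa [e4] using congr_fun h 3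

theorem isLorentzSubgroup_HM : IsLorentzSubgroup HM where
  subset := fun _ h => h.1
  one_mem := ⟨one_mem_SO31, 1, by simp⟩
  mul_mem := fun {g h} hg hh => by
    obtain ⟨hg, c, hc⟩ := hg
    obtain ⟨hh, d, hd⟩ := hh
    exact ⟨mul_mem_SO31 hg hh, c * d, by
      rw [← Matrix.mulVec_mulVec, hd, Matrix.mulVec_smul, hc, smul_smul, mul_comm]⟩
  inv_mem := fun {g} hg => by
    obtain ⟨hg, c, hc⟩ := hg
    have h := inv_mulVec_mulVec hg e4
    rw [hc, Matrix.mulVec_smul] at h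
    have hc0 : c ≠ 0 := by rintro rfl; exact e4_ne_zero (by rw [← h, zero_smul])
    exact ⟨inv_mem_SO31 hg, c⁻¹, by rw [← h, smul_smul, h, inv_mul_cancel₀ hc0, one_smul]⟩

theorem HL_subset_HM : HL ⊆ HM := fun _ h => ⟨h.1, 1, by rw [h.2, one_smul]⟩

theorem contDiff_inv_of_mem_SO31 {E : Type*} [NormedAddCommGroup E] [NormedSpace ℝ E]
    {g : E → Mat4} (hs : ContDiff ℝ ∞ g) (hg : ∀ x, g x ∈ SO31) :
    ContDiff ℝ ∞ fun x => (g x)⁻¹ := by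
  simp only [inv_eq_of_mem_SO31 (hg _)]
  exact contDiff_matMul (contDiff_matMul contDiff_const (contDiff_matTranspose hs)) contDiff_const

/-! ### The gauge action of loop groups. -/

section Gauge

variable {T : ℝ} {H : Set Mat4}

theorem one_mem_groupLoops (hH : IsLorentzSubgroup H) : (fun _ => 1) ∈ groupLoops T H :=
  ⟨⟨contDiff_const, fun _ => rfl⟩, fun _ => hH.one_mem⟩

theorem mul_mem_groupLoops (hH : IsLorentzSubgroup H) {g h : ℝ → Mat4}
    (hg : g ∈ groupLoops T H) (hh : h ∈ groupLoops T H) :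
    (fun x => g x * h x) ∈ groupLoops T H :=
  ⟨⟨contDiff_matMul hg.1.1 hh.1.1, fun x => by simp only [hg.1.2 x, hh.1.2 x]⟩,
    fun x => hH.mul_mem (hg.2 x) (hh.2 x)⟩

theorem inv_mem_groupLoops (hH : IsLorentzSubgroup H) {g : ℝ → Mat4}
    (hg : g ∈ groupLoops T H) : (fun x => (g x)⁻¹) ∈ groupLoops T H :=
  ⟨⟨contDiff_inv_of_mem_SO31 hg.1.1 fun x => hH.subset (hg.2 x),
    fun x => by simp only [hg.1.2 x]⟩, fun x => hH.inv_mem (hg.2 x)⟩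

/-- The form of the gauge action without inverses on the right: identities between entries, and
derivatives in a parameter, are read off from it. -/
theorem gauge_mul_self {g : ℝ → Mat4} (hg : ∀ x, g x ∈ SO31) (L : ℝ → Mat4) (x : ℝ) :
    gauge g L x * g x = g x * L x - deriv g x := by
  rw [gauge, Matrix.sub_mul, Matrix.mul_assoc _ (g x)⁻¹, Matrix.mul_assoc _ (g x)⁻¹,
    inv_mul_of_mem_SO31 (hg x), Matrix.mul_one, Matrix.mul_one]

theorem gauge_eq_of_mul_eq {g : ℝ → Mat4} (hg : ∀ x, g x ∈ SO31) {L L' : ℝ → Mat4}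
    (h : ∀ x, L' x * g x = g x * L x - deriv g x) : gauge g L = L' := by
  funext x
  have h1 : gauge g L x * g x * (g x)⁻¹ = L' x * g x * (g x)⁻¹ := by
    rw [gauge_mul_self hg, h]
  simpa [Matrix.mul_assoc, mul_inv_of_mem_SO31 (hg x)] using h1

theorem gauge_gauge {g h : ℝ → Mat4} (hgs : ContDiff ℝ ∞ g) (hhs : ContDiff ℝ ∞ h)
    (hg : ∀ x, g x ∈ SO31) (hh : ∀ x, h x ∈ SO31) (L : ℝ → Mat4) :
    gauge g (gauge h L) = gauge (fun x => g x * h x) L := by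
  refine (gauge_eq_of_mul_eq (fun x => mul_mem_SO31 (hg x) (hh x)) fun x => ?_).symm
  rw [deriv_matMul hgs hhs,
    ← Matrix.mul_assoc, gauge_mul_self hg, Matrix.sub_mul, Matrix.mul_assoc, gauge_mul_self hh,
    Matrix.mul_sub, Matrix.mul_assoc]
  abel

theorem gauge_one (L : ℝ → Mat4) : gauge (fun _ => 1) L = L := by
  funext x; simp [gauge, deriv_mat_const]

theorem gauge_inv_gauge {g : ℝ → Mat4} (hgs : ContDiff ℝ ∞ g) (hg : ∀ x, g x ∈ SO31)
    (L : ℝ → Mat4) : gauge (fun x => (g x)⁻¹) (gauge g L) = L := by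
  rw [gauge_gauge (contDiff_inv_of_mem_SO31 hgs hg) hgs (fun x => inv_mem_SO31 (hg x)) hg]
  simp only [inv_mul_of_mem_SO31 (hg _), gauge_one]

theorem gauge_mem_so31 {g : ℝ → Mat4} (hgs : ContDiff ℝ ∞ g) (hg : ∀ x, g x ∈ SO31)
    {L : ℝ → Mat4} (hL : ∀ x, L x ∈ so31) (x : ℝ) : gauge g L x ∈ so31 :=
  sub_mem_so31 (conj_mem_so31 (hg x) (hL x))
    (deriv_mul_inv_mem_so31 (hasDerivAt_mat hgs x) hg)

theorem gauge_mem_algLoops {g L : ℝ → Mat4} (hg : g ∈ groupLoops T SO31)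
    (hL : L ∈ algLoops T) : gauge g L ∈ algLoops T := by
  have hi := contDiff_inv_of_mem_SO31 hg.1.1 hg.2
  refine ⟨⟨?_, fun x => ?_⟩, gauge_mem_so31 hg.1.1 hg.2 hL.2⟩
  · exact (contDiff_matMul (contDiff_matMul hg.1.1 hL.1.1) hi).sub
      (contDiff_matMul (contDiff_deriv_mat hg.1.1) hi)
  · simp only [gauge, hg.1.2 x, hL.1.2 x, periodic_deriv_mat hg.1.2 x]

theorem groupLoops_mono {H' : Set Mat4} (h : H ⊆ H') : groupLoops T H ⊆ groupLoops T H' :=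
  fun _ hg => ⟨hg.1, fun x => h (hg.2 x)⟩

end Gauge

/-! ### Linear differential equations -/

section LinearODE

variable {E : Type*} [NormedAddCommGroup E] [NormedSpace ℝ E]

/-- The terms of the Dyson series of the linear equation `y' = A y`, `y 0 = y₀`. -/
noncomputable def dysonTerm (A : ℝ → E →L[ℝ] E) (y₀ : E) : ℕ → ℝ → E
  | 0 => fun _ => y₀
  | n + 1 => fun t => ∫ s in (0 : ℝ)..t, A s (dysonTerm A y₀ n s)

theorem continuous_dysonTerm {A : ℝ → E →L[ℝ] E} (hA : Continuous A) (y₀ : E) (n : ℕ) :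
    Continuous (dysonTerm A y₀ n) := by
  induction n with
  | zero => exact continuous_const
  | succ n ih =>
    exact intervalIntegral.continuous_primitive (μ := MeasureTheory.volume)
      (fun a b => (hA.clm_apply ih).intervalIntegrable a b) 0

theorem hasDerivAt_dysonTerm [CompleteSpace E] {A : ℝ → E →L[ℝ] E} (hA : Continuous A) (y₀ : E) (n : ℕ) (t : ℝ) :
    HasDerivAt (dysonTerm A y₀ (n + 1)) (A t (dysonTerm A y₀ n t)) t :=
  (hA.clm_apply (continuous_dysonTerm hA y₀ n)).integral_hasStrictDerivAt 0 t |>.hasDerivAt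

/-- Each integration raises the power of `|t|` by one and divides by the new exponent, which builds
up the factorial. -/
theorem norm_dysonTerm_le {A : ℝ → E →L[ℝ] E} (hA : Continuous A) (y₀ : E) {R M : ℝ}
    (hM : ∀ t, |t| ≤ R → ‖A t‖ ≤ M) (n : ℕ) {t : ℝ} (ht : |t| ≤ R) :
    ‖dysonTerm A y₀ n t‖ ≤ ‖y₀‖ * ((M * |t|) ^ n / n.factorial) := by
  have hM0 : 0 ≤ M := (norm_nonneg _).trans (hM t ht)
  induction n generalizing t with
  | zero => simp [dysonTerm]
  | succ n ih =>
    have hsub (s : ℝ) (hs : s ∈ Set.uIoc 0 t) : |s| ≤ |t| := by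
      rcases le_total 0 t with h | h
      · rw [Set.uIoc_of_le h] at hs; rw [abs_of_pos hs.1, abs_of_nonneg h]; exact hs.2
      · rw [Set.uIoc_of_ge h] at hs; rw [abs_of_nonpos hs.2, abs_of_nonpos h]; linarith [hs.1]
    have hc : Continuous fun s => A s (dysonTerm A y₀ n s) :=
      hA.clm_apply (continuous_dysonTerm hA y₀ n)
    calc ‖dysonTerm A y₀ (n + 1) t‖
        ≤ ∫ s in Set.uIoc 0 t, ‖A s (dysonTerm A y₀ n s)‖ :=
          intervalIntegral.norm_integral_le_integral_norm_uIoc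
      _ ≤ ∫ s in Set.uIoc 0 t, M * (‖y₀‖ * (M ^ n / n.factorial)) * |s - 0| ^ n := by
          refine MeasureTheory.setIntegral_mono_on hc.norm.integrableOn_uIoc
            (Continuous.integrableOn_uIoc (by fun_prop)) measurableSet_uIoc fun s hs => ?_
          have h1 := hsub s hs
          calc ‖A s (dysonTerm A y₀ n s)‖ ≤ ‖A s‖ * ‖dysonTerm A y₀ n s‖ := (A s).le_opNorm _
            _ ≤ M * (‖y₀‖ * ((M * |s|) ^ n / n.factorial)) := by
                gcongr
                exacts [hM s (h1.trans ht), ih (h1.trans ht)]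
            _ = _ := by rw [sub_zero, mul_pow]; ring
      _ = ‖y₀‖ * ((M * |t|) ^ (n + 1) / (n + 1).factorial) := by
          rw [MeasureTheory.integral_const_mul, integral_pow_abs_sub_uIoc, sub_zero,
            Nat.factorial_succ]
          push_cast
          field_simp
          ring

/-- Global existence for linear differential equations with continuous coefficients. -/
theorem exists_linear_solution [CompleteSpace E] {A : ℝ → E →L[ℝ] E} (hA : Continuous A) (y₀ : E) :
    ∃ y : ℝ → E, y 0 = y₀ ∧ ∀ t, HasDerivAt y (A t (y t)) t := by
  have hbound (R : ℝ) : ∃ M, ∀ t, |t| ≤ R → ‖A t‖ ≤ M := by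
    obtain ⟨M, hM⟩ := (isCompact_Icc (a := -R) (b := R)).exists_bound_of_continuousOn hA.continuousOn
    exact ⟨M, fun t ht => hM t (abs_le.1 ht)⟩
  have hsumb (R M : ℝ) : Summable fun n : ℕ => ‖y₀‖ * ((M * R) ^ n / n.factorial) :=
    (Real.summable_pow_div_factorial (M * R)).mul_left _
  have hsum (t : ℝ) : Summable fun n => dysonTerm A y₀ n t := by
    obtain ⟨M, hM⟩ := hbound |t|
    exact .of_norm_bounded (hsumb |t| M) fun n => norm_dysonTerm_le hA y₀ hM n le_rfl
  refine ⟨fun t => ∑' n, dysonTerm A y₀ n t, ?_, fun t => ?_⟩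
  · change ∑' n, dysonTerm A y₀ n 0 = y₀
    rw [tsum_eq_single 0]
    · rfl
    · rintro (_ | n) hn
      · exact absurd rfl hn
      · simp [dysonTerm]
  · obtain ⟨M, hM⟩ := hbound (|t| + 1)
    have hM0 : 0 ≤ M := (norm_nonneg _).trans (hM t (by linarith))
    have hmem {s : ℝ} (hs : s ∈ Metric.ball (0 : ℝ) (|t| + 1)) : |s| ≤ |t| + 1 := by
      simpa using (mem_ball_zero_iff.1 hs).le
    -- The zeroth term is constant, so the series is shifted and differentiated term by term on a
    -- ball around `0` that contains `t`, where the exponential series dominates the derivatives.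
    have key : HasDerivAt (fun s => ∑' n, dysonTerm A y₀ (n + 1) s)
        (∑' n, A t (dysonTerm A y₀ n t)) t := by
      refine hasDerivAt_tsum_of_isPreconnected (t := Metric.ball 0 (|t| + 1)) (y₀ := 0)
        ((hsumb (|t| + 1) M).mul_left M) Metric.isOpen_ball
        (convex_ball _ _).isPreconnected (fun n s _ => hasDerivAt_dysonTerm hA y₀ n s)
        (fun n s hs => ?_) (by simp; positivity) ((summable_nat_add_iff 1).2 (hsum 0))
        (by simp)
      have h1 := hmem hs
      calc ‖A s (dysonTerm A y₀ n s)‖ ≤ ‖A s‖ * ‖dysonTerm A y₀ n s‖ := (A s).le_opNorm _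
        _ ≤ M * (‖y₀‖ * ((M * |s|) ^ n / n.factorial)) := by
            gcongr
            exacts [hM s h1, norm_dysonTerm_le hA y₀ hM n h1]
        _ ≤ _ := by gcongr
    have hy : (fun s => ∑' n, dysonTerm A y₀ n s) =
        fun s => y₀ + ∑' n, dysonTerm A y₀ (n + 1) s := by
      funext s; rw [(hsum s).tsum_eq_zero_add]; rfl
    rw [(A t).map_tsum (hsum t), hy]
    exact key.const_add y₀

end LinearODE

/-! ### Matrix equations `r' = r K`: regularity, values in the group, monodromy. -/

/-- Bootstrapping: if `r` is `Cⁿ` then so is `r K`, which is the derivative of `r`. -/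
theorem contDiff_of_matrix_equation {r K : ℝ → Mat4} (hK : ContDiff ℝ ∞ K)
    (hr : ∀ x, HasDerivAt r (r x * K x) x) : ContDiff ℝ ∞ r := by
  have hn (n : ℕ) : ContDiff ℝ n r := by
    induction n with
    | zero => exact contDiff_zero.2 (continuous_iff_continuousAt.2 fun x => (hr x).continuousAt)
    | succ n ih =>
      have hd : deriv r = fun x => r x * K x := funext fun x => deriv_mat_eq (hr x)
      have h2 : ContDiff ℝ n (deriv r) := by
        rw [hd]; exact contDiff_matMul ih (hK.of_le (by exact_mod_cast le_top))
      exact contDiff_succ_iff_deriv.2 ⟨fun x => (hr x).differentiableAt, by simp, h2⟩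
  exact contDiff_infty.2 hn

theorem exists_matrix_solution {K : ℝ → Mat4} (hK : ContDiff ℝ ∞ K) :
    ∃ r : ℝ → Mat4, r 0 = 1 ∧ ContDiff ℝ ∞ r ∧ ∀ x, HasDerivAt r (r x * K x) x := by
  -- `Φ K` is right multiplication by `K`; it is continuous in `K` because the space is finite
  -- dimensional.
  let Φ : Mat4 →ₗ[ℝ] (Mat4 →L[ℝ] Mat4) :=
    LinearMap.toContinuousLinearMap.toLinearMap ∘ₗ (LinearMap.mul ℝ Mat4).flip
  have hΦ : Continuous Φ := Φ.continuous_of_finiteDimensional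
  obtain ⟨r, h0, hr⟩ := exists_linear_solution (hΦ.comp hK.continuous) 1
  have hr' (x : ℝ) : HasDerivAt r (r x * K x) x := hr x
  exact ⟨r, h0, contDiff_of_matrix_equation hK hr', hr'⟩

/-- The derivative of `r J rᵀ` is `r (K J + J Kᵀ) rᵀ = 0`, so this matrix stays equal to `J`. The
determinant is then a continuous sign with value `1` at `0`. -/
theorem matrix_solution_mem_SO31 {r K : ℝ → Mat4} (hK : ∀ x, K x ∈ so31) (h0 : r 0 = 1)
    (hr : ∀ x, HasDerivAt r (r x * K x) x) (x : ℝ) : r x ∈ SO31 := by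
  have hd (y : ℝ) : HasDerivAt (fun y => r y * J * (r y)ᵀ) 0 y := by
    have hK' : K y * J + J * (K y)ᵀ = 0 := by
      have := transpose_mem_so31 (hK y)
      simpa [so31] using this
    convert! hasDerivAt_matMul (hasDerivAt_matMul (hr y) (hasDerivAt_const y J))
      (hasDerivAt_matTranspose (hr y)) using 1
    simp only [Matrix.mul_zero, add_zero, Matrix.transpose_mul]
    calc (0 : Mat4) = r y * (K y * J + J * (K y)ᵀ) * (r y)ᵀ := by rw [hK']; simp
      _ = _ := by simp only [Matrix.mul_add, Matrix.add_mul, Matrix.mul_assoc]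
  have hJ (y : ℝ) : r y * J * (r y)ᵀ = J := by
    have := is_const_of_deriv_eq_zero (fun y => (hd y).differentiableAt) (fun y => (hd y).deriv) y 0
    simpa [h0] using this
  -- The previous relation says that `J rᵀ J` is a right inverse of `r`, hence it is also a left
  -- inverse.
  have hJ' (y : ℝ) : (r y)ᵀ * J * r y = J := by
    have h1 : r y * (J * (r y)ᵀ * J) = 1 := by
      rw [← Matrix.mul_assoc, ← Matrix.mul_assoc, hJ, J_mul_J]
    have h2 : (J * (r y)ᵀ * J) * r y = 1 := mul_eq_one_comm.1 h1
    calc (r y)ᵀ * J * r y = J * (J * (r y)ᵀ * J * r y) := by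
          simp only [← Matrix.mul_assoc, J_mul_J, Matrix.one_mul]
      _ = J := by rw [h2, Matrix.mul_one]
  have hJd : J.det ≠ 0 := fun h => by
    have := congr_arg Matrix.det J_mul_J
    rw [Matrix.det_mul, h] at this; simp at this
  have hsq (y : ℝ) : (r y).det ^ 2 = 1 := by
    have := congr_arg Matrix.det (hJ' y)
    rw [Matrix.det_mul, Matrix.det_mul, Matrix.det_transpose] at this
    exact mul_left_cancel₀ hJd (by linear_combination this)
  have hc : Continuous fun y => (r y).det :=
    (continuous_iff_continuousAt.2 fun y => (hr y).continuousAt : Continuous r).matrix_det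
  refine ⟨hJ' x, ?_⟩
  rcases eq_one_or_eq_neg_one_of_sq hc hsq with h | h
  · exact h x
  · have := h 0
    rw [h0, Matrix.det_one] at this
    norm_num at this

theorem hasDerivAt_inv_SO31 {g : ℝ → Mat4} {g' : Mat4} {x : ℝ} (hd : HasDerivAt g g' x)
    (hg : ∀ y, g y ∈ SO31) : HasDerivAt (fun y => (g y)⁻¹) (-((g x)⁻¹ * g' * (g x)⁻¹)) x := by
  have h := hasDerivAt_matMul (hasDerivAt_matMul (hasDerivAt_const x J)
    (hasDerivAt_matTranspose hd)) (hasDerivAt_const x J)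
  simp only [← inv_eq_of_mem_SO31 (hg _)] at h
  have h1 := hasDerivAt_matMul h hd
  simp only [inv_mul_of_mem_SO31 (hg _)] at h1
  have h2 := h1.unique (hasDerivAt_const x 1)
  convert! h using 1
  generalize (0 * (g x)ᵀ + J * g'ᵀ) * J + J * (g x)ᵀ * 0 = d at h2
  calc -((g x)⁻¹ * g' * (g x)⁻¹) = (d * g x + (g x)⁻¹ * g') * (g x)⁻¹
        - (g x)⁻¹ * g' * (g x)⁻¹ := by rw [h2]; simp
    _ = d := by
      rw [Matrix.add_mul, Matrix.mul_assoc d, mul_inv_of_mem_SO31 (hg x)]; simp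

/-- The fundamental solution of a linear equation with periodic coefficients has monodromy. -/
theorem matrix_solution_monodromy {r K : ℝ → Mat4} {T : ℝ} (hK : Function.Periodic K T)
    (hmem : ∀ x, r x ∈ SO31) (hr : ∀ x, HasDerivAt r (r x * K x) x) :
    ∃ g ∈ SO31, ∀ x, r (x + T) = g * r x := by
  have hd (x : ℝ) : HasDerivAt (fun y => r (y + T) * (r y)⁻¹) 0 x := by
    convert! hasDerivAt_matMul ((hr (x + T)).comp_add_const x T)
      (hasDerivAt_inv_SO31 (hr x) hmem) using 1
    rw [hK x, ← Matrix.mul_assoc (r x)⁻¹, inv_mul_of_mem_SO31 (hmem x)]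
    simp [Matrix.mul_assoc]
  refine ⟨r (0 + T) * (r 0)⁻¹, mul_mem_SO31 (hmem _) (inv_mem_SO31 (hmem _)), fun x => ?_⟩
  have := is_const_of_deriv_eq_zero (fun y => (hd y).differentiableAt) (fun y => (hd y).deriv) x 0
  rw [← this, Matrix.mul_assoc, inv_mul_of_mem_SO31 (hmem x), Matrix.mul_one]

/-! ### Moving frames along curves in the cone -/

theorem mcCone_injective {k k' : Fin 3 → ℝ} (h : mcCone k = mcCone k') : k = k' := by
  have h0 := congr_fun (congr_fun h 0) 1
  have h1 := congr_fun (congr_fun h 1) 0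
  have h2 := congr_fun (congr_fun h 2) 0
  simp [mcCone] at h0 h1 h2
  ext i; fin_cases i <;> assumption

theorem mcCone_mem_so31 (k : Fin 3 → ℝ) : mcCone k ∈ so31 := by
  rw [mcCone_eq_alg]; exact alg_mem_so31 ..

theorem contDiff_mcCone {E : Type*} [NormedAddCommGroup E] [NormedSpace ℝ E]
    {k : E → Fin 3 → ℝ} (hk : ContDiff ℝ ∞ k) : ContDiff ℝ ∞ fun x => mcCone (k x) := by
  have h := contDiff_pi.1 hk
  refine contDiff_mat_iff.2 fun i j => ?_
  fin_cases i <;> fin_cases j <;> simp [mcCone] <;> first | exact h _ | exact contDiff_const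

theorem mulVec_e4 (g : Mat4) : g *ᵥ e4 = ![g 0 3, g 1 3, g 2 3, g 3 3] := by
  ext i; fin_cases i <;> simp [e4, Matrix.mulVec, dotProduct, Fin.sum_univ_four]

/-- The quotient `h = g' g⁻¹` fixes `e₄` and `e₂`. Since `⟨u, w⟩ ≠ 0`, the vector `g w` has nonzero
coordinate `0`, and comparing the third coordinates of `h (g w) = g' w` gives `h 2 0 = 0`; then
`eq_one_of_fixes` applies. Applied to the 2-jet of a cone curve, it yields both uniqueness of the
frame and its behaviour under the monodromy. -/
theorem frame_unique {g g' : Mat4} (hg : g ∈ SO31) (hg' : g' ∈ SO31) {u v w : Vec4} {l : ℝ}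
    (hl : l ≠ 0) (h0 : g *ᵥ u = e4) (h0' : g' *ᵥ u = e4) (h1 : g *ᵥ v = ![0, l, 0, 0])
    (h1' : g' *ᵥ v = ![0, l, 0, 0]) (h2 : (g *ᵥ w) 2 = 0) (h2' : (g' *ᵥ w) 2 = 0)
    (huw : mink u w ≠ 0) : g = g' := by
  set h := g' * g⁻¹ with hh
  have hcomp (z : Vec4) : h *ᵥ (g *ᵥ z) = g' *ᵥ z := by
    rw [hh, ← Matrix.mulVec_mulVec, inv_mulVec_mulVec hg]
  have hm : h ∈ SO31 := mul_mem_SO31 hg' (inv_mem_SO31 hg)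
  have e2 : h *ᵥ ![0, 1, 0, 0] = ![0, 1, 0, 0] := by
    have hs : ![0, l, 0, 0] = l • (![0, 1, 0, 0] : Vec4) := by
      ext i; fin_cases i <;> simp
    have := hcomp v
    rw [h1, h1', hs, Matrix.mulVec_smul] at this
    exact smul_right_injective _ hl this
  have e4' : h *ᵥ e4 = e4 := by rw [← h0, hcomp, h0', h0]
  have h21 : h 2 1 = 0 := by
    simpa [Matrix.mulVec, dotProduct, Fin.sum_univ_four] using congr_fun e2 2
  have h23 : h 2 3 = 0 := by
    simpa [e4, Matrix.mulVec, dotProduct, Fin.sum_univ_four] using congr_fun e4' 2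
  have hw0 : (g *ᵥ w) 0 ≠ 0 := by
    rw [← mink_mulVec hg, h0, mink_eq] at huw
    simpa [e4] using huw
  have h20 : h 2 0 = 0 := by
    have := congr_fun (hcomp w) 2
    rw [h2', Matrix.mulVec] at this
    simp only [dotProduct, Fin.sum_univ_four, h21, h23, h2] at this
    simpa [hw0] using this
  have h1 := eq_one_of_fixes hm e4' e2 h20
  calc g = h * g := by rw [h1, Matrix.one_mul]
    _ = g' := by rw [hh, Matrix.mul_assoc, inv_mul_of_mem_SO31 hg, Matrix.mul_one]

theorem mink_deriv_eq_zero {u : ℝ → Vec4} (hu : ContDiff ℝ ∞ u) (hn : ∀ x, mink (u x) (u x) = 0)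
    (x : ℝ) : mink (u x) (deriv u x) = 0 := by
  have hd := hasDerivAt_of_smooth hu x
  have h := hasDerivAt_mink hd hd
  rw [show (fun y => mink (u y) (u y)) = fun _ => 0 from funext hn] at h
  have := h.unique (hasDerivAt_const x 0)
  rw [mink_comm] at this; linarith

theorem mink_deriv_deriv {u : ℝ → Vec4} (hu : ContDiff ℝ ∞ u) (hn : ∀ x, mink (u x) (u x) = 0)
    (x : ℝ) : mink (u x) (deriv (deriv u) x) = -mink (deriv u x) (deriv u x) := by
  have h := hasDerivAt_mink (hasDerivAt_of_smooth hu x)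
    (hasDerivAt_of_smooth (contDiff_deriv hu) x)
  rw [show (fun y => mink (u y) (deriv u y)) = fun _ => 0 from
    funext (mink_deriv_eq_zero hu hn)] at h
  have := h.unique (hasDerivAt_const x 0)
  linarith

theorem IsConeFrame.unique {u : ℝ → Vec4} (hu : ContDiff ℝ ∞ u) (hn : ∀ x, mink (u x) (u x) = 0)
    (hr : ∀ x, 0 < mink (deriv u x) (deriv u x)) {ρ ρ' : ℝ → Mat4} (hρ : IsConeFrame u ρ)
    (hρ' : IsConeFrame u ρ') : ρ = ρ' := by
  funext x
  refine frame_unique (hρ.mem x) (hρ'.mem x) (Real.sqrt_pos.2 (hr x)).ne' (hρ.zeroth x)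
    (hρ'.zeroth x) (hρ.first x) (hρ'.first x) (hρ.second x) (hρ'.second x) ?_
  rw [mink_deriv_deriv hu hn]
  exact (neg_neg_of_pos (hr x)).ne

/-- The Maurer-Cartan matrix of the moving frame of a cone curve. -/
theorem IsConeFrame.exists_invariants {u : ℝ → Vec4} (hu : ContDiff ℝ ∞ u)
    (hr : ∀ x, 0 < mink (deriv u x) (deriv u x)) {ρ : ℝ → Mat4} (hρ : IsConeFrame u ρ) :
    ∃ k : ℝ → Fin 3 → ℝ, ContDiff ℝ ∞ k ∧
      (∀ x, k x 0 = Real.sqrt (mink (deriv u x) (deriv u x))) ∧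
      ∀ x, deriv ρ x * (ρ x)⁻¹ = -mcCone (k x) := by
  set l : ℝ → ℝ := fun x => Real.sqrt (mink (deriv u x) (deriv u x)) with hl
  have hlpos (x : ℝ) : 0 < l x := Real.sqrt_pos.2 (hr x)
  have hls : ContDiff ℝ ∞ l :=
    (contDiff_mink (contDiff_deriv hu) (contDiff_deriv hu)).sqrt fun x => (hr x).ne'
  set A : ℝ → Mat4 := fun x => -(deriv ρ x * (ρ x)⁻¹) with hA
  have hAs : ContDiff ℝ ∞ A := (contDiff_matMul (contDiff_deriv_mat hρ.smooth)
    (contDiff_inv_of_mem_SO31 hρ.smooth hρ.mem)).neg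
  have hAm (x : ℝ) : A x ∈ so31 :=
    neg_mem_so31 (deriv_mul_inv_mem_so31 (hasDerivAt_mat hρ.smooth x) hρ.mem)
  have hAv (x : ℝ) (v : Vec4) : A x *ᵥ (ρ x *ᵥ v) = -(deriv ρ x *ᵥ v) := by
    rw [hA, Matrix.neg_mulVec, ← Matrix.mulVec_mulVec, inv_mulVec_mulVec (hρ.mem x)]
  -- Differentiating `ρ u = e₄` gives the last column of `A`: the entries `p` and `q₂` vanish, and
  -- `q₁` is the speed.
  have h4 (x : ℝ) : A x *ᵥ e4 = ![0, l x, 0, 0] := by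
    have h := hasDerivAt_mulVec (hasDerivAt_mat hρ.smooth x) (hasDerivAt_of_smooth hu x)
    rw [show (fun y => ρ y *ᵥ u y) = fun _ => e4 from funext hρ.zeroth] at h
    have h0 := h.unique (hasDerivAt_const x e4)
    rw [← hρ.zeroth x, hAv, ← hρ.first x, neg_eq_iff_add_eq_zero]
    exact h0
  -- Differentiating the third coordinate of `ρ u'`, together with the second-order normalization,
  -- makes the entry `s` vanish.
  have h2 (x : ℝ) : (A x *ᵥ ![0, l x, 0, 0]) 2 = 0 := by
    have h := hasDerivAt_mulVec (hasDerivAt_mat hρ.smooth x)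
      (hasDerivAt_of_smooth (contDiff_deriv hu) x)
    rw [show (fun y => ρ y *ᵥ deriv u y) = fun y => ![0, l y, 0, 0] from funext hρ.first] at h
    have h' := (hasDerivAt_pi.1 h 2).unique (hasDerivAt_const x 0)
    rw [← hρ.first x, hAv]
    simpa [hρ.second x] using h'
  refine ⟨fun x => ![A x 0 1, A x 1 0, A x 2 0], ?_, fun x => ?_, fun x => ?_⟩
  · refine contDiff_pi.2 fun i => ?_
    fin_cases i
    exacts [contDiff_entry hAs 0 1, contDiff_entry hAs 1 0, contDiff_entry hAs 2 0]
  all_goals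
    have hform := eq_alg_of_mem_so31 (hAm x)
    have h4x := h4 x
    have h2x := h2 x
    rw [mulVec_e4, hform] at h4x
    have e1 := congr_fun h4x 1
    have e2 := congr_fun h4x 2
    have e3 := congr_fun h4x 3
    simp [alg] at e1 e2 e3
  · simpa using e1
  · rw [hform] at h2x
    have e12 : A x 1 2 = 0 := by
      simpa [alg, Matrix.mulVec, dotProduct, Fin.sum_univ_four, (hlpos x).ne'] using h2x
    rw [e2, e3, e12] at hform
    rw [mcCone_eq_alg]
    simp only [Matrix.cons_val_zero, Matrix.cons_val_one, Matrix.cons_val_two, Matrix.head_cons,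
      Matrix.tail_cons]
    rw [← hform, hA, neg_neg]

theorem HasConeInvariants.smooth {u : ℝ → Vec4} (hu : ContDiff ℝ ∞ u)
    (hr : ∀ x, 0 < mink (deriv u x) (deriv u x)) {k : ℝ → Fin 3 → ℝ}
    (hk : HasConeInvariants u k) :
    ContDiff ℝ ∞ k ∧ ∀ x, k x 0 = Real.sqrt (mink (deriv u x) (deriv u x)) := by
  obtain ⟨ρ, hρ, hk⟩ := hk
  obtain ⟨k', hs, h0, hk'⟩ := hρ.exists_invariants hu hr
  have : k = k' := funext fun x => mcCone_injective (neg_injective ((hk x).symm.trans (hk' x)))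
  rw [this]; exact ⟨hs, h0⟩

theorem HasConeInvariants.unique {u : ℝ → Vec4} (hu : ContDiff ℝ ∞ u)
    (hn : ∀ x, mink (u x) (u x) = 0) (hr : ∀ x, 0 < mink (deriv u x) (deriv u x))
    {k k' : ℝ → Fin 3 → ℝ} (hk : HasConeInvariants u k) (hk' : HasConeInvariants u k') :
    k = k' := by
  obtain ⟨ρ, hρ, hk⟩ := hk
  obtain ⟨ρ', hρ', hk'⟩ := hk'
  obtain rfl := hρ.unique hu hn hr hρ'
  exact funext fun x => mcCone_injective (neg_injective ((hk x).symm.trans (hk' x)))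

theorem deriv_add_period {u : ℝ → Vec4} {g : Mat4} {T : ℝ} (hu : ContDiff ℝ ∞ u)
    (hm : ∀ x, u (x + T) = g *ᵥ u x) (x : ℝ) : deriv u (x + T) = g *ᵥ deriv u x := by
  rw [← deriv_comp_add_const]
  have h := hasDerivAt_mulVec (hasDerivAt_const x g) (hasDerivAt_of_smooth hu x)
  simp only [Matrix.zero_mulVec, zero_add] at h
  rw [← h.deriv]
  congr 1; exact funext hm

/-- Both `ρ (x + T) g` and `ρ x` normalize the 2-jet of `u` at `x`, so they coincide, and the
constant `g` cancels in `ρ' ρ⁻¹`. -/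
theorem HasConeInvariants.periodic {T : ℝ} {u : ℝ → Vec4} (hu : IsConeCurve T u)
    {k : ℝ → Fin 3 → ℝ} (hk : HasConeInvariants u k) : Function.Periodic k T := by
  obtain ⟨ρ, hρ, hk⟩ := hk
  obtain ⟨g, hg, hm⟩ := hu.monodromy
  have hm1 := deriv_add_period hu.smooth hm
  have hm2 := deriv_add_period (contDiff_deriv hu.smooth) hm1
  have hρT (x : ℝ) : ρ (x + T) * g = ρ x := by
    refine frame_unique (mul_mem_SO31 (hρ.mem _) hg) (hρ.mem x)
      (Real.sqrt_pos.2 (hu.nonradial x)).ne' (u := u x) (v := deriv u x) (w := deriv (deriv u) x)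
      ?_ (hρ.zeroth x) ?_ (hρ.first x) ?_ (hρ.second x) ?_
    · rw [← Matrix.mulVec_mulVec, ← hm, hρ.zeroth]
    · rw [← Matrix.mulVec_mulVec, ← hm1, hρ.first, hm1, mink_mulVec hg]
    · rw [← Matrix.mulVec_mulVec, ← hm2, hρ.second]
    · rw [mink_deriv_deriv hu.smooth hu.null]
      exact (neg_neg_of_pos (hu.nonradial x)).ne
  intro x
  have hd : deriv ρ (x + T) * g = deriv ρ x := by
    have h := hasDerivAt_matMul ((hasDerivAt_mat hρ.smooth (x + T)).comp_add_const x T)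
      (hasDerivAt_const x g)
    simp only [Matrix.mul_zero, add_zero, hρT] at h
    exact (deriv_mat_eq h).symm
  refine mcCone_injective (neg_injective ?_)
  have hgi := mul_inv_of_mem_SO31 hg
  rw [← hk x, ← hk (x + T), ← hd, ← hρT x, Matrix.mul_inv_rev, Matrix.mul_assoc,
    ← Matrix.mul_assoc g, hgi, Matrix.one_mul]

/-! ### Existence of moving frames along curves parametrized by arc-length -/

/-- The determinant of the `3 × 3` minor with rows `i, j, k` of the matrix with columns `a, b, c`. -/
def minor (a b c : Vec4) (i j k : Fin 4) : ℝ :=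
  a i * (b j * c k - b k * c j) - b i * (a j * c k - a k * c j) + c i * (a j * b k - a k * b j)

/-- The Lorentzian cross product of three vectors. -/
def cross (a b c : Vec4) : Vec4 :=
  ![minor a b c 0 1 2, -minor a b c 0 2 3, minor a b c 0 1 3, -minor a b c 1 2 3]

/-- The matrix with columns `a, b, cross a b c, c`. -/
def frameMatrix (a b c : Vec4) : Mat4 :=
  Matrix.of fun i => ![a i, b i, cross a b c i, c i]

/-- The right-hand side is minus the Gram determinant of `a`, `b`, `c`; the sign is that of `det J`.
-/
theorem mink_cross_self (a b c : Vec4) : mink (cross a b c) (cross a b c) =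
    -(mink a a * (mink b b * mink c c - mink b c ^ 2)
      - mink a b * (mink a b * mink c c - mink b c * mink a c)
      + mink a c * (mink a b * mink b c - mink b b * mink a c)) := by
  simp [mink_eq, cross, minor]; ring

theorem mink_cross_first (a b c : Vec4) : mink a (cross a b c) = 0 := by
  simp [mink_eq, cross, minor]; ring

theorem mink_cross_second (a b c : Vec4) : mink b (cross a b c) = 0 := by
  simp [mink_eq, cross, minor]; ring

theorem mink_cross_third (a b c : Vec4) : mink c (cross a b c) = 0 := by
  simp [mink_eq, cross, minor]; ring

/-- The cross product is `J` applied to the cofactors of the third column, so expanding along that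
column gives a Minkowski square. -/
theorem frameMatrix_det (a b c : Vec4) :
    (frameMatrix a b c).det = mink (cross a b c) (cross a b c) := by
  have h (i : Fin 4) : cross a b c i = ![minor a b c 0 1 2, -minor a b c 0 2 3, minor a b c 0 1 3,
    -minor a b c 1 2 3] i := rfl
  simp [Matrix.det_succ_row_zero, Fin.sum_univ_succ, Fin.succAbove, frameMatrix, mink_eq]
  simp [h, minor]
  ring

theorem frameMatrix_mem_SO31 {a b c : Vec4} (haa : mink a a = 0) (hab : mink a b = 0)
    (hac : mink a c = -1) (hbb : mink b b = 1) (hbc : mink b c = 0) (hcc : mink c c = 0) :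
    frameMatrix a b c ∈ SO31 := by
  have hx : mink (cross a b c) (cross a b c) = 1 := by
    rw [mink_cross_self, haa, hab, hac, hbb, hbc, hcc]; norm_num
  refine ⟨?_, by rw [frameMatrix_det, hx]⟩
  have hax := mink_cross_first a b c
  have hbx := mink_cross_second a b c
  have hcx := mink_cross_third a b c
  have hent (i j : Fin 4) : ((frameMatrix a b c)ᵀ * J * frameMatrix a b c) i j =
      mink (![a, b, cross a b c, c] i) (![a, b, cross a b c, c] j) := by
    rw [mink_eq]
    fin_cases i <;> fin_cases j <;>
      simp [Matrix.mul_apply, Fin.sum_univ_four, J, frameMatrix] <;> ring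
  ext i j
  rw [hent]
  fin_cases i <;> fin_cases j <;>
    simp [J, *, mink_comm b a, mink_comm c a, mink_comm c b, mink_comm (cross a b c)]

theorem frameMatrix_mulVec (a b c : Vec4) (x : Vec4) :
    frameMatrix a b c *ᵥ x = x 0 • a + x 1 • b + x 2 • cross a b c + x 3 • c := by
  ext i
  simp [Matrix.mulVec, dotProduct, Fin.sum_univ_four, frameMatrix]; ring

theorem contDiff_frameMatrix {a b c : ℝ → Vec4} (ha : ContDiff ℝ ∞ a) (hb : ContDiff ℝ ∞ b)
    (hc : ContDiff ℝ ∞ c) : ContDiff ℝ ∞ fun x => frameMatrix (a x) (b x) (c x) := by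
  have ha' := contDiff_pi.1 ha
  have hb' := contDiff_pi.1 hb
  have hc' := contDiff_pi.1 hc
  have hm (i j k : Fin 4) : ContDiff ℝ ∞ fun x => minor (a x) (b x) (c x) i j k :=
    (((ha' i).mul (((hb' j).mul (hc' k)).sub ((hb' k).mul (hc' j)))).sub
      ((hb' i).mul (((ha' j).mul (hc' k)).sub ((ha' k).mul (hc' j))))).add
      ((hc' i).mul (((ha' j).mul (hb' k)).sub ((ha' k).mul (hb' j))))
  refine contDiff_mat_iff.2 fun i j => ?_
  fin_cases j
  · exact ha' i
  · exact hb' i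
  · change ContDiff ℝ ∞ fun x => cross (a x) (b x) (c x) i
    fin_cases i
    exacts [hm _ _ _, (hm _ _ _).neg, hm _ _ _, (hm _ _ _).neg]
  · exact hc' i

theorem exists_coneFrame {u : ℝ → Vec4} (hu : ContDiff ℝ ∞ u) (hn : ∀ x, mink (u x) (u x) = 0)
    (ha : IsArcLength u) : ∃ ρ, IsConeFrame u ρ := by
  have hu1 := contDiff_deriv hu
  have hu2 := contDiff_deriv hu1
  -- Since `⟨u, u''⟩ = -1`, this is the multiple for which `n = u'' + β u` is null. Then `n, u', u`
  -- are the columns 0, 1, 3 of an element of the group, and `u'' = n - β u` has no component along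
  -- the cross product.
  set β : ℝ → ℝ := fun x => mink (deriv (deriv u) x) (deriv (deriv u) x) / 2 with hβ
  have hβs : ContDiff ℝ ∞ β := (contDiff_mink hu2 hu2).div_const 2
  set n : ℝ → Vec4 := fun x => deriv (deriv u) x + β x • u x with hn'
  have hns : ContDiff ℝ ∞ n := hu2.add (hβs.smul hu)
  have h01 := mink_deriv_eq_zero hu hn
  have h02 (x : ℝ) : mink (u x) (deriv (deriv u) x) = -1 := by
    rw [mink_deriv_deriv hu hn, ha]
  have h12 (x : ℝ) : mink (deriv u x) (deriv (deriv u) x) = 0 := by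
    have hd := hasDerivAt_of_smooth hu1 x
    have h := hasDerivAt_mink hd hd
    rw [show (fun y => mink (deriv u y) (deriv u y)) = fun _ => 1 from funext ha] at h
    have := h.unique (hasDerivAt_const x 1)
    rw [mink_comm] at this; linarith
  set r : ℝ → Mat4 := fun x => frameMatrix (n x) (deriv u x) (u x) with hr
  have hrs : ContDiff ℝ ∞ r := contDiff_frameMatrix hns hu1 hu
  have hrm (x : ℝ) : r x ∈ SO31 := by
    refine frameMatrix_mem_SO31 ?_ ?_ ?_ (ha x) ?_ (hn x)
    · simp only [hn', mink_add_left, mink_add_right, mink_smul_left, mink_smul_right, hn,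
        mink_comm _ (u x), h02]
      simp only [hβ]; ring
    · rw [hn', mink_add_left, mink_smul_left, h01, mink_comm, h12]; ring
    · rw [hn', mink_add_left, mink_smul_left, hn, mink_comm, h02]; ring
    · rw [mink_comm, h01]
  refine ⟨fun x => (r x)⁻¹, contDiff_inv_of_mem_SO31 hrs hrm, fun x => inv_mem_SO31 (hrm x),
    fun x => ?_, fun x => ?_, fun x => ?_⟩
  · have : u x = r x *ᵥ e4 := by simp [hr, frameMatrix_mulVec, e4]
    rw [this, inv_mulVec_mulVec (hrm x)]
  · have : deriv u x = r x *ᵥ ![0, 1, 0, 0] := by simp [hr, frameMatrix_mulVec]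
    rw [ha, Real.sqrt_one]
    nth_rw 1 [this]
    rw [inv_mulVec_mulVec (hrm x)]
  · have : deriv (deriv u) x = r x *ᵥ ![1, 0, 0, -β x] := by
      simp [hr, frameMatrix_mulVec, hn']
    simp only [this, inv_mulVec_mulVec (hrm x)]
    simp

/-! ### The space of invariants of curves in the cone -/

theorem mcCone_mulVec_e4 (k : Fin 3 → ℝ) : mcCone k *ᵥ e4 = k 0 • ![0, 1, 0, 0] := by
  rw [mulVec_e4]; ext i; fin_cases i <;> simp [mcCone]

theorem mcCone_mulVec_e2 (k : Fin 3 → ℝ) : mcCone k *ᵥ ![0, 1, 0, 0] = ![k 0, 0, 0, k 1] := by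
  ext i; fin_cases i <;> simp [mcCone, Matrix.mulVec, dotProduct, Fin.sum_univ_four]

theorem mink_e4 : mink e4 e4 = 0 := by simp [mink_eq, e4]

/-- Integrating `r' = r K(k)` and setting `u = r e₄` recovers a curve with frame `r⁻¹`. Positivity
of `k₀` makes `u` non-radial and makes `k₀`, not only its absolute value, equal to the speed. -/
theorem mem_coneInvariants_of_loop {T : ℝ} {k : ℝ → Fin 3 → ℝ} (hk : k ∈ loops T (Fin 3 → ℝ))
    (hpos : ∀ x, 0 < k x 0) : k ∈ coneInvariants T := by
  have hKs := contDiff_mcCone hk.1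
  obtain ⟨r, h0, hrs, hr⟩ := exists_matrix_solution hKs
  have hm := matrix_solution_mem_SO31 (fun x => mcCone_mem_so31 (k x)) h0 hr
  obtain ⟨g, hg, hmon⟩ := matrix_solution_monodromy (T := T)
    (fun x => by simp only [hk.2 x]) hm hr
  have hk0 : ContDiff ℝ ∞ fun x => k x 0 := contDiff_pi.1 hk.1 0
  set u : ℝ → Vec4 := fun x => r x *ᵥ e4 with hu
  have hus : ContDiff ℝ ∞ u := contDiff_mulVec hrs contDiff_const
  have hu1 : deriv u = fun x => r x *ᵥ (k x 0 • ![0, 1, 0, 0]) := by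
    funext x
    have h := hasDerivAt_mulVec (hr x) (hasDerivAt_const x e4)
    rw [h.deriv, ← Matrix.mulVec_mulVec, mcCone_mulVec_e4]; simp
  have hnorm (x : ℝ) : mink (deriv u x) (deriv u x) = k x 0 ^ 2 := by
    rw [hu1, mink_mulVec (hm x), mink_smul_left, mink_smul_right, mink_eq]; simp; ring
  have hsqrt (x : ℝ) : Real.sqrt (mink (deriv u x) (deriv u x)) = k x 0 := by
    rw [hnorm, Real.sqrt_sq (hpos x).le]
  have hu2 (x : ℝ) : deriv (deriv u) x = r x *ᵥ ((k x 0 • ![k x 0, 0, 0, k x 1]) +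
      deriv (fun x => k x 0) x • ![0, 1, 0, 0]) := by
    rw [hu1]
    have h := hasDerivAt_mulVec (hr x)
      ((hasDerivAt_of_smooth hk0 x).smul_const (![0, 1, 0, 0] : Vec4))
    rw [h.deriv, ← Matrix.mulVec_mulVec, Matrix.mulVec_smul (mcCone (k x)), mcCone_mulVec_e2,
      ← Matrix.mulVec_add]
  refine ⟨u, ⟨hus, fun x h => ?_, fun x => ?_, fun x => ?_, g, hg, fun x => ?_⟩,
    fun x => (r x)⁻¹, ⟨contDiff_inv_of_mem_SO31 hrs hm, fun x => inv_mem_SO31 (hm x), fun x => ?_,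
      fun x => ?_, fun x => ?_⟩, fun x => ?_⟩
  · have := inv_mulVec_mulVec (hm x) e4
    rw [show r x *ᵥ e4 = 0 from h, Matrix.mulVec_zero] at this
    exact e4_ne_zero this.symm
  · rw [hu, mink_mulVec (hm x), mink_e4]
  · rw [hnorm]; exact pow_pos (hpos x) 2
  · simp only [hu]; rw [hmon, ← Matrix.mulVec_mulVec]
  · exact inv_mulVec_mulVec (hm x) e4
  · rw [hsqrt, hu1, inv_mulVec_mulVec (hm x)]; simp
  · simp only [hu2, inv_mulVec_mulVec (hm x)]; simp
  · rw [deriv_mat_eq (hasDerivAt_inv_SO31 (hr x) hm), ← Matrix.mul_assoc (r x)⁻¹,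
      inv_mul_of_mem_SO31 (hm x), Matrix.one_mul, Matrix.neg_mul,
      Matrix.mul_assoc, mul_inv_of_mem_SO31 (inv_mem_SO31 (hm x)), Matrix.mul_one]

theorem mem_coneInvariants_iff {T : ℝ} {k : ℝ → Fin 3 → ℝ} :
    k ∈ coneInvariants T ↔ k ∈ loops T (Fin 3 → ℝ) ∧ ∀ x, 0 < k x 0 := by
  refine ⟨?_, fun h => mem_coneInvariants_of_loop h.1 h.2⟩
  rintro ⟨u, hu, hk⟩
  obtain ⟨hs, h0⟩ := hk.smooth hu.smooth hu.nonradial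
  exact ⟨⟨hs, hk.periodic hu⟩, fun x => by rw [h0]; exact Real.sqrt_pos.2 (hu.nonradial x)⟩

/-! ### Curves in the projectivized cone -/

theorem affine_smul {a : ℝ} (ha : a ≠ 0) (v : Vec4) : affine (a • v) = affine v := by
  simp [affine, mul_div_mul_left _ _ ha]

theorem exists_rep_eq_smul (v : Vec4) (hv : v ≠ 0) :
    ∃ a : ℝ, a ≠ 0 ∧ (Projectivization.mk ℝ v hv).rep = a • v := by
  obtain ⟨a, ha⟩ := Projectivization.exists_smul_eq_mk_rep ℝ v hv
  exact ⟨a, a.ne_zero, ha.symm⟩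

theorem affine_mulVec_rep (g : Mat4) (v : Vec4) (hv : v ≠ 0) :
    affine (g *ᵥ (Projectivization.mk ℝ v hv).rep) = affine (g *ᵥ v) := by
  obtain ⟨a, ha, h⟩ := exists_rep_eq_smul v hv
  rw [h, Matrix.mulVec_smul, affine_smul ha]

theorem mulVec_rep_apply_ne_zero (g : Mat4) (v : Vec4) (hv : v ≠ 0) (i : Fin 4) :
    (g *ᵥ (Projectivization.mk ℝ v hv).rep) i ≠ 0 ↔ (g *ᵥ v) i ≠ 0 := by
  obtain ⟨a, ha, h⟩ := exists_rep_eq_smul v hv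
  rw [h, Matrix.mulVec_smul, Pi.smul_apply, smul_eq_mul]
  exact mul_ne_zero_iff_left ha |>.trans Iff.rfl

theorem contDiffAt_deriv {V : Type*} [NormedAddCommGroup V] [NormedSpace ℝ V] {f : ℝ → V} {x : ℝ}
    (hf : ContDiffAt ℝ ∞ f x) : ContDiffAt ℝ ∞ (deriv f) x := by
  have h : ContDiffAt ℝ ∞ (fun y => fderiv ℝ f y 1) x :=
    (hf.fderiv_right (m := ∞) (by simp)).clm_apply contDiffAt_const
  simpa only [fderiv_apply_one_eq_deriv] using h

/-- The second jet of a quotient. -/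
theorem jet_div {a b : ℝ → ℝ} (ha : ContDiff ℝ ∞ a) (hb : ContDiff ℝ ∞ b) {x : ℝ} (hx : b x ≠ 0) :
    deriv a x = deriv (fun y => a y / b y) x * b x + a x / b x * deriv b x ∧
    deriv (deriv a) x = deriv (deriv fun y => a y / b y) x * b x +
      2 * deriv (fun y => a y / b y) x * deriv b x + a x / b x * deriv (deriv b) x := by
  have hb0 : ∀ᶠ y in nhds x, b y ≠ 0 := hb.continuous.continuousAt.eventually_ne hx
  set f : ℝ → ℝ := fun y => a y / b y with hf
  have hfs {y : ℝ} (hy : b y ≠ 0) : ContDiffAt ℝ ∞ f y := ha.contDiffAt.div hb.contDiffAt hy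
  have hfd {y : ℝ} (hy : b y ≠ 0) : HasDerivAt f (deriv f y) y :=
    ((hfs hy).differentiableAt (by simp)).hasDerivAt
  -- The Leibniz rule for `a = (a / b) b` near `x` replaces the quotient rule.
  have hab : a =ᶠ[nhds x] fun y => f y * b y := by
    filter_upwards [hb0] with y hy
    simp only [hf]; field_simp
  have h1 : deriv a =ᶠ[nhds x] fun y => deriv f y * b y + f y * deriv b y := by
    filter_upwards [hab.eventuallyEq_nhds, hb0] with y hy hy0
    rw [hy.deriv_eq]
    exact ((hfd hy0).mul (hasDerivAt_of_smooth hb y)).deriv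
  have hfd2 : HasDerivAt (deriv f) (deriv (deriv f) x) x := by
    exact ((contDiffAt_deriv (hfs hx)).differentiableAt (by simp)).hasDerivAt
  refine ⟨h1.eq_of_nhds, ?_⟩
  rw [h1.deriv_eq]
  have := ((hfd2.mul (hasDerivAt_of_smooth hb x)).add
    ((hfd hx).mul (hasDerivAt_of_smooth (contDiff_deriv hb) x))).deriv
  refine this.trans ?_
  simp only [hf]; ring

theorem contDiffAt_affine {w : ℝ → Vec4} (hw : ContDiff ℝ ∞ w) {x : ℝ} (hx : w x 3 ≠ 0) :
    ContDiffAt ℝ ∞ (fun y => affine (w y)) x := by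
  have h := contDiff_pi.1 hw
  refine contDiffAt_pi.2 fun i => ?_
  fin_cases i
  exacts [(h 1).contDiffAt.div (h 3).contDiffAt hx, (h 2).contDiffAt.div (h 3).contDiffAt hx]

theorem deriv_affine_apply {w : ℝ → Vec4} (hw : ContDiff ℝ ∞ w) {x : ℝ} (hx : w x 3 ≠ 0)
    (i : Fin 2) : deriv (fun y => affine (w y)) x i = deriv (fun y => affine (w y) i) x ∧
      deriv (deriv fun y => affine (w y)) x i = deriv (deriv fun y => affine (w y) i) x := by
  have hs {y : ℝ} (hy : w y 3 ≠ 0) (i : Fin 2) :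
      deriv (fun y => affine (w y)) y i = deriv (fun y => affine (w y) i) y :=
    (hasDerivAt_pi.1 ((contDiffAt_affine hw hy).differentiableAt (by simp)).hasDerivAt i).deriv.symm
  refine ⟨hs hx i, ?_⟩
  have h2 := hasDerivAt_pi.1
    ((contDiffAt_deriv (contDiffAt_affine hw hx)).differentiableAt (by simp)).hasDerivAt i
  rw [← h2.deriv]
  refine Filter.EventuallyEq.deriv_eq ?_
  have h3 : Continuous fun y => w y 3 := (contDiff_pi.1 hw 3).continuous
  filter_upwards [h3.continuousAt.eventually_ne hx] with y hy using hs hy i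

/-- The normalization of the second jet in affine coordinates of a null curve parametrized by
arc-length. -/
theorem affine_jet_iff {w : ℝ → Vec4} (hw : ContDiff ℝ ∞ w) (hn : ∀ x, mink (w x) (w x) = 0)
    (ha : IsArcLength w) (x : ℝ) :
    (w x 3 ≠ 0 ∧ affine (w x) = 0 ∧ deriv (fun y => affine (w y)) x = ![1, 0] ∧
      deriv (deriv fun y => affine (w y)) x = 0) ↔
    ∃ c : ℝ, c ^ 2 = 1 ∧ w x = c • e4 ∧ deriv w x = c • ![0, 1, 0, 0] ∧
      deriv (deriv w) x 2 = 0 := by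
  have hw1 := contDiff_deriv hw
  have hi := contDiff_pi.1 hw
  have d1 (y : ℝ) (i : Fin 4) : deriv (fun y => w y i) y = deriv w y i :=
    (hasDerivAt_pi.1 (hasDerivAt_of_smooth hw y) i).deriv
  have d2 (y : ℝ) (i : Fin 4) : deriv (deriv fun y => w y i) y = deriv (deriv w) y i := by
    rw [show (deriv fun y => w y i) = fun y => deriv w y i from funext fun y => d1 y i]
    exact (hasDerivAt_pi.1 (hasDerivAt_of_smooth hw1 y) i).deriv
  have m00 := hn x
  have m01 := mink_deriv_eq_zero hw hn x
  have m02 := mink_deriv_deriv hw hn x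
  have m11 := ha x
  have m12 : mink (deriv w x) (deriv (deriv w) x) = 0 := by
    have hd := hasDerivAt_of_smooth hw1 x
    have h := hasDerivAt_mink hd hd
    rw [show (fun y => mink (deriv w y) (deriv w y)) = fun _ => 1 from funext ha] at h
    have := h.unique (hasDerivAt_const x 1)
    rw [mink_comm] at this; linarith
  rw [m11] at m02
  rw [mink_eq] at m00 m01 m02 m11 m12
  have jets (hx : w x 3 ≠ 0) (h1 : w x 1 = 0) (h2 : w x 2 = 0) :
      deriv w x 1 = deriv (fun y => affine (w y)) x 0 * w x 3 ∧
      deriv w x 2 = deriv (fun y => affine (w y)) x 1 * w x 3 ∧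
      deriv (deriv w) x 1 = deriv (deriv fun y => affine (w y)) x 0 * w x 3 +
        2 * deriv (fun y => affine (w y)) x 0 * deriv w x 3 ∧
      deriv (deriv w) x 2 = deriv (deriv fun y => affine (w y)) x 1 * w x 3 +
        2 * deriv (fun y => affine (w y)) x 1 * deriv w x 3 := by
    obtain ⟨j1, j2⟩ := jet_div (hi 1) (hi 3) hx
    obtain ⟨j3, j4⟩ := jet_div (hi 2) (hi 3) hx
    obtain ⟨a1, a2⟩ := deriv_affine_apply hw hx 0
    obtain ⟨a3, a4⟩ := deriv_affine_apply hw hx 1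
    simp only [d1, d2, h1, h2, zero_div, zero_mul, add_zero] at j1 j2 j3 j4
    rw [a1, a2, a3, a4]
    exact ⟨j1, j3, j2, j4⟩
  constructor
  · rintro ⟨hx, h0, h1, h2⟩
    have h01 : w x 1 = 0 := by simpa [affine, hx] using congr_fun h0 0
    have h02 : w x 2 = 0 := by simpa [affine, hx] using congr_fun h0 1
    obtain ⟨j1, j2, j3, j4⟩ := jets hx h01 h02
    simp [h1, h2] at j1 j2 j3 j4
    simp only [h01, h02, j1, j2, j3, j4] at m00 m01 m02 m11 m12
    -- The affine normalization leaves `w₀`, `w₀'` and `w₃'` open; these vanish by `⟨w, w⟩ = 0`,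
    -- `⟨w, w'⟩ = 0` and `⟨w', w''⟩ = 0` in turn.
    have w0 : w x 0 = 0 := by
      have : w x 0 * w x 3 = 0 := by linarith
      simpa [hx] using this
    rw [w0] at m01 m02
    have w0' : deriv w x 0 = 0 := by
      have : w x 3 * deriv w x 0 = 0 := by linarith
      simpa [hx] using this
    rw [w0'] at m11 m12
    -- Here `w₁' = w₃` and `w₁'' = 2 w₃'`. Multiplying `⟨w', w''⟩ = 0` by `w₃` and using `w₃ w₀'' =
    -- 1` and `w₃² = 1` leaves `w₃' = 0`.
    have w3' : deriv w x 3 = 0 := by 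
      linear_combination w x 3 * m12 - deriv w x 3 * m02 - 2 * deriv w x 3 * m11
    refine ⟨w x 3, by linarith, ?_, ?_, j4⟩
    · ext i; fin_cases i <;> simp [e4, *]
    · ext i; fin_cases i <;> simp [*]
  · rintro ⟨c, hc, h0, h1, h2⟩
    have hc0 : c ≠ 0 := by rintro rfl; norm_num at hc
    have w1 : w x 1 = 0 := by rw [h0]; simp [e4]
    have w2 : w x 2 = 0 := by rw [h0]; simp [e4]
    have w3 : w x 3 = c := by rw [h0]; simp [e4]
    have v0 : deriv w x 0 = 0 := by rw [h1]; simp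
    have v1 : deriv w x 1 = c := by rw [h1]; simp
    have v2 : deriv w x 2 = 0 := by rw [h1]; simp
    have v3 : deriv w x 3 = 0 := by rw [h1]; simp
    have hx : w x 3 ≠ 0 := by rw [w3]; exact hc0
    obtain ⟨j1, j2, j3, j4⟩ := jets hx w1 w2
    have z1 : deriv (deriv w) x 1 = 0 := by
      simp only [v0, v1, v2, v3] at m12
      have : c * deriv (deriv w) x 1 = 0 := by linarith
      simpa [hc0] using this
    simp only [w3, v1, v2, v3, h2, z1, mul_zero, add_zero] at j1 j2 j3 j4
    have a0 : deriv (fun y => affine (w y)) x 0 = 1 :=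
      mul_right_cancel₀ hc0 (by rw [← j1, one_mul])
    have a1 : deriv (fun y => affine (w y)) x 1 = 0 := by simpa [hc0] using j2.symm
    have b0 : deriv (deriv fun y => affine (w y)) x 0 = 0 := by simpa [hc0] using j3.symm
    have b1 : deriv (deriv fun y => affine (w y)) x 1 = 0 := by simpa [hc0] using j4.symm
    refine ⟨hx, ?_, ?_, ?_⟩
    · ext i; fin_cases i <;> simp [affine, w1, w2]
    · ext i; fin_cases i <;> simp [a0, a1]
    · ext i; fin_cases i <;> simp [b0, b1]

theorem hasDerivAt_const_mulVec {v : ℝ → Vec4} (g : Mat4) (hv : ContDiff ℝ ∞ v) (x : ℝ) :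
    deriv (fun y => g *ᵥ v y) x = g *ᵥ deriv v x := by
  have h := hasDerivAt_mulVec (hasDerivAt_const x g) (hasDerivAt_of_smooth hv x)
  simpa using h.deriv

theorem isSphereFrame_iff_jet {u : ℝ → Vec4} (hu : ContDiff ℝ ∞ u) (h0 : ∀ x, u x ≠ 0)
    (hn : ∀ x, mink (u x) (u x) = 0) (ha : IsArcLength u) (ρ : ℝ → Mat4) :
    IsSphereFrame (projectivize u h0) ρ ↔ ContDiff ℝ ∞ ρ ∧ (∀ x, ρ x ∈ SO31) ∧
      ∀ x, ∃ c : ℝ, c ^ 2 = 1 ∧ ρ x *ᵥ u x = c • e4 ∧ ρ x *ᵥ deriv u x = c • ![0, 1, 0, 0] ∧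
        (ρ x *ᵥ deriv (deriv u) x) 2 = 0 := by
  have key (hm : ∀ x, ρ x ∈ SO31) (x : ℝ) := affine_jet_iff
    (w := fun y => ρ x *ᵥ u y) (contDiff_mulVec contDiff_const hu)
    (fun y => by rw [mink_mulVec (hm x), hn]) (fun y => by
      rw [hasDerivAt_const_mulVec _ hu, mink_mulVec (hm x), ha]) x
  have hd (x : ℝ) : deriv (fun y => ρ x *ᵥ u y) = fun y => ρ x *ᵥ deriv u y :=
    funext fun y => hasDerivAt_const_mulVec _ hu y
  simp only [hd, hasDerivAt_const_mulVec _ (contDiff_deriv hu)] at key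
  constructor
  · rintro ⟨hs, hm, hc, hz, hf, hsd⟩
    refine ⟨hs, hm, fun x => (key hm x).1 ⟨?_, ?_, ?_, ?_⟩⟩
    · exact (mulVec_rep_apply_ne_zero (ρ x) (u x) (h0 x) 3).1 (hc x)
    · exact (affine_mulVec_rep (ρ x) (u x) (h0 x)).symm.trans (hz x)
    · simpa only [projectivize, affine_mulVec_rep] using hf x
    · simpa only [projectivize, affine_mulVec_rep] using hsd x
  · rintro ⟨hs, hm, h⟩
    have h' := fun x => (key hm x).2 (h x)
    refine ⟨hs, hm, fun x => ?_, fun x => ?_, fun x => ?_, fun x => ?_⟩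
    · exact (mulVec_rep_apply_ne_zero (ρ x) (u x) (h0 x) 3).2 (h' x).1
    · exact (affine_mulVec_rep (ρ x) (u x) (h0 x)).trans (h' x).2.1
    · simpa only [projectivize, affine_mulVec_rep] using (h' x).2.2.1
    · simpa only [projectivize, affine_mulVec_rep] using (h' x).2.2.2

theorem isConeFrame_iff_of_arcLength {u : ℝ → Vec4} (ha : IsArcLength u) (ρ : ℝ → Mat4) :
    IsConeFrame u ρ ↔ ContDiff ℝ ∞ ρ ∧ (∀ x, ρ x ∈ SO31) ∧ ∀ x, ρ x *ᵥ u x = e4 ∧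
      ρ x *ᵥ deriv u x = ![0, 1, 0, 0] ∧ (ρ x *ᵥ deriv (deriv u) x) 2 = 0 := by
  constructor
  · rintro ⟨h1, h2, h3, h4, h5⟩
    exact ⟨h1, h2, fun x => ⟨h3 x, by rw [h4, ha, Real.sqrt_one], h5 x⟩⟩
  · rintro ⟨h1, h2, h3⟩
    exact ⟨h1, h2, fun x => (h3 x).1, fun x => by rw [ha, Real.sqrt_one, (h3 x).2.1],
      fun x => (h3 x).2.2⟩

/-- The sphere normalization fixes the 2-jet of the lift up to a factor `c` with `c² = 1`. This
factor is a coordinate of `ρ u`, hence continuous, hence constant. -/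
theorem isSphereFrame_iff {u : ℝ → Vec4} (hu : ContDiff ℝ ∞ u) (h0 : ∀ x, u x ≠ 0)
    (hn : ∀ x, mink (u x) (u x) = 0) (ha : IsArcLength u) (ρ : ℝ → Mat4) :
    IsSphereFrame (projectivize u h0) ρ ↔ IsConeFrame u ρ ∨ IsConeFrame u (fun x => -ρ x) := by
  rw [isSphereFrame_iff_jet hu h0 hn ha, isConeFrame_iff_of_arcLength ha,
    isConeFrame_iff_of_arcLength ha]
  constructor
  · rintro ⟨hs, hm, h⟩
    choose c hc h1 h2 h3 using h
    have hcs : Continuous c := by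
      have : c = fun x => (ρ x *ᵥ u x) 3 := funext fun x => by rw [h1]; simp [e4]
      rw [this]
      exact (contDiff_pi.1 (contDiff_mulVec hs hu) 3).continuous
    rcases eq_one_or_eq_neg_one_of_sq hcs hc with h | h
    · left
      exact ⟨hs, hm, fun x => ⟨by rw [h1, h, one_smul], by rw [h2, h, one_smul], h3 x⟩⟩
    · right
      refine ⟨hs.neg, fun x => neg_mem_SO31 (hm x), fun x => ⟨?_, ?_, ?_⟩⟩
      · rw [Matrix.neg_mulVec, h1, h]; simp
      · rw [Matrix.neg_mulVec, h2, h, neg_one_smul, neg_neg]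
      · rw [Matrix.neg_mulVec, Pi.neg_apply, h3, neg_zero]
  · rintro (⟨hs, hm, h⟩ | ⟨hs, hm, h⟩)
    · exact ⟨hs, hm, fun x => ⟨1, by norm_num, by rw [(h x).1, one_smul],
        by rw [(h x).2.1, one_smul], (h x).2.2⟩⟩
    · refine ⟨by simpa using hs.neg, fun x => by simpa using neg_mem_SO31 (hm x),
        fun x => ⟨-1, by norm_num, ?_, ?_, ?_⟩⟩
      · rw [← (h x).1, Matrix.neg_mulVec]; simp
      · rw [← (h x).2.1, Matrix.neg_mulVec]; simp
      · simpa [Matrix.neg_mulVec] using (h x).2.2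

theorem deriv_neg_mul_inv {ρ : ℝ → Mat4} (hs : ContDiff ℝ ∞ ρ) (hm : ∀ x, ρ x ∈ SO31) (x : ℝ) :
    deriv (fun y => -ρ y) x * (-ρ x)⁻¹ = deriv ρ x * (ρ x)⁻¹ := by
  have hd : deriv (fun y => -ρ y) x = -deriv ρ x := deriv_mat_eq (hasDerivAt_mat hs x).neg
  rw [hd, inv_eq_of_mem_SO31 (hm x),
    inv_eq_of_mem_SO31 (neg_mem_SO31 (hm x))]
  simp

theorem hasSphereInvariants_iff {u : ℝ → Vec4} (hu : ContDiff ℝ ∞ u) (h0 : ∀ x, u x ≠ 0)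
    (hn : ∀ x, mink (u x) (u x) = 0) (ha : IsArcLength u) (κ : ℝ → Fin 2 → ℝ) :
    HasSphereInvariants (projectivize u h0) κ ↔
      HasConeInvariants u (fun x => ![1, κ x 0, κ x 1]) := by
  constructor
  · rintro ⟨ρ, hρ, h⟩
    rcases (isSphereFrame_iff hu h0 hn ha ρ).1 hρ with h' | h'
    · exact ⟨ρ, h', h⟩
    · exact ⟨_, h', fun x => (deriv_neg_mul_inv hρ.smooth hρ.mem x).trans (h x)⟩
  · rintro ⟨ρ, hρ, h⟩
    exact ⟨ρ, (isSphereFrame_iff hu h0 hn ha ρ).2 (Or.inl hρ), h⟩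

theorem IsConeCurve.isSphereCurve {T : ℝ} {u : ℝ → Vec4} (hu : IsConeCurve T u) :
    IsSphereCurve T (projectivize u hu.ne_zero) := by
  refine ⟨⟨u, hu.smooth, fun x => ⟨hu.ne_zero x, rfl⟩, hu.null, hu.nonradial⟩, ?_⟩
  obtain ⟨g, hg, hm⟩ := hu.monodromy
  refine ⟨g, hg, fun x => ?_⟩
  obtain ⟨a, ha, h⟩ := exists_rep_eq_smul (u x) (hu.ne_zero x)
  obtain ⟨b, hb, h'⟩ := exists_rep_eq_smul (u (x + T)) (hu.ne_zero _)
  refine ⟨b * a⁻¹, ?_⟩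
  rw [projectivize, projectivize, h, h', hm, Matrix.mulVec_smul, smul_smul, mul_assoc,
    inv_mul_cancel₀ ha, mul_one]

theorem IsSphereCurve.exists_arcLength_lift {T : ℝ} {m : ℝ → P3} (hm : IsSphereCurve T m) :
    ∃ (u : ℝ → Vec4) (hu : IsConeCurve T u), IsArcLength u ∧ m = projectivize u hu.ne_zero := by
  obtain ⟨⟨v, hvs, hv0, hvn, hvr⟩, g, hg, hmon⟩ := hm
  choose hv0 hmv using hv0
  -- Because `⟨v, v⟩ = ⟨v, v'⟩ = 0`, the term with `φ'` does not contribute to `⟨(φ v)', (φ v)'⟩ =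
  -- φ² ⟨v', v'⟩`.
  set φ : ℝ → ℝ := fun x => (Real.sqrt (mink (deriv v x) (deriv v x)))⁻¹ with hφ
  have hsq (x : ℝ) : 0 < Real.sqrt (mink (deriv v x) (deriv v x)) := Real.sqrt_pos.2 (hvr x)
  have hφs : ContDiff ℝ ∞ φ :=
    ((contDiff_mink (contDiff_deriv hvs) (contDiff_deriv hvs)).sqrt fun x => (hvr x).ne').inv
      fun x => (hsq x).ne'
  have hφ0 (x : ℝ) : φ x ≠ 0 := inv_ne_zero (hsq x).ne'
  set u : ℝ → Vec4 := fun x => φ x • v x with hu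
  have hus : ContDiff ℝ ∞ u := hφs.smul hvs
  have hu0 (x : ℝ) : u x ≠ 0 := smul_ne_zero (hφ0 x) (hv0 x)
  have hun (x : ℝ) : mink (u x) (u x) = 0 := by
    rw [hu, mink_smul_left, mink_smul_right, hvn]; ring
  have ha : IsArcLength u := fun x => by
    have h := ((hasDerivAt_of_smooth hφs x).smul (hasDerivAt_of_smooth hvs x)).deriv
    have h' : deriv u x = φ x • deriv v x + deriv φ x • v x := h
    rw [h']
    simp only [mink_add_left, mink_add_right, mink_smul_left, mink_smul_right, hvn,
      mink_deriv_eq_zero hvs hvn, mink_comm (deriv v x) (v x)]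
    have := Real.sq_sqrt (hvr x).le
    have h2 : φ x * Real.sqrt (mink (deriv v x) (deriv v x)) = 1 := inv_mul_cancel₀ (hsq x).ne'
    rw [← this]
    linear_combination (φ x * Real.sqrt (mink (deriv v x) (deriv v x)) + 1) * h2
  have hmu : m = projectivize u hu0 := by
    funext x
    rw [hmv x, projectivize, Projectivization.mk_eq_mk_iff']
    exact ⟨(φ x)⁻¹, by rw [hu, smul_smul, inv_mul_cancel₀ (hφ0 x), one_smul]⟩
  have hmon' (x : ℝ) : ∃ c : ℝ, u (x + T) = c • (g *ᵥ u x) := by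
    obtain ⟨c, hc⟩ := hmon x
    obtain ⟨a, ha, h⟩ := exists_rep_eq_smul (u x) (hu0 x)
    obtain ⟨b, hb, h'⟩ := exists_rep_eq_smul (u (x + T)) (hu0 _)
    rw [hmu, projectivize, projectivize, h, h', Matrix.mulVec_smul] at hc
    exact ⟨b⁻¹ * (c * a), by
      rw [mul_smul, mul_smul, ← hc, inv_smul_smul₀ hb]⟩
  choose c hc using hmon'
  -- The factor was chosen pointwise; `⟨u, u''⟩ = -1` expresses it by a pairing that is visibly
  -- smooth.
  have hcs : ContDiff ℝ ∞ c := by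
    have : c = fun x => -mink (u (x + T)) (g *ᵥ deriv (deriv u) x) := funext fun x => by
      rw [hc, mink_smul_left, mink_mulVec hg, mink_deriv_deriv hus hun, ha]; ring
    rw [this]
    exact (contDiff_mink (hus.comp (contDiff_id.add contDiff_const))
      (contDiff_mulVec contDiff_const (contDiff_deriv (contDiff_deriv hus)))).neg
  -- Both sides of `u (x + T) = c g u` have unit speed, and again the term with `c'` does not
  -- contribute.
  have hc2 (x : ℝ) : c x ^ 2 = 1 := by
    have hg' := hasDerivAt_mulVec (hasDerivAt_const x g) (hasDerivAt_of_smooth hus x)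
    have h := ((hasDerivAt_of_smooth hcs x).smul hg').deriv
    have h' : deriv u (x + T) = c x • (g *ᵥ deriv u x) + deriv c x • (g *ᵥ u x) := by
      rw [← deriv_comp_add_const]
      simp only [Matrix.zero_mulVec, zero_add] at h
      rw [← h]; congr 1; exact funext hc
    have := ha (x + T)
    rw [h'] at this
    simp only [mink_add_left, mink_add_right, mink_smul_left, mink_smul_right, mink_mulVec hg, hun,
      mink_deriv_eq_zero hus hun, mink_comm (deriv u x) (u x), ha x] at this
    linear_combination this
  have hmono : ∃ g ∈ SO31, ∀ x, u (x + T) = g *ᵥ u x := by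
    rcases eq_one_or_eq_neg_one_of_sq hcs.continuous hc2 with h | h
    · exact ⟨g, hg, fun x => by rw [hc, h, one_smul]⟩
    · exact ⟨-g, neg_mem_SO31 hg, fun x => by rw [hc, h, Matrix.neg_mulVec, neg_one_smul]⟩
  exact ⟨u, ⟨hus, hu0, hun, fun x => by rw [ha]; norm_num, hmono⟩, ha, hmu⟩

theorem loop_cons_one_iff {T : ℝ} {κ : ℝ → Fin 2 → ℝ} :
    (fun x => ![1, κ x 0, κ x 1]) ∈ loops T (Fin 3 → ℝ) ↔ κ ∈ loops T (Fin 2 → ℝ) := by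
  constructor
  · rintro ⟨hs, hp⟩
    have h := contDiff_pi.1 hs
    refine ⟨contDiff_pi.2 fun i => ?_, fun x => ?_⟩
    · fin_cases i
      exacts [h 1, h 2]
    · have := hp x
      ext i; fin_cases i
      exacts [congr_fun this 1, congr_fun this 2]
  · rintro ⟨hs, hp⟩
    have h := contDiff_pi.1 hs
    refine ⟨contDiff_pi.2 fun i => ?_, fun x => by simp only [hp x]⟩
    fin_cases i
    exacts [contDiff_const, h 0, h 1]

theorem mem_sphereInvariants_iff {T : ℝ} {κ : ℝ → Fin 2 → ℝ} :
    κ ∈ sphereInvariants T ↔ κ ∈ loops T (Fin 2 → ℝ) := by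
  rw [← loop_cons_one_iff]
  constructor
  · rintro ⟨m, hm, hκ⟩
    obtain ⟨u, hu, ha, rfl⟩ := hm.exists_arcLength_lift
    exact (mem_coneInvariants_iff.1 ⟨u, hu,
      (hasSphereInvariants_iff hu.smooth hu.ne_zero hu.null ha κ).1 hκ⟩).1
  · intro h
    obtain ⟨u, hu, hk⟩ := mem_coneInvariants_of_loop h fun x => by simp
    have ha : IsArcLength u := fun x => by
      have := (hk.smooth hu.smooth hu.nonradial).2 x
      rw [← Real.sq_sqrt (hu.nonradial x).le, ← this]; simp
    exact ⟨_, hu.isSphereCurve, (hasSphereInvariants_iff hu.smooth hu.ne_zero hu.null ha κ).2 hk⟩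

theorem exists_coneInvariants {T : ℝ} {u : ℝ → Vec4} (hu : IsConeCurve T u) (ha : IsArcLength u) :
    ∃ k : coneInvariantsOne T, ∀ k', HasConeInvariants u k' ↔ k' = k.1 := by
  obtain ⟨ρ, hρ⟩ := exists_coneFrame hu.smooth hu.null ha
  obtain ⟨k, -, h0, hk⟩ := hρ.exists_invariants hu.smooth hu.nonradial
  have hk' : HasConeInvariants u k := ⟨ρ, hρ, hk⟩
  refine ⟨⟨k, ⟨u, hu, hk'⟩, fun x => by rw [h0, ha, Real.sqrt_one]⟩, fun k' => ⟨fun h => ?_, ?_⟩⟩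
  · exact h.unique hu.smooth hu.null hu.nonradial hk'
  · rintro rfl; exact hk'

/-! ### Uniqueness of normal forms under gauge transformations -/

/-- The action is free on normal forms. Applied to `e₄`, the gauge relation reads `k₀' e₂ = k₀ g
e₂`; taking norms and using positivity, `k₀' = k₀` and `g` fixes `e₂`. Applied to `e₂`, its third
coordinate then gives `k₀ g₂₀ = 0`. -/
theorem eq_one_of_gauge_mcCone {T : ℝ} {g : ℝ → Mat4} (hg : g ∈ groupLoops T HL)
    {k k' : ℝ → Fin 3 → ℝ} (hk : ∀ x, 0 < k x 0) (hk' : ∀ x, 0 < k' x 0)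
    (h : gauge g (fun x => mcCone (k x)) = fun x => mcCone (k' x)) : g = fun _ => 1 := by
  have hs (x : ℝ) : g x ∈ SO31 := (hg.2 x).1
  have hd := hasDerivAt_mat hg.1.1
  have hrel (x : ℝ) (v : Vec4) : mcCone (k' x) *ᵥ (g x *ᵥ v) =
      g x *ᵥ (mcCone (k x) *ᵥ v) - deriv g x *ᵥ v := by
    have h1 := gauge_mul_self hs (fun x => mcCone (k x)) x
    rw [h] at h1
    rw [Matrix.mulVec_mulVec, h1, Matrix.sub_mulVec, Matrix.mulVec_mulVec]
  have hfix {v : Vec4} (hv : ∀ x, g x *ᵥ v = v) (x : ℝ) : deriv g x *ᵥ v = 0 := by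
    have h1 := hasDerivAt_mulVec (hd x) (hasDerivAt_const x v)
    simp only [hv] at h1
    simpa using h1.unique (hasDerivAt_const x v)
  have h4 (x : ℝ) : g x *ᵥ e4 = e4 := (hg.2 x).2
  have h2 (x : ℝ) : g x *ᵥ ![0, 1, 0, 0] = ![0, 1, 0, 0] := by
    have h1 := hrel x e4
    rw [hfix h4, sub_zero, h4, mcCone_mulVec_e4, mcCone_mulVec_e4, Matrix.mulVec_smul] at h1
    have hm := congr_arg (fun v => mink v v) h1
    simp only [mink_smul_left, mink_smul_right, mink_mulVec (hs x)] at hm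
    simp [mink_eq] at hm
    have hkk : k' x 0 = k x 0 := by
      rcases mul_self_eq_mul_self_iff.1 hm with h | h
      · exact h
      · linarith [hk x, hk' x]
    rw [hkk] at h1
    exact (smul_right_injective _ (hk x).ne' h1).symm
  funext x
  refine eq_one_of_fixes (hs x) (h4 x) (h2 x) ?_
  have h1 := congr_fun (hrel x ![0, 1, 0, 0]) 2
  rw [hfix h2, sub_zero, h2, mcCone_mulVec_e2, mcCone_mulVec_e2] at h1
  have h23 : g x 2 3 = 0 := by
    have := congr_fun (h4 x) 2
    rw [mulVec_e4] at this
    simpa [e4] using this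
  simpa [Matrix.mulVec, dotProduct, Fin.sum_univ_four, h23, (hk x).ne'] using h1

theorem eq_of_gauge_mcCone {T : ℝ} {g : ℝ → Mat4} (hg : g ∈ groupLoops T HL)
    {k k' : ℝ → Fin 3 → ℝ} (hk : ∀ x, 0 < k x 0) (hk' : ∀ x, 0 < k' x 0)
    (h : gauge g (fun x => mcCone (k x)) = fun x => mcCone (k' x)) : k = k' := by
  rw [eq_one_of_gauge_mcCone hg hk hk' h, gauge_one] at h
  exact funext fun x => mcCone_injective (congr_fun h x)

theorem gauge_neg {g : ℝ → Mat4} (hgs : ContDiff ℝ ∞ g) (hg : ∀ x, g x ∈ SO31) (L : ℝ → Mat4) :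
    gauge (fun x => -g x) L = gauge g L := by
  funext x
  rw [gauge, gauge, deriv_neg_mul_inv hgs hg, inv_eq_of_mem_SO31 (hg x),
    inv_eq_of_mem_SO31 (neg_mem_SO31 (hg x))]
  simp

/-- If `g e₄ = c e₄`, the gauge relation at `e₄` is `c e₂ = g e₂ - c' e₄`, and norms give `c² = 1`.
So `g` or `-g` lies in `HL`, both act in the same way, and the cone case applies. -/
theorem eq_of_gauge_mcSphere {T : ℝ} {g : ℝ → Mat4} (hg : g ∈ groupLoops T HM)
    {k k' : ℝ → Fin 2 → ℝ}
    (h : gauge g (fun x => mcSphere (k x)) = fun x => mcSphere (k' x)) : k = k' := by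
  have hs (x : ℝ) : g x ∈ SO31 := (hg.2 x).1
  have hd := hasDerivAt_mat hg.1.1
  choose c hc using fun x => (hg.2 x).2
  have hc33 : c = fun x => g x 3 3 := funext fun x => by
    have := congr_fun (hc x) 3
    rw [mulVec_e4] at this
    simpa [e4] using this.symm
  have hcs : ContDiff ℝ ∞ c := by rw [hc33]; exact contDiff_entry hg.1.1 3 3
  have hc2 (x : ℝ) : c x ^ 2 = 1 := by
    have h1 := gauge_mul_self hs (fun x => mcSphere (k x)) x
    rw [h] at h1
    have h2 : mcSphere (k' x) *ᵥ (g x *ᵥ e4) =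
        g x *ᵥ (mcSphere (k x) *ᵥ e4) - deriv g x *ᵥ e4 := by
      rw [Matrix.mulVec_mulVec, h1, Matrix.sub_mulVec, Matrix.mulVec_mulVec]
    have h3 : deriv g x *ᵥ e4 = deriv c x • e4 := by
      have h4 := hasDerivAt_mulVec (hd x) (hasDerivAt_const x e4)
      simp only [hc, Matrix.mulVec_zero, add_zero] at h4
      exact h4.unique ((hasDerivAt_of_smooth hcs x).smul_const e4)
    rw [h3, hc, Matrix.mulVec_smul, mcSphere, mcSphere, mcCone_mulVec_e4, mcCone_mulVec_e4] at h2
    simp only [Matrix.cons_val_zero, one_smul] at h2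
    have h5 := congr_arg (fun v => mink v v) (eq_add_of_sub_eq h2.symm)
    simp only [mink_mulVec (hs x)] at h5
    simp [mink_eq, e4] at h5
    linear_combination -h5
  have key {g : ℝ → Mat4} (hg : g ∈ groupLoops T HL)
      (h : gauge g (fun x => mcSphere (k x)) = fun x => mcSphere (k' x)) : k = k' := by
    have := eq_of_gauge_mcCone hg (k := fun x => ![1, k x 0, k x 1])
      (k' := fun x => ![1, k' x 0, k' x 1]) (fun x => by simp) (fun x => by simp) h
    funext x i
    have hx := congr_fun this x
    fin_cases i
    exacts [congr_fun hx 1, congr_fun hx 2]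
  rcases eq_one_or_eq_neg_one_of_sq hcs.continuous hc2 with h1 | h1
  · exact key ⟨hg.1, fun x => ⟨hs x, by rw [hc, h1, one_smul]⟩⟩ h
  · refine key (g := fun x => -g x) ⟨⟨hg.1.1.neg, fun x => by simp only [hg.1.2 x]⟩,
      fun x => ⟨neg_mem_SO31 (hs x), by rw [Matrix.neg_mulVec, hc, h1]; simp⟩⟩ ?_
    rw [gauge_neg hg.1.1 hs, h]

/-! ### Normal forms of smooth families -/

/-- A smooth family of elements of the loop algebra. -/
structure IsAlgFamily (T : ℝ) (L : ℝ → ℝ → Mat4) : Prop where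
  smooth : SmoothFamily L
  periodic : ∀ ε, Function.Periodic (L ε) T
  mem : ∀ ε x, L ε x ∈ so31

/-- A smooth family of elements of the loop group of `H`. -/
structure IsGaugeFamily (T : ℝ) (H : Set Mat4) (g : ℝ → ℝ → Mat4) : Prop where
  smooth : SmoothFamily g
  periodic : ∀ ε, Function.Periodic (g ε) T
  mem : ∀ ε x, g ε x ∈ H

variable {T : ℝ} {H : Set Mat4}

theorem IsAlgFamily.mem_algLoops {L : ℝ → ℝ → Mat4} (hL : IsAlgFamily T L) (ε : ℝ) :
    L ε ∈ algLoops T := ⟨⟨hL.smooth.right ε, hL.periodic ε⟩, hL.mem ε⟩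

theorem IsGaugeFamily.mem_groupLoops {g : ℝ → ℝ → Mat4} (hg : IsGaugeFamily T H g) (ε : ℝ) :
    g ε ∈ groupLoops T H := ⟨⟨hg.smooth.right ε, hg.periodic ε⟩, hg.mem ε⟩

theorem IsGaugeFamily.mul (hH : IsLorentzSubgroup H) {g h : ℝ → ℝ → Mat4}
    (hg : IsGaugeFamily T H g) (hh : IsGaugeFamily T H h) :
    IsGaugeFamily T H (fun ε x => g ε x * h ε x) where
  smooth := contDiff_matMul hg.smooth hh.smooth
  periodic := fun ε x => by simp only [hg.periodic ε x, hh.periodic ε x]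
  mem := fun ε x => hH.mul_mem (hg.mem ε x) (hh.mem ε x)

theorem IsGaugeFamily.mono {H' : Set Mat4} (hH : H ⊆ H') {g : ℝ → ℝ → Mat4}
    (hg : IsGaugeFamily T H g) : IsGaugeFamily T H' g :=
  ⟨hg.smooth, hg.periodic, fun ε x => hH (hg.mem ε x)⟩

theorem IsAlgFamily.gauge (hH : IsLorentzSubgroup H) {g L : ℝ → ℝ → Mat4}
    (hg : IsGaugeFamily T H g) (hL : IsAlgFamily T L) :
    IsAlgFamily T (fun ε => gauge (g ε) (L ε)) := by
  have hm (ε : ℝ) := gauge_mem_algLoops (groupLoops_mono hH.subset (hg.mem_groupLoops ε))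
    (hL.mem_algLoops ε)
  refine ⟨?_, fun ε => (hm ε).1.2, fun ε => (hm ε).2⟩
  have hi : SmoothFamily (fun ε x => (g ε x)⁻¹) :=
    contDiff_inv_of_mem_SO31 (g := fun p : ℝ × ℝ => g p.1 p.2) hg.smooth
      fun p => hH.subset (hg.mem p.1 p.2)
  have hd : SmoothFamily (fun ε => deriv (g ε)) := hg.smooth.deriv_right
  exact (contDiff_matMul (contDiff_matMul hg.smooth hL.smooth) hi).sub (contDiff_matMul hd hi)

theorem gauge_gauge_family (hH : IsLorentzSubgroup H) {g h : ℝ → ℝ → Mat4}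
    (hg : IsGaugeFamily T H g) (hh : IsGaugeFamily T H h) (ε : ℝ) (L : ℝ → Mat4) :
    gauge (g ε) (gauge (h ε) L) = gauge (fun x => g ε x * h ε x) L :=
  gauge_gauge (hg.smooth.right ε) (hh.smooth.right ε) (fun x => hH.subset (hg.mem ε x))
    (fun x => hH.subset (hh.mem ε x)) L

/-! ### Explicit gauge transformations and reduction to normal form. -/

/-- Rotations in the isotropy subgroup. -/
def rot (c s : ℝ) : Mat4 := !![1, 0, 0, 0; 0, c, s, 0; 0, -s, c, 0; 0, 0, 0, 1]

/-- Translations in the isotropy subgroup. -/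
noncomputable def trans (a b : ℝ) : Mat4 :=
  !![1, 0, 0, 0; a, 1, 0, 0; b, 0, 1, 0; (a ^ 2 + b ^ 2) / 2, a, b, 1]

/-- Dilations in the isotropy subgroup. -/
noncomputable def scal (c : ℝ) : Mat4 := !![c, 0, 0, 0; 0, 1, 0, 0; 0, 0, 1, 0; 0, 0, 0, c⁻¹]

theorem rot_mem_HL {c s : ℝ} (h : c ^ 2 + s ^ 2 = 1) : rot c s ∈ HL := by
  refine ⟨⟨?_, ?_⟩, by rw [mulVec_e4]; simp [rot, e4]⟩
  · ext i j
    fin_cases i <;> fin_cases j <;>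
      simp [rot, J, Matrix.mul_apply, Fin.sum_univ_four] <;> linarith
  · simp [Matrix.det_succ_row_zero, Fin.sum_univ_succ, Fin.succAbove, rot]; linarith

theorem trans_mem_HL (a b : ℝ) : trans a b ∈ HL := by
  refine ⟨⟨?_, ?_⟩, by rw [mulVec_e4]; simp [trans, e4]⟩
  · ext i j
    fin_cases i <;> fin_cases j <;>
      simp [trans, J, Matrix.mul_apply, Fin.sum_univ_four]
    ring
  · simp [Matrix.det_succ_row_zero, Fin.sum_univ_succ, Fin.succAbove, trans]

theorem scal_mem_HM {c : ℝ} (hc : c ≠ 0) : scal c ∈ HM := by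
  refine ⟨⟨?_, ?_⟩, c⁻¹, by rw [mulVec_e4]; ext i; fin_cases i <;> simp [scal, e4]⟩
  · ext i j
    fin_cases i <;> fin_cases j <;>
      simp [scal, J, Matrix.mul_apply, Fin.sum_univ_four, hc]
  · simp [Matrix.det_succ_row_zero, Fin.sum_univ_succ, Fin.succAbove, scal, hc]

theorem scal_one : scal 1 = 1 := by
  ext i j; fin_cases i <;> fin_cases j <;> simp [scal]

section Families

variable {E : Type*} [NormedAddCommGroup E] [NormedSpace ℝ E]

theorem contDiff_rot {c s : E → ℝ} (hc : ContDiff ℝ ∞ c) (hs : ContDiff ℝ ∞ s) :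
    ContDiff ℝ ∞ fun x => rot (c x) (s x) := by
  refine contDiff_mat_iff.2 fun i j => ?_
  fin_cases i <;> fin_cases j <;> simp [rot] <;> fun_prop

theorem contDiff_trans {a b : E → ℝ} (ha : ContDiff ℝ ∞ a) (hb : ContDiff ℝ ∞ b) :
    ContDiff ℝ ∞ fun x => trans (a x) (b x) := by
  refine contDiff_mat_iff.2 fun i j => ?_
  fin_cases i <;> fin_cases j <;> simp [trans] <;> fun_prop

theorem contDiff_scal {c : E → ℝ} (hc : ContDiff ℝ ∞ c) (h0 : ∀ x, c x ≠ 0) :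
    ContDiff ℝ ∞ fun x => scal (c x) := by
  have hi := hc.inv h0
  refine contDiff_mat_iff.2 fun i j => ?_
  fin_cases i <;> fin_cases j <;> simp [scal] <;> first | exact contDiff_const | exact hc | exact hi

end Families

/-- The first row of a rotation is constant, so the inhomogeneous term does not affect the first
row: the pair `(L₀₁, L₀₂)` is simply rotated. -/
theorem gauge_rot_entries {c s : ℝ → ℝ} (hc : ContDiff ℝ ∞ c) (hs : ContDiff ℝ ∞ s)
    (h1 : ∀ x, c x ^ 2 + s x ^ 2 = 1) {L : ℝ → Mat4} (hL : ∀ x, L x ∈ so31) (x : ℝ) :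
    gauge (fun x => rot (c x) (s x)) L x 0 1 = L x 0 1 * c x + L x 0 2 * s x ∧
    gauge (fun x => rot (c x) (s x)) L x 0 2 = L x 0 2 * c x - L x 0 1 * s x := by
  have hr := contDiff_rot hc hs
  have hm (x : ℝ) := (rot_mem_HL (h1 x)).1
  have h := gauge_mul_self hm L x
  have hd (j : Fin 4) : deriv (fun x => rot (c x) (s x)) x 0 j = 0 := by
    rw [deriv_mat_entry hr]
    fin_cases j <;> simp [rot]
  have hA := eq_alg_of_mem_so31 (gauge_mem_so31 hr hm hL x)
  set A := gauge (fun x => rot (c x) (s x)) L x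
  have e1 := congr_fun (congr_fun h 0) 1
  have e2 := congr_fun (congr_fun h 0) 2
  rw [Matrix.sub_apply, hd, sub_zero] at e1 e2
  simp [Matrix.mul_apply, Fin.sum_univ_four, rot] at e1 e2
  have := h1 x
  constructor
  · linear_combination c x * e1 + s x * e2 - A 0 1 * this
  · linear_combination c x * e2 - s x * e1 - A 0 2 * this

/-- Translations leave the pair `(q₁, q₂) = (L₀₁, 0)` alone and shift the entries `p` and `s` by
multiples of `L₀₁`. If `L₀₁ ≠ 0`, suitable `a` and `b` therefore remove `p` and `s`. -/
theorem gauge_trans_entries {a b : ℝ → ℝ} (ha : ContDiff ℝ ∞ a) (hb : ContDiff ℝ ∞ b)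
    {L : ℝ → Mat4} (hL : ∀ x, L x ∈ so31) (x : ℝ) (h02 : L x 0 2 = 0) :
    gauge (fun x => trans (a x) (b x)) L x =
      alg (L x 0 0 - L x 0 1 * a x) (L x 0 1) 0 (gauge (fun x => trans (a x) (b x)) L x 1 0)
        (gauge (fun x => trans (a x) (b x)) L x 2 0) (L x 1 2 - L x 0 1 * b x) := by
  have hr := contDiff_trans ha hb
  have hm (x : ℝ) := (trans_mem_HL (a x) (b x)).1
  have h := gauge_mul_self hm L x
  have hd (j : Fin 4) : deriv (fun x => trans (a x) (b x)) x 0 j = 0 := by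
    rw [deriv_mat_entry hr]
    fin_cases j <;> simp [trans]
  have hd' : deriv (fun x => trans (a x) (b x)) x 1 2 = 0 := by
    rw [deriv_mat_entry hr]; simp [trans]
  have hA := eq_alg_of_mem_so31 (gauge_mem_so31 hr hm hL x)
  set A := gauge (fun x => trans (a x) (b x)) L x
  have e0 := congr_fun (congr_fun h 0) 0
  have e1 := congr_fun (congr_fun h 0) 1
  have e2 := congr_fun (congr_fun h 0) 2
  have e3 := congr_fun (congr_fun h 1) 2
  rw [Matrix.sub_apply, hd, sub_zero] at e0 e1 e2
  rw [Matrix.sub_apply, hd', sub_zero] at e3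
  have a03 : A 0 3 = 0 := by rw [hA]; simp [alg]
  have a11 : A 1 1 = 0 := by rw [hA]; simp [alg]
  have a13 : A 1 3 = A 0 1 := by rw [hA]; simp [alg]
  simp [Matrix.mul_apply, Fin.sum_univ_four, trans, a03, a11, a13, h02] at e0 e1 e2 e3
  rw [e2] at hA
  rw [e1] at e0 e3 hA
  rw [e2] at e0
  rw [show A 0 0 = L x 0 0 - L x 0 1 * a x by linarith,
    show A 1 2 = L x 1 2 - L x 0 1 * b x by linarith] at hA
  exact hA

theorem gauge_scal_entries {c : ℝ → ℝ} (hc : ContDiff ℝ ∞ c) (h0 : ∀ x, c x ≠ 0)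
    {L : ℝ → Mat4} (x : ℝ) :
    gauge (fun x => scal (c x)) L x 0 1 = c x * L x 0 1 ∧
    gauge (fun x => scal (c x)) L x 0 2 = c x * L x 0 2 := by
  have hr := contDiff_scal hc h0
  have hm (x : ℝ) := (scal_mem_HM (h0 x)).1
  have h := gauge_mul_self hm L x
  have hd1 : deriv (fun x => scal (c x)) x 0 1 = 0 := by
    rw [deriv_mat_entry hr]; simp [scal]
  have hd2 : deriv (fun x => scal (c x)) x 0 2 = 0 := by
    rw [deriv_mat_entry hr]; simp [scal]
  have e1 := congr_fun (congr_fun h 0) 1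
  have e2 := congr_fun (congr_fun h 0) 2
  rw [Matrix.sub_apply, hd1, sub_zero] at e1
  rw [Matrix.sub_apply, hd2, sub_zero] at e2
  simp [Matrix.mul_apply, Fin.sum_univ_four, scal] at e1 e2
  exact ⟨e1, e2⟩

theorem exists_cone_normal_form {L : ℝ → ℝ → Mat4} (hL : IsAlgFamily T L)
    (hq : ∀ ε x, 0 < L ε x 0 1 ^ 2 + L ε x 0 2 ^ 2) :
    ∃ (g : ℝ → ℝ → Mat4) (κ : ℝ → ℝ → Fin 3 → ℝ), IsGaugeFamily T HL g ∧ SmoothFamily κ ∧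
      (∀ ε, κ ε ∈ loops T (Fin 3 → ℝ)) ∧
      (∀ ε x, κ ε x 0 = Real.sqrt (L ε x 0 1 ^ 2 + L ε x 0 2 ^ 2)) ∧
      ∀ ε, gauge (g ε) (L ε) = fun x => mcCone (κ ε x) := by
  have hent (i j : Fin 4) : ContDiff ℝ ∞ fun p : ℝ × ℝ => L p.1 p.2 i j :=
    contDiff_entry (f := fun p : ℝ × ℝ => L p.1 p.2) hL.smooth i j
  set l : ℝ → ℝ → ℝ := fun ε x => Real.sqrt (L ε x 0 1 ^ 2 + L ε x 0 2 ^ 2) with hl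
  have hlpos (ε x : ℝ) : 0 < l ε x := Real.sqrt_pos.2 (hq ε x)
  have hlsq (ε x : ℝ) : l ε x ^ 2 = L ε x 0 1 ^ 2 + L ε x 0 2 ^ 2 := Real.sq_sqrt (hq ε x).le
  have hls : SmoothFamily l :=
    (((hent 0 1).pow 2).add ((hent 0 2).pow 2)).sqrt fun p => (hq p.1 p.2).ne'
  have hli : ContDiff ℝ ∞ fun p : ℝ × ℝ => (l p.1 p.2)⁻¹ :=
    ContDiff.inv hls fun p => (hlpos p.1 p.2).ne'
  have hlp (ε x : ℝ) : l ε (x + T) = l ε x := by simp only [hl, hL.periodic ε x]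
  -- The rotation taking `(L₀₁, L₀₂)` to `(l, 0)`.
  set c : ℝ → ℝ → ℝ := fun ε x => L ε x 0 1 * (l ε x)⁻¹ with hc
  set s : ℝ → ℝ → ℝ := fun ε x => L ε x 0 2 * (l ε x)⁻¹ with hs
  have hcs : SmoothFamily c := (hent 0 1).mul hli
  have hss : SmoothFamily s := (hent 0 2).mul hli
  have h1 (ε x : ℝ) : c ε x ^ 2 + s ε x ^ 2 = 1 := by
    have := (hlpos ε x).ne'
    simp only [hc, hs]; field_simp; rw [hlsq]
  have hR : IsGaugeFamily T HL (fun ε x => rot (c ε x) (s ε x)) :=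
    ⟨contDiff_rot (c := fun p : ℝ × ℝ => c p.1 p.2) (s := fun p : ℝ × ℝ => s p.1 p.2) hcs hss,
      fun ε x => by simp only [hc, hs, hlp, hL.periodic ε x], fun ε x => rot_mem_HL (h1 ε x)⟩
  have hM := hL.gauge isLorentzSubgroup_HL hR
  set M : ℝ → ℝ → Mat4 := fun ε => gauge (fun x => rot (c ε x) (s ε x)) (L ε) with hMdef
  have hM01 (ε x : ℝ) : M ε x 0 1 = l ε x := by
    rw [hMdef]
    refine (gauge_rot_entries (hcs.right ε) (hss.right ε) (h1 ε) (hL.mem ε) x).1.trans ?_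
    have := (hlpos ε x).ne'
    simp only [hc, hs]; field_simp; rw [hlsq]
  have hM02 (ε x : ℝ) : M ε x 0 2 = 0 := by
    refine (gauge_rot_entries (hcs.right ε) (hss.right ε) (h1 ε) (hL.mem ε) x).2.trans ?_
    simp only [hc, hs]; ring
  have hMent (i j : Fin 4) : ContDiff ℝ ∞ fun p : ℝ × ℝ => M p.1 p.2 i j :=
    contDiff_entry (f := fun p : ℝ × ℝ => M p.1 p.2) hM.smooth i j
  -- The translation that cancels the entries `p` and `s` left over by the rotation.
  set a : ℝ → ℝ → ℝ := fun ε x => M ε x 0 0 * (l ε x)⁻¹ with ha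
  set b : ℝ → ℝ → ℝ := fun ε x => M ε x 1 2 * (l ε x)⁻¹ with hb
  have has : SmoothFamily a := (hMent 0 0).mul hli
  have hbs : SmoothFamily b := (hMent 1 2).mul hli
  have hN : IsGaugeFamily T HL (fun ε x => trans (a ε x) (b ε x)) :=
    ⟨contDiff_trans (a := fun p : ℝ × ℝ => a p.1 p.2) (b := fun p : ℝ × ℝ => b p.1 p.2) has hbs,
      fun ε x => by simp only [ha, hb, hlp, hM.periodic ε x], fun ε x => trans_mem_HL _ _⟩
  have hP := hM.gauge isLorentzSubgroup_HL hN
  set P : ℝ → ℝ → Mat4 := fun ε => gauge (fun x => trans (a ε x) (b ε x)) (M ε) with hPdef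
  have hPent (i j : Fin 4) : ContDiff ℝ ∞ fun p : ℝ × ℝ => P p.1 p.2 i j :=
    contDiff_entry (f := fun p : ℝ × ℝ => P p.1 p.2) hP.smooth i j
  have hκ : SmoothFamily (fun ε x => ![l ε x, P ε x 1 0, P ε x 2 0]) := by
    refine contDiff_pi.2 fun i => ?_
    fin_cases i
    exacts [hls, hPent 1 0, hPent 2 0]
  refine ⟨_, fun ε x => ![l ε x, P ε x 1 0, P ε x 2 0], hN.mul isLorentzSubgroup_HL hR, hκ,
    fun ε => ⟨hκ.right ε, fun x => by simp only [hlp, hP.periodic ε x]⟩, fun ε x => by simp [hl],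
    fun ε => ?_⟩
  rw [← gauge_gauge_family isLorentzSubgroup_HL hN hR]
  funext x
  refine (gauge_trans_entries (has.right ε) (hbs.right ε) (hM.mem ε) x (hM02 ε x)).trans ?_
  have := (hlpos ε x).ne'
  rw [mcCone_eq_alg, hM01]
  congr 1
  · simp only [ha]; field_simp; ring
  · simp only [hb]; field_simp; ring

theorem exists_sphere_normal_form {L : ℝ → ℝ → Mat4} (hL : IsAlgFamily T L)
    (hq : ∀ ε x, 0 < L ε x 0 1 ^ 2 + L ε x 0 2 ^ 2) :
    ∃ (g : ℝ → ℝ → Mat4) (κ : ℝ → ℝ → Fin 2 → ℝ), IsGaugeFamily T HM g ∧ SmoothFamily κ ∧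
      (∀ ε, κ ε ∈ loops T (Fin 2 → ℝ)) ∧
      (∀ ε, gauge (g ε) (L ε) = fun x => mcSphere (κ ε x)) ∧
      ∀ ε (k : ℝ → Fin 2 → ℝ), L ε = (fun x => mcSphere (k x)) → g ε = fun _ => 1 := by
  obtain ⟨g₁, k₁, hg₁, hk₁, hl₁, hk₁0, hG₁⟩ := exists_cone_normal_form hL hq
  have hpos (ε x : ℝ) : 0 < k₁ ε x 0 := by rw [hk₁0]; exact Real.sqrt_pos.2 (hq ε x)
  have hc : ContDiff ℝ ∞ fun p : ℝ × ℝ => (k₁ p.1 p.2 0)⁻¹ :=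
    ContDiff.inv (contDiff_pi.1 hk₁ 0) fun p => (hpos p.1 p.2).ne'
  have hc0 (ε x : ℝ) : (k₁ ε x 0)⁻¹ ≠ 0 := inv_ne_zero (hpos ε x).ne'
  -- The dilation scales `k₀` to `1`, but its derivative can create a diagonal entry again. A second
  -- reduction under `HL` removes it, and keeps the value `1` since `k₀` is the square root of `L₀₁²
  -- + L₀₂²`.
  have hS : IsGaugeFamily T HM (fun ε x => scal (k₁ ε x 0)⁻¹) :=
    ⟨contDiff_scal hc fun p => hc0 p.1 p.2, fun ε x => by simp only [(hl₁ ε).2 x],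
      fun ε x => scal_mem_HM (hc0 ε x)⟩
  have hg₁M := hg₁.mono HL_subset_HM
  have hL₂ := (hL.gauge isLorentzSubgroup_HM hg₁M).gauge isLorentzSubgroup_HM hS
  have hent (ε x : ℝ) := gauge_scal_entries (L := gauge (g₁ ε) (L ε))
    (hc.comp (contDiff_const.prodMk contDiff_id : ContDiff ℝ ∞ fun x : ℝ => (ε, x))) (hc0 ε) x
  have h01 (ε x : ℝ) : gauge (fun x => scal (k₁ ε x 0)⁻¹) (gauge (g₁ ε) (L ε)) x 0 1 = 1 := by
    refine (hent ε x).1.trans ?_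
    rw [hG₁]
    simp [mcCone, (hpos ε x).ne']
  have h02 (ε x : ℝ) : gauge (fun x => scal (k₁ ε x 0)⁻¹) (gauge (g₁ ε) (L ε)) x 0 2 = 0 := by
    refine (hent ε x).2.trans ?_
    rw [hG₁]
    simp [mcCone]
  obtain ⟨g₂, k₂, hg₂, hk₂, hl₂, hk₂0, hG₂⟩ := exists_cone_normal_form hL₂
    (fun ε x => by rw [h01, h02]; norm_num)
  have hk₂1 (ε x : ℝ) : k₂ ε x 0 = 1 := by rw [hk₂0, h01, h02]; norm_num
  have hcons (ε x : ℝ) : k₂ ε x = ![1, k₂ ε x 1, k₂ ε x 2] := by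
    ext i; fin_cases i
    exacts [hk₂1 ε x, rfl, rfl]
  have hκ : SmoothFamily (fun ε x => ![k₂ ε x 1, k₂ ε x 2]) := by
    have h := contDiff_pi.1 hk₂
    refine contDiff_pi.2 fun i => ?_
    fin_cases i
    exacts [h 1, h 2]
  have hg₂M := hg₂.mono HL_subset_HM
  refine ⟨_, fun ε x => ![k₂ ε x 1, k₂ ε x 2],
    hg₂M.mul isLorentzSubgroup_HM (hS.mul isLorentzSubgroup_HM hg₁M), hκ,
    fun ε => ⟨hκ.right ε, fun x => by simp only [(hl₂ ε).2 x]⟩, fun ε => ?_, fun ε k hLk => ?_⟩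
  · rw [← gauge_gauge_family isLorentzSubgroup_HM hg₂M (hS.mul isLorentzSubgroup_HM hg₁M),
      ← gauge_gauge_family isLorentzSubgroup_HM hS hg₁M, hG₂]
    funext x
    rw [hcons]; rfl
  -- On a loop already in normal form all three factors are trivial: the two `HL` factors by
  -- freeness, the dilation because `k₀ = 1`.
  · have hp (k : ℝ → Fin 2 → ℝ) (x : ℝ) : 0 < (![1, k x 0, k x 1] : Fin 3 → ℝ) 0 := by simp
    have e₁ : g₁ ε = fun _ => 1 := eq_one_of_gauge_mcCone (hg₁.mem_groupLoops ε)
      (k := fun x => ![1, k x 0, k x 1]) (hp k) (hpos ε)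
      (by rw [← hG₁ ε, hLk]; rfl)
    have e₀ (x : ℝ) : k₁ ε x 0 = 1 := by rw [hk₁0, hLk]; simp [mcSphere, mcCone]
    have e₂ : g₂ ε = fun _ => 1 := by
      refine eq_one_of_gauge_mcCone (hg₂.mem_groupLoops ε)
        (k := fun x => ![1, k x 0, k x 1]) (k' := k₂ ε) (hp k)
        (fun x => by rw [hk₂1]; norm_num) ?_
      rw [← hG₂ ε, e₁, gauge_one, hLk]
      simp only [e₀, inv_one, scal_one, gauge_one]; rfl
    simp only [e₁, e₂, e₀, inv_one, scal_one, mul_one]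

/-! ### Variational derivatives of invariant extensions -/

theorem eq_zero_of_integral_eq_zero {T : ℝ} (hT : 0 < T) {f : ℝ → ℝ} (hf : Continuous f)
    (hp : Function.Periodic f T) (h0 : ∀ x, 0 ≤ f x) (hi : ∫ x in (0 : ℝ)..T, f x = 0) (x : ℝ) :
    f x = 0 := by
  obtain ⟨y, hy, hxy⟩ := hp.exists_mem_Ico₀ hT x
  rw [hxy]
  by_contra hne
  exact (intervalIntegral.integral_pos hT hf.continuousOn (fun x _ => h0 x)
    ⟨y, ⟨hy.1, hy.2.le⟩, lt_of_le_of_ne (h0 y) (Ne.symm hne)⟩).ne' hi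

theorem exists_bound_of_periodic {T : ℝ} (hT : 0 < T) {f : ℝ → ℝ} (hf : Continuous f)
    (hp : Function.Periodic f T) : ∃ C, 0 ≤ C ∧ ∀ x, f x ≤ C := by
  obtain ⟨C, hC⟩ := (isCompact_Icc (a := 0) (b := T)).exists_bound_of_continuousOn hf.continuousOn
  have h (x : ℝ) : f x ≤ C := by
    obtain ⟨y, hy, hxy⟩ := hp.exists_mem_Ico₀ hT x
    rw [hxy]; exact (le_abs_self _).trans (hC y ⟨hy.1, hy.2.le⟩)
  exact ⟨C, (norm_nonneg _).trans (hC 0 ⟨le_rfl, hT.le⟩), h⟩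

theorem contDiff_tracePairing {E : Type*} [NormedAddCommGroup E] [NormedSpace ℝ E]
    {X Y : E → Mat4} (hX : ContDiff ℝ ∞ X) (hY : ContDiff ℝ ∞ Y) :
    ContDiff ℝ ∞ fun x => tracePairing (X x) (Y x) := by
  simp only [tracePairing, Matrix.trace, Matrix.diag]
  exact ContDiff.sum fun i _ => contDiff_entry (contDiff_matMul hX hY) i i

theorem hasDerivAt_tracePairing {X Y : ℝ → Mat4} {X' Y' : Mat4} {x : ℝ} (hX : HasDerivAt X X' x)
    (hY : HasDerivAt Y Y' x) : HasDerivAt (fun y => tracePairing (X y) (Y y))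
      (tracePairing X' (Y x) + tracePairing (X x) Y') x := by
  have h := hasDerivAt_matMul hX hY
  simp only [tracePairing]
  rw [← Matrix.trace_add]
  simp only [Matrix.trace, Matrix.diag]
  exact HasDerivAt.fun_sum fun i _ => hasDerivAt_mat_iff.1 h i i

theorem contDiff_matSmul {E : Type*} [NormedAddCommGroup E] [NormedSpace ℝ E] {c : E → ℝ}
    {X : E → Mat4} (hc : ContDiff ℝ ∞ c) (hX : ContDiff ℝ ∞ X) :
    ContDiff ℝ ∞ fun x => c x • X x :=
  contDiff_mat_iff.2 fun i j => hc.mul (contDiff_entry hX i j)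

theorem tracePairing_transpose (X : Mat4) : tracePairing X Xᵀ = ∑ i, ∑ j, X i j ^ 2 := by
  simp only [tracePairing, Matrix.trace, Matrix.diag, Matrix.mul_apply, Matrix.transpose_apply, sq]

theorem tracePairing_transpose_nonneg (X : Mat4) : 0 ≤ tracePairing X Xᵀ := by
  rw [tracePairing_transpose]
  exact Finset.sum_nonneg fun i _ => Finset.sum_nonneg fun j _ => sq_nonneg _

theorem eq_zero_of_tracePairing_transpose {X : Mat4} (h : tracePairing X Xᵀ = 0) : X = 0 := by
  rw [tracePairing_transpose] at h
  ext i j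
  have h' := (Finset.sum_eq_zero_iff_of_nonneg
    fun i _ => Finset.sum_nonneg fun j _ => sq_nonneg (X i j)).1 h i (Finset.mem_univ i)
  exact pow_eq_zero_iff two_ne_zero |>.1
    ((Finset.sum_eq_zero_iff_of_nonneg fun j _ => sq_nonneg (X i j)).1 h' j (Finset.mem_univ j))

/-- The part of a Lorentz Lie algebra element that has to be nonzero in the gauge domains. -/
def soldering (X : Mat4) : ℝ := X 0 1 ^ 2 + X 0 2 ^ 2

/-- The space `S` parametrizes a cross section of the gauge action of the loop group of `H` on
its domain; `𝔥` contains the velocities of `H` at the identity, and `mcL` is the derivative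
of `mc`. -/
structure IsCrossSection (T : ℝ) (H 𝔥 : Set Mat4) {n : ℕ} (S : Set (ℝ → Fin n → ℝ))
    (mc mcL : (Fin n → ℝ) → Mat4) : Prop where
  subgroup : IsLorentzSubgroup H
  tangent : ∀ G : ℝ → Mat4, ContDiff ℝ ∞ G → (∀ ε, G ε ∈ H) → G 0 = 1 → deriv G 0 ∈ 𝔥
  smooth_mc : ContDiff ℝ ∞ mc
  hasDerivAt_mc : ∀ (κ : ℝ → Fin n → ℝ) (κ' : Fin n → ℝ) (ε : ℝ), HasDerivAt κ κ' ε →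
    HasDerivAt (fun η => mc (κ η)) (mcL κ') ε
  mem_domain_iff : ∀ L, L ∈ gaugeDomain T H S mc ↔ L ∈ algLoops T ∧ ∀ x, 0 < soldering (L x)
  normal_form : ∀ L : ℝ → ℝ → Mat4, IsAlgFamily T L → (∀ ε x, 0 < soldering (L ε x)) →
    ∃ (g : ℝ → ℝ → Mat4) (κ : ℝ → ℝ → Fin n → ℝ), IsGaugeFamily T H g ∧ SmoothFamily κ ∧
      (∀ ε, κ ε ∈ S) ∧ (∀ ε, gauge (g ε) (L ε) = fun x => mc (κ ε x)) ∧
      ∀ ε, ∀ k ∈ S, L ε = (fun x => mc (k x)) → g ε = fun _ => 1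
  unique : ∀ g ∈ groupLoops T H, ∀ k ∈ S, ∀ k' ∈ S,
    gauge g (fun x => mc (k x)) = (fun x => mc (k' x)) → k = k'

/-- `X` is the horizontal element of the loop algebra over the covector `a`. -/
structure IsHorizontal (T : ℝ) (𝔥 : Set Mat4) {n : ℕ} (mcL : (Fin n → ℝ) → Mat4) (K : ℝ → Mat4)
    (a : ℝ → Fin n → ℝ) (X : ℝ → Mat4) : Prop where
  mem : X ∈ algLoops T
  pairing : ∀ x w, tracePairing (X x) (mcL w) = dotPairing (a x) w
  orthogonal : ∀ x, ∀ ξ ∈ 𝔥, tracePairing (deriv X x + (K x * X x - X x * K x)) ξ = 0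

namespace IsCrossSection

variable {T : ℝ} {H 𝔥 : Set Mat4} {n : ℕ} {S : Set (ℝ → Fin n → ℝ)}
  {mc mcL : (Fin n → ℝ) → Mat4}

theorem mc_mem (R : IsCrossSection T H 𝔥 S mc mcL) {k : ℝ → Fin n → ℝ} (hk : k ∈ S) :
    (fun x => mc (k x)) ∈ gaugeDomain T H S mc :=
  ⟨k, hk, fun _ => 1, one_mem_groupLoops R.subgroup, (gauge_one _).symm⟩

/-- An extension evaluates `h` at a chosen normal form; uniqueness of normal forms makes it
independent of the choice and constant on gauge leaves. -/
theorem exists_extension (R : IsCrossSection T H 𝔥 S mc mcL) (h : S → ℝ) :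
    ∃ F, IsInvariantExtension T H S mc h F := by
  have hH := R.subgroup
  choose k hk g hg hL using fun L : gaugeDomain T H S mc => L.2
  have hs {g : ℝ → Mat4} (hg : g ∈ groupLoops T H) (x : ℝ) : g x ∈ SO31 := hH.subset (hg.2 x)
  refine ⟨fun L => h ⟨k L, hk L⟩, fun L k' hL' => ?_, fun L L' ⟨g', hg', hLL'⟩ => ?_⟩
  · have := R.unique _ (hg L) _ (hk L) _ k'.2 (by rw [← hL L, hL'])
    exact congr_arg h (Subtype.ext this)
  · have hi := inv_mem_groupLoops hH (hg L')
    have h1 : gauge (fun x => ((g L') x)⁻¹) L'.1 = fun x => mc (k L' x) := by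
      conv_lhs => rw [hL L']
      exact gauge_inv_gauge (hg L').1.1 (hs (hg L')) _
    rw [hLL', hL L, gauge_gauge hg'.1.1 (hg L).1.1 (hs hg') (hs (hg L)),
      gauge_gauge hi.1.1 (mul_mem_groupLoops hH hg' (hg L)).1.1 (hs hi)
        (hs (mul_mem_groupLoops hH hg' (hg L)))] at h1
    have := R.unique _ (mul_mem_groupLoops hH hi (mul_mem_groupLoops hH hg' (hg L)))
      _ (hk L) _ (hk L') h1
    exact congr_arg h (Subtype.ext this.symm)

theorem mc_injective (R : IsCrossSection T H 𝔥 S mc mcL) {k k' : ℝ → Fin n → ℝ} (hk : k ∈ S)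
    (hk' : k' ∈ S) (h : (fun x => mc (k x)) = fun x => mc (k' x)) : k = k' :=
  R.unique _ (one_mem_groupLoops R.subgroup) k hk k' hk' (by rw [gauge_one, h])

/-- The variational derivative of an invariant extension is horizontal. -/
theorem hasVarDeriv_extension (R : IsCrossSection T H 𝔥 S mc mcL) {h : S → ℝ}
    {F : gaugeDomain T H S mc → ℝ} (hF : IsInvariantExtension T H S mc h F) {k : S}
    {L : gaugeDomain T H S mc} (hL : L.1 = fun x => mc (k.1 x)) {a : ℝ → Fin n → ℝ}
    {X : ℝ → Mat4} (hX : IsHorizontal T 𝔥 mcL L.1 a X) (ha : HasVarDeriv T dotPairing h k a) :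
    HasVarDeriv T tracePairing F L X := by
  intro γ hγ hγ0
  have hγm (ε : ℝ) := (R.mem_domain_iff _).1 (γ ε).2
  have hfam : IsAlgFamily T (fun ε => (γ ε).1) :=
    ⟨hγ, fun ε => (hγm ε).1.1.2, fun ε => (hγm ε).1.2⟩
  -- A path in the domain is gauged into the cross section by a smooth family. At `ε = 0` the path
  -- already lies there, so the family starts at the identity.
  obtain ⟨g, κ, hg, hκ, hκS, hgκ, hg1⟩ := R.normal_form _ hfam fun ε => (hγm ε).2
  have hg0 : g 0 = fun _ => 1 := hg1 0 k.1 k.2 (by rw [hγ0, hL])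
  let κ' : ℝ → S := fun ε => ⟨κ ε, hκS ε⟩
  have hκ0 : κ' 0 = k := by
    refine Subtype.ext (R.mc_injective (hκS 0) k.2 ?_)
    rw [← hgκ 0, hg0, gauge_one, hγ0, hL]
  have hFh (ε : ℝ) : F (γ ε) = h (κ' ε) := by
    rw [← hF.1 ⟨_, R.mc_mem (hκS ε)⟩ (κ' ε) rfl]
    exact (hF.2 (γ ε) ⟨_, R.mc_mem (hκS ε)⟩ ⟨g ε, hg.mem_groupLoops ε, (hgκ ε).symm⟩).symm
  simp only [hFh]
  convert! ha κ' hκ hκ0 using 1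
  set V : ℝ → Mat4 := fun x => deriv (fun ε => (γ ε).1 x) 0 with hV
  set ξ : ℝ → Mat4 := fun x => deriv (fun ε => g ε x) 0 with hξ
  have hγ' : SmoothFamily (fun ε => (γ ε).1) := hγ
  have hVs : ContDiff ℝ ∞ V := hγ'.deriv_left.right 0
  have hξs : ContDiff ℝ ∞ ξ := hg.smooth.deriv_left.right 0
  have hξp : Function.Periodic ξ T := fun x => by simp only [hξ, hg.periodic _ x]
  have hξm (x : ℝ) : ξ x ∈ 𝔥 := R.tangent (fun ε => g ε x) (hg.smooth.left x)
    (fun ε => hg.mem ε x) (by simp only [hg0])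
  -- The derivative at `ε = 0` of `mc(κ) g = g γ - gₓ`, where `g = 1`: the velocity of `κ` differs
  -- from that of `γ` by an infinitesimal gauge transformation.
  have hvar (x : ℝ) : mcL (deriv (fun ε => κ ε x) 0) =
      V x + (ξ x * L.1 x - L.1 x * ξ x) - deriv ξ x := by
    have h1 (ε : ℝ) : mc (κ ε x) * g ε x = g ε x * (γ ε).1 x - deriv (g ε) x := by
      rw [← gauge_mul_self (fun y => R.subgroup.subset (hg.mem ε y)) (γ ε).1 x, hgκ]
    have dg := hasDerivAt_mat (hg.smooth.left x) 0
    have dγ := hasDerivAt_mat (hγ'.left x) 0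
    have dκ := R.hasDerivAt_mc _ _ _ (hasDerivAt_of_smooth (hκ.left x) 0)
    have dd : HasDerivAt (fun ε => deriv (g ε) x) (deriv ξ x) 0 :=
      (hasDerivAt_mat (hg.smooth.deriv_right.left x) 0).congr_deriv (hg.smooth.deriv_comm 0 x)
    have hr := (hasDerivAt_matMul dg dγ).sub dd
    have hl := hasDerivAt_matMul dκ dg
    have hfun : (fun ε => mc (κ ε x) * g ε x) = (fun ε => g ε x * (γ ε).1 x) - fun ε =>
      deriv (g ε) x := funext h1
    rw [hfun] at hl
    have heq := hl.unique hr
    have hγ0' : (γ 0).1 = L.1 := by rw [hγ0]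
    have hκ0' : mc (κ 0 x) = L.1 x := by
      rw [hL, ← hκ0]
    rw [hκ0', hγ0', hg0] at heq
    simp only [Matrix.mul_one, Matrix.one_mul] at heq
    rw [eq_sub_of_add_eq heq]
    simp only [hV, hξ]
    abel
  have hXd := hasDerivAt_mat hX.mem.1.1
  have hXξ : (fun x => tracePairing (X x) (ξ x)) ∈ loops T ℝ :=
    ⟨contDiff_tracePairing hX.mem.1.1 hξs, fun x => by simp only [hX.mem.1.2 x, hξp x]⟩
  -- Cyclicity of the trace turns `tr (X [ξ, L])` into `tr ([L, X] ξ)`, which is `-tr (X' ξ)` by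
  -- horizontality. The gauge term thus contributes only the derivative of the loop `tr (X ξ)`.
  have hpt (x : ℝ) : dotPairing (a x) (deriv (fun ε => κ ε x) 0) =
      tracePairing (X x) (V x) - deriv (fun x => tracePairing (X x) (ξ x)) x := by
    rw [(hasDerivAt_tracePairing (hXd x) (hasDerivAt_mat hξs x)).deriv, ← hX.pairing, hvar]
    have ho := hX.orthogonal x (ξ x) (hξm x)
    simp only [tracePairing, Matrix.add_mul, Matrix.sub_mul, Matrix.mul_add, Matrix.mul_sub,
      Matrix.trace_add, Matrix.trace_sub] at ho ⊢
    have c1 : (X x * (ξ x * L.1 x)).trace = (L.1 x * X x * ξ x).trace := by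
      rw [← Matrix.mul_assoc, Matrix.trace_mul_comm, ← Matrix.mul_assoc]
    rw [c1, ← Matrix.mul_assoc (X x)]
    linarith
  change ∫ x in (0 : ℝ)..T, tracePairing (X x) (V x) =
    ∫ x in (0 : ℝ)..T, dotPairing (a x) (deriv (fun ε => κ ε x) 0)
  simp only [hpt]
  rw [intervalIntegral.integral_sub
    ((contDiff_tracePairing hX.mem.1.1 hVs).continuous.intervalIntegrable _ _)
    ((contDiff_deriv hXξ.1).continuous.intervalIntegrable _ _), integral_deriv_loop hXξ, sub_zero]

/-- A path in `S` is also a path in the domain, along which the extension agrees with `h`. So the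
covector is read off from the pairing of `X` with tangents of the cross section, and horizontality
of `X` is not needed. -/
theorem hasVarDeriv_of_extension (R : IsCrossSection T H 𝔥 S mc mcL) {h : S → ℝ}
    {F : gaugeDomain T H S mc → ℝ} (hF : IsInvariantExtension T H S mc h F) {k : S}
    {L : gaugeDomain T H S mc} (hL : L.1 = fun x => mc (k.1 x)) {a : ℝ → Fin n → ℝ}
    {X : ℝ → Mat4} (hXa : ∀ x w, tracePairing (X x) (mcL w) = dotPairing (a x) w)
    (hX : HasVarDeriv T tracePairing F L X) : HasVarDeriv T dotPairing h k a := by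
  intro κ hκ hκ0
  let γ : ℝ → gaugeDomain T H S mc := fun ε => ⟨_, R.mc_mem (κ ε).2⟩
  have hγ : IsSmoothPath γ := R.smooth_mc.comp hκ
  have hκ' : SmoothFamily (fun ε => (κ ε).1) := hκ
  have hγ0 : γ 0 = L := Subtype.ext (by rw [hL, ← hκ0])
  have hFh (ε : ℝ) : F (γ ε) = h (κ ε) := hF.1 _ _ rfl
  have hd (x : ℝ) : deriv (fun ε => (γ ε).1 x) 0 = mcL (deriv (fun ε => (κ ε).1 x) 0) :=
    deriv_mat_eq (R.hasDerivAt_mc _ _ _ (hasDerivAt_of_smooth (hκ'.left x) 0))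
  have h1 := hX γ hγ hγ0
  simp only [hFh] at h1
  refine h1.congr_deriv ?_
  congr 1
  funext x
  exact (congr_arg (tracePairing (X x)) (hd x)).trans (hXa x _)

/-- The test direction is `V = (X - X')ᵀ`, for which the trace form is a sum of squares. The test
path must stay in the domain for every parameter, so the line `L + ε V` is replaced by a bounded
reparametrization with the same velocity at `0`. -/
theorem varDeriv_unique (R : IsCrossSection T H 𝔥 S mc mcL) (hT : 0 < T)
    {F : gaugeDomain T H S mc → ℝ} {L : gaugeDomain T H S mc} {X X' : ℝ → Mat4}
    (hXm : X ∈ algLoops T) (hXm' : X' ∈ algLoops T) (hX : HasVarDeriv T tracePairing F L X)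
    (hX' : HasVarDeriv T tracePairing F L X') : X = X' := by
  obtain ⟨hLm, hLq⟩ := (R.mem_domain_iff _).1 L.2
  set V : ℝ → Mat4 := fun x => (X x - X' x)ᵀ with hV
  have hVs : ContDiff ℝ ∞ V := contDiff_matTranspose (hXm.1.1.sub hXm'.1.1)
  have hVp : Function.Periodic V T := fun x => by simp only [hV, hXm.1.2 x, hXm'.1.2 x]
  have hVm (x : ℝ) : V x ∈ so31 := transpose_mem_so31 (sub_mem_so31 (hXm.2 x) (hXm'.2 x))
  have hsol {L : ℝ → Mat4} (hL : ContDiff ℝ ∞ L) : ContDiff ℝ ∞ fun x => soldering (L x) :=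
    ((contDiff_entry hL 0 1).pow 2).add ((contDiff_entry hL 0 2).pow 2)
  obtain ⟨C, hC0, hC⟩ := exists_bound_of_periodic hT
    ((hsol hVs).div (hsol hLm.1.1) fun x => (hLq x).ne').continuous
    (fun x => by simp only [Pi.div_apply, hVp x, hLm.1.2 x])
  -- `C` bounds `soldering V / soldering L`, and this amplitude satisfies `δ² C < 1`.
  set δ : ℝ := 1 / (1 + C) with hδ
  have hδ0 : 0 < δ := by positivity
  have hδC : δ ^ 2 * C < 1 := by
    rw [hδ, div_pow, one_pow, one_div_mul_eq_div, div_lt_one (by positivity)]; nlinarith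
  set η : ℝ → ℝ := fun ε => δ * Real.sin (ε / δ) with hη
  have hηs : ContDiff ℝ ∞ η :=
    contDiff_const.mul (Real.contDiff_sin.comp (contDiff_id.div_const δ))
  have hη0 : η 0 = 0 := by simp [hη]
  have hηd : HasDerivAt η 1 0 := by
    have h1 := ((Real.hasDerivAt_sin (0 / δ)).comp 0
      ((hasDerivAt_id (0 : ℝ)).div_const δ)).const_mul δ
    convert! h1 using 1
    simp [hδ0.ne']
  have hηsq (ε : ℝ) : η ε ^ 2 ≤ δ ^ 2 := by
    rw [hη, mul_pow]
    nlinarith [Real.sin_sq_le_one (ε / δ), sq_nonneg δ]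
  have hmem (ε : ℝ) : (fun x => L.1 x + η ε • V x) ∈ gaugeDomain T H S mc := by
    refine (R.mem_domain_iff _).2 ⟨⟨⟨hLm.1.1.add (contDiff_matSmul contDiff_const hVs),
      fun x => by simp only [hLm.1.2 x, hVp x]⟩,
      fun x => add_mem_so31 (hLm.2 x) (smul_mem_so31 _ (hVm x))⟩, fun x => ?_⟩
    -- If both entries vanished, `soldering L = η² soldering V ≤ δ² C soldering L` would be less
    -- than `soldering L`.
    by_contra hcon
    simp only [soldering, Matrix.add_apply, Matrix.smul_apply, smul_eq_mul] at hcon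
    have z1 : L.1 x 0 1 + η ε * V x 0 1 = 0 := by
      refine pow_eq_zero_iff two_ne_zero |>.1 (le_antisymm ?_ (sq_nonneg _))
      linarith [sq_nonneg (L.1 x 0 2 + η ε * V x 0 2)]
    have z2 : L.1 x 0 2 + η ε * V x 0 2 = 0 := by
      refine pow_eq_zero_iff two_ne_zero |>.1 (le_antisymm ?_ (sq_nonneg _))
      linarith [sq_nonneg (L.1 x 0 1 + η ε * V x 0 1)]
    have h1 : soldering (L.1 x) = η ε ^ 2 * soldering (V x) := by
      simp only [soldering]
      rw [eq_neg_of_add_eq_zero_left z1, eq_neg_of_add_eq_zero_left z2]; ring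
    have h2 : soldering (V x) ≤ C * soldering (L.1 x) := (div_le_iff₀ (hLq x)).1 (hC x)
    have h3 : η ε ^ 2 * soldering (V x) ≤ δ ^ 2 * (C * soldering (L.1 x)) :=
      mul_le_mul (hηsq ε) h2 (by simp only [soldering]; positivity) (by positivity)
    have h4 : δ ^ 2 * C * soldering (L.1 x) < 1 * soldering (L.1 x) :=
      mul_lt_mul_of_pos_right hδC (hLq x)
    linarith
  let γ : ℝ → gaugeDomain T H S mc := fun ε => ⟨_, hmem ε⟩
  have hγ : IsSmoothPath γ := (hLm.1.1.comp contDiff_snd).add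
    (contDiff_matSmul (hηs.comp contDiff_fst) (hVs.comp contDiff_snd))
  have hγ0 : γ 0 = L := Subtype.ext (by simp [γ, hη0])
  have hd (x : ℝ) : deriv (fun ε => (γ ε).1 x) 0 = V x := by
    have h := (hηd.smul_const (V x)).const_add (L.1 x)
    rw [one_smul] at h
    exact deriv_mat_eq h
  have heq : ∫ x in (0 : ℝ)..T, tracePairing (X x) (V x) =
      ∫ x in (0 : ℝ)..T, tracePairing (X' x) (V x) := by
    have h := (hX γ hγ hγ0).unique (hX' γ hγ hγ0)
    have hV' : V = fun x => deriv (fun ε => (γ ε).1 x) 0 := funext fun x => (hd x).symm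
    rw [hV']
    exact h
  have hcont {Y : ℝ → Mat4} (hY : Y ∈ algLoops T) :
      IntervalIntegrable (fun x => tracePairing (Y x) (V x)) MeasureTheory.volume 0 T :=
    (contDiff_tracePairing hY.1.1 hVs).continuous.intervalIntegrable _ _
  have hzero : ∫ x in (0 : ℝ)..T, tracePairing (X x - X' x) (V x) = 0 := by
    rw [← sub_eq_zero, ← intervalIntegral.integral_sub (hcont hXm) (hcont hXm')] at heq
    rw [← heq]
    congr 1; funext x
    simp only [tracePairing, Matrix.sub_mul, Matrix.trace_sub]
  have hpt := eq_zero_of_integral_eq_zero hT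
    (contDiff_tracePairing (hXm.1.1.sub hXm'.1.1) hVs).continuous
    (fun x => by simp only [hVp x, hXm.1.2 x, hXm'.1.2 x])
    (fun x => tracePairing_transpose_nonneg _) hzero
  exact funext fun x => sub_eq_zero.1 (eq_zero_of_tracePairing_transpose (hpt x))

theorem reducedBracket_iff (R : IsCrossSection T H 𝔥 S mc mcL) (hT : 0 < T) {h f : S → ℝ} {k : S}
    {a b : ℝ → Fin n → ℝ} {X Y : ℝ → Mat4}
    (hX : IsHorizontal T 𝔥 mcL (fun x => mc (k.1 x)) a X)
    (hY : IsHorizontal T 𝔥 mcL (fun x => mc (k.1 x)) b Y)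
    (ha : HasVarDeriv T dotPairing h k a) (hb : HasVarDeriv T dotPairing f k b) (v : ℝ) :
    ReducedBracket T H S mc h f k v ↔ v = lieBracket T (fun x => mc (k.1 x)) X Y := by
  constructor
  · rintro ⟨F, G, hF, hG, L, hL, X', hX', Y', hY', hFX, hGY, rfl⟩
    have eX := R.varDeriv_unique hT hX.mem hX'
      (R.hasVarDeriv_extension hF hL (by rwa [hL]) ha) hFX
    have eY := R.varDeriv_unique hT hY.mem hY'
      (R.hasVarDeriv_extension hG hL (by rwa [hL]) hb) hGY
    rw [hL, eX, eY]
  · rintro rfl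
    obtain ⟨F, hF⟩ := R.exists_extension h
    obtain ⟨G, hG⟩ := R.exists_extension f
    refine ⟨F, G, hF, hG, ⟨_, R.mc_mem k.2⟩, rfl, X, hX.mem, Y, hY.mem, ?_, ?_, rfl⟩
    · exact R.hasVarDeriv_extension hF rfl hX ha
    · exact R.hasVarDeriv_extension hG rfl hY hb

end IsCrossSection

/-! ### The two cross sections -/

/-- If both entries vanished, the gauged matrix would have `e₄` as an eigenvector, and the gauge
relation at `e₄` would make `k₀ g e₂` a multiple of `e₄`; but that vector has square norm `k₀² > 0`,
while `e₄` is null. -/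
theorem soldering_pos_of_gauge {T : ℝ} {g : ℝ → Mat4} (hg : g ∈ groupLoops T HM)
    {k : ℝ → Fin 3 → ℝ} (hk : ∀ x, 0 < k x 0) (x : ℝ) :
    0 < soldering (gauge g (fun x => mcCone (k x)) x) := by
  have hs (x : ℝ) : g x ∈ SO31 := (hg.2 x).1
  choose c hc using fun x => (hg.2 x).2
  have hc33 : c = fun x => g x 3 3 := funext fun x => by
    have := congr_fun (hc x) 3
    rw [mulVec_e4] at this
    simpa [e4] using this.symm
  have hcs : ContDiff ℝ ∞ c := by rw [hc33]; exact contDiff_entry hg.1.1 3 3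
  have hA := eq_alg_of_mem_so31 (gauge_mem_so31 hg.1.1 hs (fun x => mcCone_mem_so31 (k x)) x)
  have h1 := gauge_mul_self hs (fun x => mcCone (k x)) x
  set A := gauge g (fun x => mcCone (k x)) x
  have h2 : A *ᵥ (g x *ᵥ e4) = g x *ᵥ (mcCone (k x) *ᵥ e4) - deriv g x *ᵥ e4 := by
    rw [Matrix.mulVec_mulVec, h1, Matrix.sub_mulVec, Matrix.mulVec_mulVec]
  have h3 : deriv g x *ᵥ e4 = deriv c x • e4 := by
    have h4 := hasDerivAt_mulVec (hasDerivAt_mat hg.1.1 x) (hasDerivAt_const x e4)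
    simp only [hc, Matrix.mulVec_zero, add_zero] at h4
    exact h4.unique ((hasDerivAt_of_smooth hcs x).smul_const e4)
  by_contra hcon
  simp only [soldering] at hcon
  have z1 : A 0 1 = 0 := by
    refine pow_eq_zero_iff two_ne_zero |>.1 (le_antisymm ?_ (sq_nonneg _))
    linarith [sq_nonneg (A 0 2)]
  have z2 : A 0 2 = 0 := by
    refine pow_eq_zero_iff two_ne_zero |>.1 (le_antisymm ?_ (sq_nonneg _))
    linarith [sq_nonneg (A 0 1)]
  have h5 : A *ᵥ e4 = (-A 0 0) • e4 := by
    rw [z1, z2] at hA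
    rw [mulVec_e4, hA]
    ext i; fin_cases i <;> simp [alg, e4]
  rw [h3, hc, Matrix.mulVec_smul, h5, mcCone_mulVec_e4, Matrix.mulVec_smul] at h2
  have h6 : k x 0 • (g x *ᵥ ![0, 1, 0, 0]) = (c x * -A 0 0 + deriv c x) • e4 := by
    rw [add_smul, mul_smul, h2, sub_add_cancel]
  have h7 := congr_arg (fun v => mink v v) h6
  simp only [mink_smul_left, mink_smul_right, mink_mulVec (hs x), mink_e4] at h7
  simp [mink_eq] at h7
  exact (hk x).ne' h7

theorem mcCone_mem_algLoops {T : ℝ} {k : ℝ → Fin 3 → ℝ} (hk : k ∈ loops T (Fin 3 → ℝ)) :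
    (fun x => mcCone (k x)) ∈ algLoops T :=
  ⟨⟨contDiff_mcCone hk.1, fun x => by simp only [hk.2 x]⟩, fun x => mcCone_mem_so31 _⟩

/-- The Lie algebra of `HL`. -/
def algHL : Set Mat4 := {ξ | ∃ r₁ r₂ s, ξ = alg 0 0 0 r₁ r₂ s}

/-- The Lie algebra of `HM`. -/
def algHM : Set Mat4 := {ξ | ∃ p r₁ r₂ s, ξ = alg p 0 0 r₁ r₂ s}

theorem deriv_mem_so31_of_one {G : ℝ → Mat4} (hG : ContDiff ℝ ∞ G) (hm : ∀ ε, G ε ∈ SO31)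
    (h0 : G 0 = 1) : deriv G 0 ∈ so31 := by
  have := deriv_mul_inv_mem_so31 (hasDerivAt_mat hG 0) hm
  rwa [h0, inv_one, mul_one] at this

theorem deriv_mem_algHM {G : ℝ → Mat4} (hG : ContDiff ℝ ∞ G) (hm : ∀ ε, G ε ∈ HM)
    (h0 : G 0 = 1) : deriv G 0 ∈ algHM := by
  have h1 := eq_alg_of_mem_so31 (deriv_mem_so31_of_one hG (fun ε => (hm ε).1) h0)
  have hz (i : Fin 4) (hi : e4 i = 0) : deriv G 0 i 3 = 0 := by
    have h (ε : ℝ) : G ε i 3 = 0 := by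
      obtain ⟨c, hc⟩ := (hm ε).2
      have := congr_fun hc i
      rw [Pi.smul_apply, hi, smul_zero] at this
      rw [← this]; simp [e4, Matrix.mulVec, dotProduct, Fin.sum_univ_four]
    rw [deriv_mat_entry hG]; simp [h]
  have e1 := hz 1 (by simp [e4])
  have e2 := hz 2 (by simp [e4])
  have f1 : deriv G 0 1 3 = deriv G 0 0 1 := by rw [h1]; simp [alg]
  have f2 : deriv G 0 2 3 = deriv G 0 0 2 := by rw [h1]; simp [alg]
  rw [← f1, ← f2, e1, e2] at h1
  exact ⟨_, _, _, _, h1⟩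

theorem deriv_mem_algHL {G : ℝ → Mat4} (hG : ContDiff ℝ ∞ G) (hm : ∀ ε, G ε ∈ HL)
    (h0 : G 0 = 1) : deriv G 0 ∈ algHL := by
  obtain ⟨p, r₁, r₂, s, h⟩ := deriv_mem_algHM hG (fun ε => HL_subset_HM (hm ε)) h0
  have h33 : deriv G 0 3 3 = 0 := by
    have h (ε : ℝ) : G ε 3 3 = 1 := by
      have := congr_fun (hm ε).2 3
      rw [mulVec_e4] at this
      simpa [e4] using this
    rw [deriv_mat_entry hG]; simp [h]
  have hp : p = 0 := by
    rw [h] at h33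
    simpa [alg] using h33
  rw [hp] at h
  exact ⟨_, _, _, h⟩

theorem IsAlgFamily.const {T : ℝ} {L : ℝ → Mat4} (hL : L ∈ algLoops T) :
    IsAlgFamily T (fun _ => L) :=
  ⟨hL.1.1.comp contDiff_snd, fun _ => hL.1.2, fun _ => hL.2⟩

theorem hasDerivAt_mcCone {κ : ℝ → Fin 3 → ℝ} {κ' : Fin 3 → ℝ} {ε : ℝ} (h : HasDerivAt κ κ' ε) :
    HasDerivAt (fun η => mcCone (κ η)) (mcCone κ') ε := by
  have h' := hasDerivAt_pi.1 h
  refine hasDerivAt_mat_iff.2 fun i j => ?_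
  fin_cases i <;> fin_cases j <;> simp [mcCone] <;>
    first | exact h' _ | exact hasDerivAt_const _ _

theorem cone_isCrossSection (T : ℝ) :
    IsCrossSection T HL algHL (coneInvariants T) mcCone mcCone where
  subgroup := isLorentzSubgroup_HL
  tangent := fun _ hG hm h0 => deriv_mem_algHL hG hm h0
  smooth_mc := contDiff_mcCone contDiff_id
  hasDerivAt_mc := fun _ _ _ h => hasDerivAt_mcCone h
  mem_domain_iff := fun L => by
    constructor
    · rintro ⟨k, hk, g, hg, rfl⟩
      rw [mem_coneInvariants_iff] at hk
      exact ⟨gauge_mem_algLoops (groupLoops_mono isLorentzSubgroup_HL.subset hg)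
        (mcCone_mem_algLoops hk.1), soldering_pos_of_gauge (groupLoops_mono HL_subset_HM hg) hk.2⟩
    · rintro ⟨hL, hq⟩
      -- A single loop is treated as a constant family; the inverse gauge transformation displays it
      -- as an element of a leaf.
      obtain ⟨g, κ, hg, -, hκ, hκ0, hgκ⟩ := exists_cone_normal_form (IsAlgFamily.const hL)
        fun _ x => hq x
      have hg0 := hg.mem_groupLoops 0
      refine ⟨κ 0, mem_coneInvariants_iff.2 ⟨hκ 0, fun x => ?_⟩, _,
        inv_mem_groupLoops isLorentzSubgroup_HL hg0, ?_⟩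
      · rw [hκ0]; exact Real.sqrt_pos.2 (hq x)
      · rw [← hgκ 0, gauge_inv_gauge hg0.1.1 fun x => (hg0.2 x).1]
  normal_form := fun L hL hq => by
    obtain ⟨g, κ, hg, hκs, hκ, hκ0, hgκ⟩ := exists_cone_normal_form hL hq
    have hpos (ε x : ℝ) : 0 < κ ε x 0 := by rw [hκ0]; exact Real.sqrt_pos.2 (hq ε x)
    refine ⟨g, κ, hg, hκs, fun ε => mem_coneInvariants_iff.2 ⟨hκ ε, hpos ε⟩, hgκ,
      fun ε k hk hLk => ?_⟩
    exact eq_one_of_gauge_mcCone (hg.mem_groupLoops ε) (mem_coneInvariants_iff.1 hk).2 (hpos ε)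
      (by rw [← hLk, hgκ])
  unique := fun g hg k hk k' hk' h => eq_of_gauge_mcCone hg (mem_coneInvariants_iff.1 hk).2
    (mem_coneInvariants_iff.1 hk').2 h

/-- The derivative of `mcSphere`. -/
def mcSphereL (w : Fin 2 → ℝ) : Mat4 := mcCone ![0, w 0, w 1]

theorem sphere_isCrossSection (T : ℝ) :
    IsCrossSection T HM algHM (sphereInvariants T) mcSphere mcSphereL where
  subgroup := isLorentzSubgroup_HM
  tangent := fun _ hG hm h0 => deriv_mem_algHM hG hm h0
  smooth_mc := by
    refine contDiff_mcCone (contDiff_pi.2 fun i => ?_)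
    fin_cases i
    exacts [contDiff_const, contDiff_apply ℝ ℝ 0, contDiff_apply ℝ ℝ 1]
  hasDerivAt_mc := fun κ κ' ε h => by
    have h' := hasDerivAt_pi.1 h
    refine hasDerivAt_mcCone (κ := fun η => ![1, κ η 0, κ η 1]) (hasDerivAt_pi.2 fun i => ?_)
    fin_cases i
    exacts [hasDerivAt_const ε 1, h' 0, h' 1]
  mem_domain_iff := fun L => by
    constructor
    · rintro ⟨k, hk, g, hg, rfl⟩
      rw [mem_sphereInvariants_iff, ← loop_cons_one_iff] at hk
      exact ⟨gauge_mem_algLoops (groupLoops_mono isLorentzSubgroup_HM.subset hg)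
        (mcCone_mem_algLoops hk), soldering_pos_of_gauge hg fun x => by simp⟩
    · rintro ⟨hL, hq⟩
      obtain ⟨g, κ, hg, -, hκ, hgκ, -⟩ := exists_sphere_normal_form (IsAlgFamily.const hL)
        fun _ x => hq x
      have hg0 := hg.mem_groupLoops 0
      refine ⟨κ 0, mem_sphereInvariants_iff.2 (hκ 0), _,
        inv_mem_groupLoops isLorentzSubgroup_HM hg0, ?_⟩
      rw [← hgκ 0, gauge_inv_gauge hg0.1.1 fun x => (hg0.2 x).1]
  normal_form := fun L hL hq => by
    obtain ⟨g, κ, hg, hκs, hκ, hgκ, h1⟩ := exists_sphere_normal_form hL hq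
    exact ⟨g, κ, hg, hκs, fun ε => mem_sphereInvariants_iff.2 (hκ ε), hgκ,
      fun ε k _ hLk => h1 ε k hLk⟩
  unique := fun g hg k _ k' _ h => eq_of_gauge_mcSphere hg h

/-! ### Horizontal elements and the reduced brackets -/

section RealLoops

variable {T : ℝ} {f g : ℝ → ℝ}

theorem add_mem_loops (hf : f ∈ loops T ℝ) (hg : g ∈ loops T ℝ) :
    (fun x => f x + g x) ∈ loops T ℝ :=
  ⟨hf.1.add hg.1, fun x => by simp only [hf.2 x, hg.2 x]⟩

theorem sub_mem_loops (hf : f ∈ loops T ℝ) (hg : g ∈ loops T ℝ) :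
    (fun x => f x - g x) ∈ loops T ℝ :=
  ⟨hf.1.sub hg.1, fun x => by simp only [hf.2 x, hg.2 x]⟩

theorem mul_mem_loops (hf : f ∈ loops T ℝ) (hg : g ∈ loops T ℝ) :
    (fun x => f x * g x) ∈ loops T ℝ :=
  ⟨hf.1.mul hg.1, fun x => by simp only [hf.2 x, hg.2 x]⟩

theorem div_mem_loops (hf : f ∈ loops T ℝ) (hg : g ∈ loops T ℝ) (h0 : ∀ x, g x ≠ 0) :
    (fun x => f x / g x) ∈ loops T ℝ :=
  ⟨hf.1.div hg.1 h0, fun x => by simp only [hf.2 x, hg.2 x]⟩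

theorem const_mem_loops (c : ℝ) : (fun _ => c) ∈ loops T ℝ := ⟨contDiff_const, fun _ => rfl⟩

theorem coord_mem_loops {n : ℕ} {a : ℝ → Fin n → ℝ} (ha : a ∈ loops T (Fin n → ℝ)) (i : Fin n) :
    (fun x => a x i) ∈ loops T ℝ :=
  ⟨contDiff_pi.1 ha.1 i, fun x => by simp only [ha.2 x]⟩

end RealLoops

theorem alg_mem_algLoops {T : ℝ} {p q₁ q₂ r₁ r₂ s : ℝ → ℝ} (hp : p ∈ loops T ℝ)
    (hq₁ : q₁ ∈ loops T ℝ) (hq₂ : q₂ ∈ loops T ℝ) (hr₁ : r₁ ∈ loops T ℝ) (hr₂ : r₂ ∈ loops T ℝ)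
    (hs : s ∈ loops T ℝ) :
    (fun x => alg (p x) (q₁ x) (q₂ x) (r₁ x) (r₂ x) (s x)) ∈ algLoops T := by
  refine ⟨⟨contDiff_mat_iff.2 fun i j => ?_, fun x => ?_⟩, fun x => alg_mem_so31 ..⟩
  · fin_cases i <;> fin_cases j <;> simp [alg] <;>
      first
      | exact hp.1 | exact hq₁.1 | exact hq₂.1 | exact hr₁.1 | exact hr₂.1 | exact hs.1
      | exact hs.1.neg | exact hp.1.neg | exact contDiff_const
  · simp only [hp.2 x, hq₁.2 x, hq₂.2 x, hr₁.2 x, hr₂.2 x, hs.2 x]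

theorem deriv_alg {p q₁ q₂ r₁ r₂ s : ℝ → ℝ} {p' q₁' q₂' r₁' r₂' s' x : ℝ} (hp : HasDerivAt p p' x)
    (hq₁ : HasDerivAt q₁ q₁' x) (hq₂ : HasDerivAt q₂ q₂' x) (hr₁ : HasDerivAt r₁ r₁' x)
    (hr₂ : HasDerivAt r₂ r₂' x) (hs : HasDerivAt s s' x) :
    deriv (fun x => alg (p x) (q₁ x) (q₂ x) (r₁ x) (r₂ x) (s x)) x =
      alg p' q₁' q₂' r₁' r₂' s' := by
  refine deriv_mat_eq (hasDerivAt_mat_iff.2 fun i j => ?_)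
  fin_cases i <;> fin_cases j <;> simp [alg] <;>
    first
    | exact hp | exact hq₁ | exact hq₂ | exact hr₁ | exact hr₂ | exact hs
    | exact hs.neg | exact hp.neg | exact hasDerivAt_const _ _

theorem commutator_mcCone (k : Fin 3 → ℝ) (p q₁ q₂ r₁ r₂ s : ℝ) :
    mcCone k * alg p q₁ q₂ r₁ r₂ s - alg p q₁ q₂ r₁ r₂ s * mcCone k =
      alg (k 0 * r₁ - q₁ * k 1 - q₂ * k 2) (-(p * k 0)) (k 0 * s) (k 1 * p - s * k 2)
        (k 2 * p + s * k 1) (k 1 * q₂ + k 0 * r₂ - q₁ * k 2) := by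
  ext i j
  fin_cases i <;> fin_cases j <;>
    simp [mcCone, alg] <;> ring

theorem alg_add (p q₁ q₂ r₁ r₂ s p' q₁' q₂' r₁' r₂' s' : ℝ) :
    alg p q₁ q₂ r₁ r₂ s + alg p' q₁' q₂' r₁' r₂' s' =
      alg (p + p') (q₁ + q₁') (q₂ + q₂') (r₁ + r₁') (r₂ + r₂') (s + s') := by
  ext i j
  fin_cases i <;> fin_cases j <;> simp [alg] <;> ring

/-- The horizontal element over `a`, for the cross section of the cone. -/
noncomputable def coneHorizontal (k a : ℝ → Fin 3 → ℝ) (x : ℝ) : Mat4 :=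
  alg (1 / 2 * (1 / k x 0 * deriv (fun y => a y 1) x)) (1 / 2 * a x 1) (1 / 2 * a x 2)
    (1 / 2 * a x 0)
    (1 / 2 * (k x 2 / k x 0 * a x 1 - k x 1 / k x 0 * a x 2 +
      1 / k x 0 * deriv (fun y => 1 / k y 0 * deriv (fun z => a z 2) y) x))
    (-1 / 2 * (1 / k x 0 * deriv (fun y => a y 2) x))

section Horizontal

variable {T : ℝ} {k a : ℝ → Fin 3 → ℝ}

theorem coneHorizontal_mem (hk : k ∈ loops T (Fin 3 → ℝ)) (hpos : ∀ x, 0 < k x 0)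
    (ha : a ∈ loops T (Fin 3 → ℝ)) : coneHorizontal k a ∈ algLoops T := by
  have hk0 : (fun x => 1 / k x 0) ∈ loops T ℝ :=
    div_mem_loops (const_mem_loops 1) (coord_mem_loops hk 0) fun x => (hpos x).ne'
  have hd (i : Fin 3) : (fun x => k x i / k x 0) ∈ loops T ℝ :=
    div_mem_loops (coord_mem_loops hk i) (coord_mem_loops hk 0) fun x => (hpos x).ne'
  have hA (i : Fin 3) : (fun x => 1 / k x 0 * deriv (fun y => a y i) x) ∈ loops T ℝ :=
    mul_mem_loops hk0 (deriv_mem_loops (coord_mem_loops ha i))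
  have hc (i : Fin 3) (c : ℝ) := mul_mem_loops (const_mem_loops (T := T) c) (coord_mem_loops ha i)
  exact alg_mem_algLoops (mul_mem_loops (const_mem_loops _) (hA 1)) (hc 1 _) (hc 2 _) (hc 0 _)
    (mul_mem_loops (const_mem_loops _) (add_mem_loops (sub_mem_loops
      (mul_mem_loops (hd 2) (coord_mem_loops ha 1)) (mul_mem_loops (hd 1) (coord_mem_loops ha 2)))
      (mul_mem_loops hk0 (deriv_mem_loops (hA 2)))))
    (mul_mem_loops (const_mem_loops _) (hA 2))

/-- Pairing with tangents of the cross section involves only the entries `r₁`, `q₁`, `q₂`, which are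
therefore half of `a₀`, `a₁`, `a₂`. -/
theorem coneHorizontal_pairing (k a : ℝ → Fin 3 → ℝ) (x : ℝ) (w : Fin 3 → ℝ) :
    tracePairing (coneHorizontal k a x) (mcCone w) = dotPairing (a x) w := by
  rw [coneHorizontal, mcCone_eq_alg, tracePairing_alg]
  simp [dotPairing, dotProduct, Fin.sum_univ_three]; ring

/-- The Hamiltonian vector field at `K(k)` of the horizontal element over `a`. -/
theorem coneHorizontal_hamiltonian (hk : k ∈ loops T (Fin 3 → ℝ)) (hpos : ∀ x, 0 < k x 0)
    (ha : a ∈ loops T (Fin 3 → ℝ)) (x : ℝ) :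
    ∃ p r₁ r₂ : ℝ, deriv (coneHorizontal k a) x +
        (mcCone (k x) * coneHorizontal k a x - coneHorizontal k a x * mcCone (k x)) =
        alg p 0 0 r₁ r₂ 0 ∧
      p = 1 / 2 * (deriv (fun y => 1 / k y 0 * deriv (fun z => a z 1) y) x +
        k x 0 * a x 0 - k x 1 * a x 1 - k x 2 * a x 2) ∧
      r₁ = 1 / 2 * (deriv (fun y => a y 0) x + k x 1 / k x 0 * deriv (fun y => a y 1) x +
        k x 2 / k x 0 * deriv (fun y => a y 2) x) ∧
      r₂ = 1 / 2 * coneOp k a x 2 := by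
  have hk0 : (fun x => 1 / k x 0) ∈ loops T ℝ :=
    div_mem_loops (const_mem_loops 1) (coord_mem_loops hk 0) fun x => (hpos x).ne'
  have hd (i : Fin 3) : (fun x => k x i / k x 0) ∈ loops T ℝ :=
    div_mem_loops (coord_mem_loops hk i) (coord_mem_loops hk 0) fun x => (hpos x).ne'
  have hA (i : Fin 3) : (fun x => 1 / k x 0 * deriv (fun y => a y i) x) ∈ loops T ℝ :=
    mul_mem_loops hk0 (deriv_mem_loops (coord_mem_loops ha i))
  have D {f : ℝ → ℝ} (hf : f ∈ loops T ℝ) := hasDerivAt_of_smooth hf.1 x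
  have dA1 := D (hA 1)
  have dA2 := D (hA 2)
  have da (i : Fin 3) := D (coord_mem_loops ha i)
  have dC21 := D (mul_mem_loops (hd 2) (coord_mem_loops ha 1))
  have dC12 := D (mul_mem_loops (hd 1) (coord_mem_loops ha 2))
  have dB2 := D (mul_mem_loops hk0 (deriv_mem_loops (hA 2)))
  have hk0x := (hpos x).ne'
  have hder := deriv_alg (dA1.const_mul (1 / 2)) ((da 1).const_mul (1 / 2))
    ((da 2).const_mul (1 / 2)) ((da 0).const_mul (1 / 2))
    (((dC21.sub dC12).add dB2).const_mul (1 / 2)) (dA2.const_mul (-1 / 2))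
  have hder' : deriv (coneHorizontal k a) x = _ := hder
  refine ⟨_, _, _, ?_, rfl, rfl, rfl⟩
  rw [hder', coneHorizontal, commutator_mcCone, alg_add]
  -- The entries `q₁`, `q₂` and `s` vanish by construction: these equations are solved
  -- algebraically, thanks to `k₀ ≠ 0`, for the entries `p`, `s` and `r₂` of the horizontal element.
  congr 1
  · ring
  · field_simp; ring
  · field_simp; ring
  · field_simp; ring
  · simp only [coneOp, coneOff, coneDiag, Matrix.cons_val]
    field_simp
    ring
  · field_simp; ring

theorem coneHorizontal_isHorizontal (hk : k ∈ loops T (Fin 3 → ℝ)) (hpos : ∀ x, 0 < k x 0)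
    (ha : a ∈ loops T (Fin 3 → ℝ)) :
    IsHorizontal T algHL mcCone (fun x => mcCone (k x)) a (coneHorizontal k a) where
  mem := coneHorizontal_mem hk hpos ha
  pairing := coneHorizontal_pairing k a
  orthogonal := by
    rintro x ξ ⟨r₁, r₂, s, rfl⟩
    obtain ⟨p, r₁', r₂', h, -⟩ := coneHorizontal_hamiltonian hk hpos ha x
    simp only [h, tracePairing_alg]; ring

theorem lieBracket_coneHorizontal {b : ℝ → Fin 3 → ℝ} (hk : k ∈ loops T (Fin 3 → ℝ))
    (hpos : ∀ x, 0 < k x 0) (ha : a ∈ loops T (Fin 3 → ℝ)) (hb : b ∈ loops T (Fin 3 → ℝ)) :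
    lieBracket T (fun x => mcCone (k x)) (coneHorizontal k a) (coneHorizontal k b) =
      1 / 2 * ∫ x in (0 : ℝ)..T, dotPairing (b x) (coneOp k a x) := by
  have hk0 : (fun x => 1 / k x 0) ∈ loops T ℝ :=
    div_mem_loops (const_mem_loops 1) (coord_mem_loops hk 0) fun x => (hpos x).ne'
  have hd (i : Fin 3) : (fun x => k x i / k x 0) ∈ loops T ℝ :=
    div_mem_loops (coord_mem_loops hk i) (coord_mem_loops hk 0) fun x => (hpos x).ne'
  have hA (i : Fin 3) : (fun x => 1 / k x 0 * deriv (fun y => a y i) x) ∈ loops T ℝ :=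
    mul_mem_loops hk0 (deriv_mem_loops (coord_mem_loops ha i))
  have hB1 := mul_mem_loops hk0 (deriv_mem_loops (hA 1))
  have hC (i : Fin 3) := mul_mem_loops (hd i) (coord_mem_loops ha i)
  -- The entry `p` of the Hamiltonian vector field is `k₀ W / 2` and meets `b₁'` in the bracket.
  -- Integrating by parts moves the derivative onto `W`; the component `a₀` then drops out, and `b₀`
  -- never appears.
  have hW := sub_mem_loops (sub_mem_loops (add_mem_loops hB1 (coord_mem_loops ha 0)) (hC 1)) (hC 2)
  have hWb := mul_mem_loops (mul_mem_loops (const_mem_loops (1 / 2)) hW) (coord_mem_loops hb 1)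
  have D {f : ℝ → ℝ} (hf : f ∈ loops T ℝ) (x : ℝ) := hasDerivAt_of_smooth hf.1 x
  have hpt (x : ℝ) : 1 / 2 * dotPairing (b x) (coneOp k a x) =
      tracePairing (deriv (coneHorizontal k a) x + (mcCone (k x) * coneHorizontal k a x -
        coneHorizontal k a x * mcCone (k x))) (coneHorizontal k b x) - deriv (fun x => 1 / 2 *
          (1 / k x 0 * deriv (fun y => 1 / k y 0 * deriv (fun z => a z 1) y) x + a x 0 -
          k x 1 / k x 0 * a x 1 - k x 2 / k x 0 * a x 2) * b x 1) x := by
    obtain ⟨p, r₁, r₂, h, hp, hr₁, hr₂⟩ := coneHorizontal_hamiltonian hk hpos ha x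
    have dW := (((((D hB1 x).add (D (coord_mem_loops ha 0) x)).sub (D (hC 1) x)).sub
      (D (hC 2) x)).const_mul (1 / 2)).mul (D (coord_mem_loops hb 1) x)
    have dW' : deriv (fun x => 1 / 2 *
          (1 / k x 0 * deriv (fun y => 1 / k y 0 * deriv (fun z => a z 1) y) x + a x 0 -
          k x 1 / k x 0 * a x 1 - k x 2 / k x 0 * a x 2) * b x 1) x = _ := dW.deriv
    rw [h, dW', coneHorizontal, tracePairing_alg, hp, hr₁, hr₂]
    have hk0x := (hpos x).ne'
    simp only [coneOp, coneOff, coneDiag, dotPairing, dotProduct, Fin.sum_univ_three,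
      Matrix.cons_val, Pi.add_apply, Pi.sub_apply]
    field_simp
    ring
  have hX := coneHorizontal_mem hk hpos ha
  have hK := contDiff_mcCone hk.1
  rw [← intervalIntegral.integral_const_mul]
  simp only [hpt]
  rw [intervalIntegral.integral_sub, integral_deriv_loop hWb, sub_zero, lieBracket]
  · refine (contDiff_tracePairing ((contDiff_deriv_mat hX.1.1).add
      ((contDiff_matMul hK hX.1.1).sub (contDiff_matMul hX.1.1 hK)))
      (coneHorizontal_mem hk hpos hb).1.1).continuous.intervalIntegrable _ _
  · exact (contDiff_deriv hWb.1).continuous.intervalIntegrable _ _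

end Horizontal

/-! ### The reduced brackets as explicit operators. -/

section Brackets

variable {T : ℝ}

theorem coneBracket_iff (hT : 0 < T) {h f : coneInvariants T → ℝ} {k : coneInvariants T}
    {a b : ℝ → Fin 3 → ℝ} (ha : a ∈ loops T (Fin 3 → ℝ)) (hb : b ∈ loops T (Fin 3 → ℝ))
    (hha : HasVarDeriv T dotPairing h k a) (hfb : HasVarDeriv T dotPairing f k b) (v : ℝ) :
    ConeBracket T h f k v ↔
      v = 1 / 2 * ∫ x in (0 : ℝ)..T, dotPairing (b x) (coneOp k.1 a x) := by
  obtain ⟨hk, hpos⟩ := mem_coneInvariants_iff.1 k.2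
  rw [← lieBracket_coneHorizontal hk hpos ha hb]
  exact (cone_isCrossSection T).reducedBracket_iff hT (coneHorizontal_isHorizontal hk hpos ha)
    (coneHorizontal_isHorizontal hk hpos hb) hha hfb v

theorem entry_mem_loops {X : ℝ → Mat4} (hX : X ∈ algLoops T) (i j : Fin 4) :
    (fun x => 2 * X x i j) ∈ loops T ℝ :=
  ⟨contDiff_const.mul (contDiff_entry hX.1.1 i j), fun x => by simp only [hX.1.2 x]⟩

theorem vec_mem_loops {n : ℕ} {a : ℝ → Fin n → ℝ} (ha : ∀ i, (fun x => a x i) ∈ loops T ℝ) :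
    a ∈ loops T (Fin n → ℝ) :=
  ⟨contDiff_pi.2 fun i => (ha i).1, fun x => funext fun i => (ha i).2 x⟩

theorem exists_varDeriv_of_coneExtension {h : coneInvariants T → ℝ} {k : coneInvariants T}
    {F : gaugeDomain T HL (coneInvariants T) mcCone → ℝ}
    (hF : IsInvariantExtension T HL (coneInvariants T) mcCone h F)
    {L : gaugeDomain T HL (coneInvariants T) mcCone} (hL : L.1 = fun x => mcCone (k.1 x))
    {X : ℝ → Mat4} (hXm : X ∈ algLoops T) (hX : HasVarDeriv T tracePairing F L X) :
    ∃ a ∈ loops T (Fin 3 → ℝ), HasVarDeriv T dotPairing h k a := by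
  refine ⟨fun x => ![2 * X x 1 0, 2 * X x 0 1, 2 * X x 0 2], vec_mem_loops fun i => ?_,
    (cone_isCrossSection T).hasVarDeriv_of_extension hF hL (fun x w => ?_) hX⟩
  · fin_cases i
    exacts [entry_mem_loops hXm 1 0, entry_mem_loops hXm 0 1, entry_mem_loops hXm 0 2]
  · rw [eq_alg_of_mem_so31 (hXm.2 x), mcCone_eq_alg, tracePairing_alg]
    simp [dotPairing, dotProduct, Fin.sum_univ_three, alg]; ring

/-- Definedness of the bracket already supplies variational derivatives on the invariants. The
Poisson property and both directions of the equivalence can therefore be checked on the explicit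
operators. -/
theorem ConeBracket.exists_varDeriv {h f : coneInvariants T → ℝ} {k : coneInvariants T} {v : ℝ}
    (hv : ConeBracket T h f k v) :
    ∃ a ∈ loops T (Fin 3 → ℝ), ∃ b ∈ loops T (Fin 3 → ℝ),
      HasVarDeriv T dotPairing h k a ∧ HasVarDeriv T dotPairing f k b := by
  obtain ⟨F, G, hF, hG, L, hL, X, hX, Y, hY, hFX, hGY, -⟩ := hv
  obtain ⟨a, ha, hha⟩ := exists_varDeriv_of_coneExtension hF hL hX hFX
  obtain ⟨b, hb, hfb⟩ := exists_varDeriv_of_coneExtension hG hL hY hGY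
  exact ⟨a, ha, b, hb, hha, hfb⟩

theorem SphereBracket.exists_varDeriv {h f : sphereInvariants T → ℝ} {κ : sphereInvariants T}
    {v : ℝ} (hv : SphereBracket T h f κ v) :
    ∃ a ∈ loops T (Fin 2 → ℝ), ∃ b ∈ loops T (Fin 2 → ℝ),
      HasVarDeriv T dotPairing h κ a ∧ HasVarDeriv T dotPairing f κ b := by
  obtain ⟨F, G, hF, hG, L, hL, X, hX, Y, hY, hFX, hGY, -⟩ := hv
  have key {X : ℝ → Mat4} (hX : X ∈ algLoops T) :
      (fun x => ![2 * X x 0 1, 2 * X x 0 2]) ∈ loops T (Fin 2 → ℝ) ∧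
      ∀ x w, tracePairing (X x) (mcSphereL w) = dotPairing ![2 * X x 0 1, 2 * X x 0 2] w := by
    refine ⟨vec_mem_loops fun i => ?_, fun x w => ?_⟩
    · fin_cases i
      exacts [entry_mem_loops hX 0 1, entry_mem_loops hX 0 2]
    · rw [eq_alg_of_mem_so31 (hX.2 x), mcSphereL, mcCone_eq_alg, tracePairing_alg]
      simp [dotPairing, dotProduct, alg]; ring
  exact ⟨_, (key hX).1, _, (key hY).1,
    (sphere_isCrossSection T).hasVarDeriv_of_extension hF hL (key hX).2 hFX,
    (sphere_isCrossSection T).hasVarDeriv_of_extension hG hL (key hY).2 hGY⟩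

theorem coneDiag_one (κ : ℝ → Fin 2 → ℝ) (a : ℝ → ℝ) :
    coneDiag (fun x => ![1, κ x 0, κ x 1]) a = diagP κ a := by
  funext x
  simp only [coneDiag, diagP, Matrix.cons_val, div_one, one_mul, iteratedDeriv_succ,
    iteratedDeriv_zero]
  ring

theorem coneOff_one (κ : ℝ → Fin 2 → ℝ) (a : ℝ → ℝ) :
    coneOff (fun x => ![1, κ x 0, κ x 1]) a = offP κ a := by
  funext x
  simp only [coneOff, offP, Matrix.cons_val, div_one]
  ring

theorem dotPairing_coneOp_one (κ : ℝ → Fin 2 → ℝ) (a b : ℝ → Fin 3 → ℝ) (x : ℝ) :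
    dotPairing (b x) (coneOp (fun x => ![1, κ x 0, κ x 1]) a x) =
      dotPairing ![b x 1, b x 2] (opP κ (fun x => ![a x 1, a x 2]) x) := by
  simp [dotPairing, dotProduct, Fin.sum_univ_three, coneOp, opP, coneDiag_one, coneOff_one]

/-- The lift of a covector on the sphere invariants whose horizontal element for the cross section
of the cone is horizontal for the cross section of the sphere. -/
noncomputable def sphereLift (κ a : ℝ → Fin 2 → ℝ) (x : ℝ) : Fin 3 → ℝ :=
  ![κ x 0 * a x 0 + κ x 1 * a x 1 - deriv (deriv fun y => a y 0) x, a x 0, a x 1]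

theorem sphereLift_mem_loops {κ a : ℝ → Fin 2 → ℝ} (hκ : κ ∈ loops T (Fin 2 → ℝ))
    (ha : a ∈ loops T (Fin 2 → ℝ)) : sphereLift κ a ∈ loops T (Fin 3 → ℝ) := by
  have h1 := coord_mem_loops hκ
  have h2 := coord_mem_loops ha
  refine vec_mem_loops fun i => ?_
  fin_cases i
  exacts [sub_mem_loops (add_mem_loops (mul_mem_loops (h1 0) (h2 0)) (mul_mem_loops (h1 1) (h2 1)))
    (deriv_mem_loops (deriv_mem_loops (h2 0))), h2 0, h2 1]

theorem sphereLift_isHorizontal {κ a : ℝ → Fin 2 → ℝ} (hκ : κ ∈ loops T (Fin 2 → ℝ))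
    (ha : a ∈ loops T (Fin 2 → ℝ)) :
    IsHorizontal T algHM mcSphereL (fun x => mcSphere (κ x)) a
      (coneHorizontal (fun x => ![1, κ x 0, κ x 1]) (sphereLift κ a)) := by
  have hk := loop_cons_one_iff.2 hκ
  have hl := sphereLift_mem_loops hκ ha
  have hpos (x : ℝ) : 0 < (![1, κ x 0, κ x 1] : Fin 3 → ℝ) 0 := by simp
  refine ⟨coneHorizontal_mem hk hpos hl, fun x w => ?_, ?_⟩
  · rw [mcSphereL, coneHorizontal_pairing]
    simp [dotPairing, dotProduct, Fin.sum_univ_three, sphereLift]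
  · rintro x ξ ⟨p, r₁, r₂, s, rfl⟩
    obtain ⟨p', r₁', r₂', h, hp, -⟩ := coneHorizontal_hamiltonian hk hpos hl x
    -- For `k₀ = 1` the vanishing of `p` is an algebraic equation for the free component of the
    -- covector, and `sphereLift` is its solution.
    have hp0 : p' = 0 := by
      rw [hp]
      simp only [sphereLift, Matrix.cons_val, div_one, one_mul]
      ring
    simp only [mcSphere, h, tracePairing_alg, hp0]; ring

/-- Horizontal elements for the sphere are cone horizontal elements of lifted covectors. The
component added by the lift does not enter the cone operator, whose remaining block at `k₀ = 1` is
`P`. -/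
theorem sphereBracket_iff (hT : 0 < T) {h f : sphereInvariants T → ℝ} {κ : sphereInvariants T}
    {a b : ℝ → Fin 2 → ℝ} (ha : a ∈ loops T (Fin 2 → ℝ)) (hb : b ∈ loops T (Fin 2 → ℝ))
    (hha : HasVarDeriv T dotPairing h κ a) (hfb : HasVarDeriv T dotPairing f κ b) (v : ℝ) :
    SphereBracket T h f κ v ↔
      v = 1 / 2 * ∫ x in (0 : ℝ)..T, dotPairing (b x) (opP κ.1 a x) := by
  have hκ := mem_sphereInvariants_iff.1 κ.2
  have hpos (x : ℝ) : 0 < (![1, κ.1 x 0, κ.1 x 1] : Fin 3 → ℝ) 0 := by simp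
  have hform := lieBracket_coneHorizontal (loop_cons_one_iff.2 hκ) hpos
    (sphereLift_mem_loops hκ ha) (sphereLift_mem_loops hκ hb)
  simp only [dotPairing_coneOp_one] at hform
  have hcomp (a : ℝ → Fin 2 → ℝ) (x : ℝ) :
      ![sphereLift κ.1 a x 1, sphereLift κ.1 a x 2] = a x := by
    ext i; fin_cases i <;> rfl
  simp only [hcomp] at hform
  rw [← hform]
  exact (sphere_isCrossSection T).reducedBracket_iff hT (sphereLift_isHorizontal hκ ha)
    (sphereLift_isHorizontal hκ hb) hha hfb v

/-! ### The leaves of fixed `k₀` -/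

theorem HasVarDeriv.restrict {n : ℕ} {S N : Set (ℝ → Fin n → ℝ)} (hNS : N ⊆ S) {h : S → ℝ}
    {hN : N → ℝ} (hh : ∀ (s : S) (p : N), s.1 = p.1 → h s = hN p) {s : S} {p : N} (hsp : s.1 = p.1)
    {a : ℝ → Fin n → ℝ} (ha : HasVarDeriv T dotPairing h s a) :
    HasVarDeriv T dotPairing hN p a := by
  intro γ hγ hγ0
  have h1 := ha (fun ε => ⟨(γ ε).1, hNS (γ ε).2⟩) hγ (Subtype.ext (by rw [hγ0, hsp]))
  have e (ε : ℝ) : h ⟨(γ ε).1, hNS (γ ε).2⟩ = hN (γ ε) := hh _ (γ ε) rfl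
  simpa only [e] using h1

theorem SmoothFamily.deriv_apply {n : ℕ} {G : ℝ → ℝ → Fin n → ℝ} (hG : SmoothFamily G) (ε x : ℝ)
    (i : Fin n) : deriv (fun η => G η x) ε i = deriv (fun η => G η x i) ε :=
  (hasDerivAt_pi.1 (hasDerivAt_of_smooth (hG.left x) ε) i).deriv.symm

/-- The variation `w` does not move `k₀`, so the whole line `k + ε w` stays in the leaf; the two
derivatives along it differ by the integral of a sum of squares. The component along `k₀` is not
determined by the leaf. -/
theorem coneLeaf_varDeriv_unique (hT : 0 < T) {c : ℝ → ℝ} {h : coneLeaf T c → ℝ}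
    {k : coneLeaf T c} {a a' : ℝ → Fin 3 → ℝ} (ha : a ∈ loops T (Fin 3 → ℝ))
    (ha' : a' ∈ loops T (Fin 3 → ℝ)) (hha : HasVarDeriv T dotPairing h k a)
    (hha' : HasVarDeriv T dotPairing h k a') (x : ℝ) : a x 1 = a' x 1 ∧ a x 2 = a' x 2 := by
  obtain ⟨hk, hpos⟩ := mem_coneInvariants_iff.1 k.2.1
  set w : ℝ → Fin 3 → ℝ := fun x => ![0, a x 1 - a' x 1, a x 2 - a' x 2] with hw
  have hwl : w ∈ loops T (Fin 3 → ℝ) := by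
    refine vec_mem_loops fun i => ?_
    fin_cases i
    exacts [const_mem_loops 0, sub_mem_loops (coord_mem_loops ha 1) (coord_mem_loops ha' 1),
      sub_mem_loops (coord_mem_loops ha 2) (coord_mem_loops ha' 2)]
  have hsm (ε : ℝ) : ContDiff ℝ ∞ fun x => ε • w x := hwl.1.const_smul ε
  have hmem (ε : ℝ) : (fun x => k.1 x + ε • w x) ∈ coneLeaf T c :=
    ⟨mem_coneInvariants_iff.2 ⟨⟨hk.1.add (hsm ε),
      fun x => by simp only [hk.2 x, hwl.2 x]⟩, fun x => by simpa [hw] using hpos x⟩,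
      fun x => by simpa [hw] using k.2.2 x⟩
  let γ : ℝ → coneLeaf T c := fun ε => ⟨_, hmem ε⟩
  have hγ : IsSmoothPath γ :=
    (hk.1.comp contDiff_snd).add (contDiff_fst.smul (hwl.1.comp contDiff_snd))
  have hγ0 : γ 0 = k := Subtype.ext (by simp [γ])
  have hd (x : ℝ) : deriv (fun ε => (γ ε).1 x) 0 = w x := by
    have h := (((hasDerivAt_id (0 : ℝ)).smul_const (w x)).const_add (k.1 x)).deriv
    rw [one_smul] at h
    exact h
  have hdot {b : ℝ → Fin 3 → ℝ} (hb : b ∈ loops T (Fin 3 → ℝ)) :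
      ContDiff ℝ ∞ fun x => dotPairing (b x) (w x) := by
    simp only [dotPairing, dotProduct]
    exact ContDiff.sum fun i _ => (contDiff_pi.1 hb.1 i).mul (contDiff_pi.1 hwl.1 i)
  have heq := (hha γ hγ hγ0).unique (hha' γ hγ hγ0)
  simp only [hd] at heq
  rw [← sub_eq_zero, ← intervalIntegral.integral_sub ((hdot ha).continuous.intervalIntegrable _ _)
    ((hdot ha').continuous.intervalIntegrable _ _)] at heq
  have hval (x : ℝ) : dotPairing (a x) (w x) - dotPairing (a' x) (w x) =
      (a x 1 - a' x 1) ^ 2 + (a x 2 - a' x 2) ^ 2 := by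
    simp [dotPairing, dotProduct, Fin.sum_univ_three, hw]; ring
  have hz := eq_zero_of_integral_eq_zero hT ((hdot ha).sub (hdot ha')).continuous
    (fun x => by simp only [ha.2 x, ha'.2 x, hwl.2 x])
    (fun x => by simp only [hval]; positivity) heq x
  simp only [hval] at hz
  constructor
  · nlinarith [sq_nonneg (a x 1 - a' x 1), sq_nonneg (a x 2 - a' x 2)]
  · nlinarith [sq_nonneg (a x 1 - a' x 1), sq_nonneg (a x 2 - a' x 2)]

/-- The row and column of the operator belonging to `k₀` are zero; this is what makes the leaves
Poisson submanifolds. -/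
theorem dotPairing_coneOp_congr (k : ℝ → Fin 3 → ℝ) {a a' b b' : ℝ → Fin 3 → ℝ}
    (ha : ∀ x, a x 1 = a' x 1 ∧ a x 2 = a' x 2) (hb : ∀ x, b x 1 = b' x 1 ∧ b x 2 = b' x 2)
    (x : ℝ) : dotPairing (b x) (coneOp k a x) = dotPairing (b' x) (coneOp k a' x) := by
  simp [dotPairing, dotProduct, Fin.sum_univ_three, coneOp, (ha _).1, (ha _).2, (hb _).1, (hb _).2]

theorem coneLeaf_subset (c : ℝ → ℝ) : coneLeaf T c ⊆ coneInvariants T := fun _ h => h.1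

theorem coneLeaf_isPoissonSubmanifold (hT : 0 < T) (c : ℝ → ℝ) :
    IsPoissonSubmanifold (ConeBracket T) (coneLeaf T c) := by
  refine ⟨coneLeaf_subset c, fun h h' f f' hh hf s hs v v' hv hv' => ?_⟩
  obtain ⟨a, ha, b, hb, hha, hfb⟩ := hv.exists_varDeriv
  obtain ⟨a', ha', b', hb', hha', hfb'⟩ := hv'.exists_varDeriv
  rw [coneBracket_iff hT ha hb hha hfb] at hv
  rw [coneBracket_iff hT ha' hb' hha' hfb'] at hv'
  have key {h h' : coneInvariants T → ℝ} (hh : ∀ s : coneInvariants T, s.1 ∈ coneLeaf T c →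
      h s = h' s) {a a' : ℝ → Fin 3 → ℝ} (ha : a ∈ loops T (Fin 3 → ℝ))
      (ha' : a' ∈ loops T (Fin 3 → ℝ)) (hha : HasVarDeriv T dotPairing h s a)
      (hha' : HasVarDeriv T dotPairing h' s a') (x : ℝ) :
      a x 1 = a' x 1 ∧ a x 2 = a' x 2 := by
    refine coneLeaf_varDeriv_unique hT (k := ⟨s.1, hs⟩)
      (h := fun p => h ⟨p.1, coneLeaf_subset c p.2⟩) ha ha'
      (hha.restrict (coneLeaf_subset c) (fun s p e => congr_arg h (Subtype.ext e)) rfl)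
      (hha'.restrict (coneLeaf_subset c) (fun s p e => ?_) rfl) x
    rw [← hh s (by rw [e]; exact p.2)]
    exact congr_arg h (Subtype.ext e)
  rw [hv, hv']
  simp only [dotPairing_coneOp_congr s.1 (key hh ha ha' hha hha') (key hf hb hb' hfb hfb')]

/-- The extension is the pullback of `h` along the projection that replaces `k₀` by `c`, so its
variational derivative has no component along `k₀`. -/
theorem exists_coneLeaf_extension {c : ℝ → ℝ} (h : coneLeaf T c → ℝ) (k : coneLeaf T c)
    {a : ℝ → Fin 3 → ℝ} (ha : a ∈ loops T (Fin 3 → ℝ)) (hha : HasVarDeriv T dotPairing h k a) :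
    ∃ h' : coneInvariants T → ℝ, (∀ (s : coneInvariants T) (p : coneLeaf T c), s.1 = p.1 →
      h' s = h p) ∧ ∃ a' ∈ loops T (Fin 3 → ℝ), (∀ x, a' x 1 = a x 1 ∧ a' x 2 = a x 2) ∧
        HasVarDeriv T dotPairing h' ⟨k.1, k.2.1⟩ a' := by
  obtain ⟨hk, hpos⟩ := mem_coneInvariants_iff.1 k.2.1
  have hkc := k.2.2
  have hmem (s : coneInvariants T) : (fun x => ![c x, s.1 x 1, s.1 x 2]) ∈ coneLeaf T c := by
    obtain ⟨hs, -⟩ := mem_coneInvariants_iff.1 s.2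
    refine ⟨mem_coneInvariants_iff.2 ⟨vec_mem_loops fun i => ?_, fun x => ?_⟩, fun x => rfl⟩
    · fin_cases i
      · change c ∈ loops T ℝ
        rw [← funext hkc]; exact coord_mem_loops hk 0
      · exact coord_mem_loops hs 1
      · exact coord_mem_loops hs 2
    · change 0 < c x
      rw [← hkc]; exact hpos x
  have hself {s : ℝ → Fin 3 → ℝ} (hs : ∀ x, s x 0 = c x) :
      (fun x => ![c x, s x 1, s x 2]) = s := by
    funext x i; fin_cases i
    exacts [(hs x).symm, rfl, rfl]
  refine ⟨fun s => h ⟨_, hmem s⟩, fun s p e => congr_arg h (Subtype.ext ?_),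
    fun x => ![0, a x 1, a x 2], vec_mem_loops fun i => ?_, fun x => ⟨rfl, rfl⟩,
    fun γ hγ hγ0 => ?_⟩
  · exact (hself fun x => by rw [e]; exact p.2.2 x).trans e
  · fin_cases i
    exacts [const_mem_loops 0, coord_mem_loops ha 1, coord_mem_loops ha 2]
  · have hγ' : SmoothFamily fun ε => (γ ε).1 := hγ
    let γ' : ℝ → coneLeaf T c := fun ε => ⟨_, hmem (γ ε)⟩
    have hγs : IsSmoothPath γ' := by
      have hg := contDiff_pi.1 hγ
      refine contDiff_pi.2 fun i => ?_
      fin_cases i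
      · change ContDiff ℝ ∞ fun p : ℝ × ℝ => c p.2
        rw [← funext hkc]; exact (contDiff_pi.1 hk.1 0).comp contDiff_snd
      · exact hg 1
      · exact hg 2
    have hγs' : SmoothFamily fun ε => (γ' ε).1 := hγs
    have h1 := hha γ' hγs (Subtype.ext (by
      change (fun x => ![c x, (γ 0).1 x 1, (γ 0).1 x 2]) = k.1
      rw [hγ0]; exact hself hkc))
    refine h1.congr_deriv ?_
    congr 1; funext x
    simp only [dotPairing, dotProduct, Fin.sum_univ_three, hγ'.deriv_apply, hγs'.deriv_apply]
    simp [γ']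

theorem coneLeaf_bracket_iff (hT : 0 < T) {c : ℝ → ℝ} {h f : coneLeaf T c → ℝ}
    {k : coneLeaf T c} {a b : ℝ → Fin 3 → ℝ} (ha : a ∈ loops T (Fin 3 → ℝ))
    (hb : b ∈ loops T (Fin 3 → ℝ)) (hha : HasVarDeriv T dotPairing h k a)
    (hfb : HasVarDeriv T dotPairing f k b) (v : ℝ) :
    InducedBracket (ConeBracket T) (coneLeaf T c) h f k v ↔
      v = 1 / 2 * ∫ x in (0 : ℝ)..T, dotPairing (b x) (coneOp k.1 a x) := by
  constructor
  · rintro ⟨h', f', hh, hf, s, hs, hv⟩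
    obtain ⟨a', ha', b', hb', hha', hfb'⟩ := hv.exists_varDeriv
    rw [coneBracket_iff hT ha' hb' hha' hfb'] at hv
    have ea := coneLeaf_varDeriv_unique hT ha' ha (hha'.restrict (coneLeaf_subset c) hh hs) hha
    have eb := coneLeaf_varDeriv_unique hT hb' hb (hfb'.restrict (coneLeaf_subset c) hf hs) hfb
    rw [hv, hs]
    simp only [dotPairing_coneOp_congr k.1 ea eb]
  · rintro rfl
    obtain ⟨h', hh, a', ha', ea, hha'⟩ := exists_coneLeaf_extension h k ha hha
    obtain ⟨f', hf, b', hb', eb, hfb'⟩ := exists_coneLeaf_extension f k hb hfb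
    refine ⟨h', f', hh, hf, ⟨k.1, k.2.1⟩, rfl, (coneBracket_iff hT ha' hb' hha' hfb' _).2 ?_⟩
    simp only [dotPairing_coneOp_congr k.1 ea eb]

/-! ### The Poisson equivalence -/

/-- The bijection `(1, k₁, k₂) ↦ (k₁, k₂)` induced by the projectivization. -/
def leafEquiv (T : ℝ) : coneInvariantsOne T ≃ sphereInvariants T where
  toFun k := ⟨fun x => ![k.1 x 1, k.1 x 2], mem_sphereInvariants_iff.2 (vec_mem_loops fun i => by
    have hk := (mem_coneInvariants_iff.1 k.2.1).1
    fin_cases i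
    exacts [coord_mem_loops hk 1, coord_mem_loops hk 2])⟩
  invFun κ := ⟨fun x => ![1, κ.1 x 0, κ.1 x 1], mem_coneInvariants_iff.2
    ⟨loop_cons_one_iff.2 (mem_sphereInvariants_iff.1 κ.2), fun x => by simp⟩, fun x => rfl⟩
  left_inv k := Subtype.ext (funext fun x => by
    ext i; fin_cases i
    exacts [(k.2.2 x).symm, rfl, rfl])
  right_inv κ := Subtype.ext (funext fun x => by
    ext i; fin_cases i <;> rfl)

theorem leafEquiv_cons (k : coneInvariantsOne T) :
    k.1 = fun x => ![1, (leafEquiv T k).1 x 0, (leafEquiv T k).1 x 1] :=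
  congr_arg Subtype.val ((leafEquiv T).left_inv k).symm

theorem hasVarDeriv_comp_leafEquiv {h : sphereInvariants T → ℝ} {k : coneInvariantsOne T}
    {a : ℝ → Fin 2 → ℝ} (ha : HasVarDeriv T dotPairing h (leafEquiv T k) a) :
    HasVarDeriv T dotPairing (h ∘ leafEquiv T) k (fun x => ![0, a x 0, a x 1]) := by
  intro γ hγ hγ0
  have hγ' : SmoothFamily fun ε => (γ ε).1 := hγ
  have hs : IsSmoothPath fun ε => leafEquiv T (γ ε) := by
    have hg := contDiff_pi.1 hγ
    refine contDiff_pi.2 fun i => ?_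
    fin_cases i
    exacts [hg 1, hg 2]
  have hs' : SmoothFamily fun ε => (leafEquiv T (γ ε)).1 := hs
  refine (ha _ hs (by rw [hγ0])).congr_deriv ?_
  congr 1; funext x
  simp only [dotPairing, dotProduct, Fin.sum_univ_three, Fin.sum_univ_two, hγ'.deriv_apply,
    hs'.deriv_apply]
  simp [leafEquiv]

theorem hasVarDeriv_of_comp_leafEquiv {h : sphereInvariants T → ℝ} {k : coneInvariantsOne T}
    {a : ℝ → Fin 3 → ℝ} (ha : HasVarDeriv T dotPairing (h ∘ leafEquiv T) k a) :
    HasVarDeriv T dotPairing h (leafEquiv T k) (fun x => ![a x 1, a x 2]) := by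
  intro γ hγ hγ0
  have hγ' : SmoothFamily fun ε => (γ ε).1 := hγ
  have hs : IsSmoothPath fun ε => (leafEquiv T).symm (γ ε) := by
    have hg := contDiff_pi.1 hγ
    refine contDiff_pi.2 fun i => ?_
    fin_cases i
    exacts [contDiff_const, hg 0, hg 1]
  have hs' : SmoothFamily fun ε => ((leafEquiv T).symm (γ ε)).1 := hs
  have h1 := ha _ hs (by rw [hγ0, Equiv.symm_apply_apply])
  simp only [Function.comp_apply, Equiv.apply_symm_apply] at h1
  refine h1.congr_deriv ?_
  congr 1; funext x
  simp only [dotPairing, dotProduct, Fin.sum_univ_three, Fin.sum_univ_two, hγ'.deriv_apply,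
    hs'.deriv_apply]
  simp [leafEquiv]

/-- Whichever bracket is assumed to be defined provides variational derivatives, which are carried
across the bijection by dropping the component along `k₀` or setting it to zero. Both brackets are
then given by the same integral. -/
theorem leafEquiv_poisson (hT : 0 < T) (h f : sphereInvariants T → ℝ) (k : coneInvariantsOne T)
    (v : ℝ) :
    InducedBracket (ConeBracket T) (coneInvariantsOne T) (h ∘ leafEquiv T) (f ∘ leafEquiv T) k v ↔
      SphereBracket T h f (leafEquiv T k) v := by
  have hform (a b : ℝ → Fin 3 → ℝ) (x : ℝ) : dotPairing (b x) (coneOp k.1 a x) =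
      dotPairing ![b x 1, b x 2] (opP (leafEquiv T k).1 (fun x => ![a x 1, a x 2]) x) := by
    conv_lhs => rw [leafEquiv_cons k]
    exact dotPairing_coneOp_one _ a b x
  have hpair {a : ℝ → Fin 3 → ℝ} (ha : a ∈ loops T (Fin 3 → ℝ)) :
      (fun x => ![a x 1, a x 2]) ∈ loops T (Fin 2 → ℝ) := vec_mem_loops fun i => by
    fin_cases i
    exacts [coord_mem_loops ha 1, coord_mem_loops ha 2]
  constructor
  · intro hv
    obtain ⟨h', f', hh, hf, s, hs, hv'⟩ := id hv
    obtain ⟨a, ha, b, hb, hha, hfb⟩ := hv'.exists_varDeriv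
    have hha := hha.restrict (coneLeaf_subset _) hh hs
    have hfb := hfb.restrict (coneLeaf_subset _) hf hs
    rw [coneLeaf_bracket_iff hT ha hb hha hfb] at hv
    rw [sphereBracket_iff hT (hpair ha) (hpair hb) (hasVarDeriv_of_comp_leafEquiv hha)
      (hasVarDeriv_of_comp_leafEquiv hfb), hv]
    simp only [hform]
  · intro hv
    obtain ⟨a, ha, b, hb, hha, hfb⟩ := hv.exists_varDeriv
    have hcons {a : ℝ → Fin 2 → ℝ} (ha : a ∈ loops T (Fin 2 → ℝ)) :
        (fun x => ![0, a x 0, a x 1]) ∈ loops T (Fin 3 → ℝ) := vec_mem_loops fun i => by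
      fin_cases i
      exacts [const_mem_loops 0, coord_mem_loops ha 0, coord_mem_loops ha 1]
    have heta (a : ℝ → Fin 2 → ℝ) (x : ℝ) : ![a x 0, a x 1] = a x := by
      ext i; fin_cases i <;> rfl
    rw [sphereBracket_iff hT ha hb hha hfb] at hv
    rw [coneLeaf_bracket_iff hT (hcons ha) (hcons hb) (hasVarDeriv_comp_leafEquiv hha)
      (hasVarDeriv_comp_leafEquiv hfb), hv]
    have hval (x : ℝ) : dotPairing ![0, b x 0, b x 1]
        (coneOp k.1 (fun x => ![0, a x 0, a x 1]) x) =
        dotPairing (b x) (opP (leafEquiv T k).1 a x) := by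
      refine (hform (fun x => ![0, a x 0, a x 1]) (fun x => ![0, b x 0, b x 1]) x).trans ?_
      exact congr_arg₂ dotPairing (heta b x)
        (congr_arg (fun a => opP (leafEquiv T k).1 a x) (funext (heta a)))
    simp only [hval]

end Brackets

end ConeSphere

theorem mainTheorem2 (T : ℝ) (hT : 0 < T) :
    -- the spaces of invariants
    (∀ k : ℝ → Fin 3 → ℝ,
      k ∈ coneInvariants T ↔ k ∈ loops T (Fin 3 → ℝ) ∧ ∀ x, 0 < k x 0) ∧
    (∀ κ : ℝ → Fin 2 → ℝ, κ ∈ sphereInvariants T ↔ κ ∈ loops T (Fin 2 → ℝ)) ∧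
    -- the geometric bracket on the cone invariants is well defined, with the explicit operator
    (∀ (h f : coneInvariants T → ℝ) (k : coneInvariants T),
      ∀ a ∈ loops T (Fin 3 → ℝ), ∀ b ∈ loops T (Fin 3 → ℝ),
      HasVarDeriv T dotPairing h k a → HasVarDeriv T dotPairing f k b →
      ∀ v : ℝ, ConeBracket T h f k v ↔
        v = 1 / 2 * ∫ x in (0 : ℝ)..T, dotPairing (b x) (coneOp k.1 a x)) ∧
    -- the geometric bracket on the sphere invariants is well defined, with operator `P`
    (∀ (h f : sphereInvariants T → ℝ) (κ : sphereInvariants T),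
      ∀ a ∈ loops T (Fin 2 → ℝ), ∀ b ∈ loops T (Fin 2 → ℝ),
      HasVarDeriv T dotPairing h κ a → HasVarDeriv T dotPairing f κ b →
      ∀ v : ℝ, SphereBracket T h f κ v ↔
        v = 1 / 2 * ∫ x in (0 : ℝ)..T, dotPairing (b x) (opP κ.1 a x)) ∧
    -- the sets of fixed `k₀` are Poisson submanifolds, with the bracket given by the same operator
    (∀ c : ℝ → ℝ, IsPoissonSubmanifold (ConeBracket T) (coneLeaf T c) ∧
      ∀ (h f : coneLeaf T c → ℝ) (k : coneLeaf T c),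
        ∀ a ∈ loops T (Fin 3 → ℝ), ∀ b ∈ loops T (Fin 3 → ℝ),
        HasVarDeriv T dotPairing h k a → HasVarDeriv T dotPairing f k b →
        ∀ v : ℝ, InducedBracket (ConeBracket T) (coneLeaf T c) h f k v ↔
          v = 1 / 2 * ∫ x in (0 : ℝ)..T, dotPairing (b x) (coneOp k.1 a x)) ∧
    -- projectivization induces a Poisson equivalence of the leaf `k₀ = 1` with the sphere invariants
    ∃ Φ : coneInvariantsOne T ≃ sphereInvariants T,
      (∀ (k : coneInvariantsOne T) (x : ℝ), (Φ k).1 x = ![k.1 x 1, k.1 x 2]) ∧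
      (∀ (u : ℝ → Vec4) (hu : IsConeCurve T u), IsArcLength u →
        IsSphereCurve T (projectivize u hu.ne_zero) ∧
        ∃ k : coneInvariantsOne T, (∀ k', HasConeInvariants u k' ↔ k' = k.1) ∧
          ∀ κ', HasSphereInvariants (projectivize u hu.ne_zero) κ' ↔ κ' = (Φ k).1) ∧
      (∀ (h f : sphereInvariants T → ℝ) (k : coneInvariantsOne T) (v : ℝ),
        InducedBracket (ConeBracket T) (coneInvariantsOne T) (h ∘ Φ) (f ∘ Φ) k v ↔
          SphereBracket T h f (Φ k) v) := by
  refine ⟨fun _ => mem_coneInvariants_iff, fun _ => mem_sphereInvariants_iff,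
    fun h f k a ha b hb hha hfb => coneBracket_iff hT ha hb hha hfb,
    fun h f κ a ha b hb hha hfb => sphereBracket_iff hT ha hb hha hfb,
    fun c => ⟨coneLeaf_isPoissonSubmanifold hT c,
      fun h f k a ha b hb hha hfb => coneLeaf_bracket_iff hT ha hb hha hfb⟩,
    leafEquiv T, fun _ _ => rfl, fun u hu ha => ⟨hu.isSphereCurve, ?_⟩, leafEquiv_poisson hT⟩
  obtain ⟨k, hk⟩ := exists_coneInvariants hu ha
  refine ⟨k, hk, fun κ' => ?_⟩
  rw [hasSphereInvariants_iff hu.smooth hu.ne_zero hu.null ha, hk]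
  constructor
  · intro h
    funext x i
    have hx := congr_fun h x
    fin_cases i
    exacts [congr_fun hx 1, congr_fun hx 2]
  · rintro rfl
    exact (leafEquiv_cons k).symm
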